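/- Theorem (th-3SATtorandkone): The 3SAT problem is reducible in polynomial time to the unital bilinear feasibility problem. Here an instance of 3SAT is a finite list of clauses, each a disjunction of three literals (Boolean variables or negated Boolean variables; repetitions are allowed), and the question is whether some truth assignment makes every clause true. An instance of unital bilinear feasibility consists of integers $n\ge 1$ and $m\ge 0$ and matrices $V_1,\dots,V_m\in\mathbb{C}^{n\times n}$ with rational entries that satisfy $$\sum_{i=1}^m V_i^*V_i=I_n ,$$ and the question is whether there are nonzero vectors $x,y\in\mathbb{C}^n$ such that $$x^{T}V_iy=0\qquad\text{for all } i=1,\dots,m .$$ That is, there is a map $f$ from 3SAT instances to instances of unital bilinear feasibility such that $f$ is computed by a Turing machine in a number of steps bounded by a polynomial in the length of its input, and such that, for every instance $\varphi$, the formula $\varphi$ is satisfiable if and only if the bilinear system of $f(\varphi)$ has a solution with $x\ne 0$ and $y\ne 0$. Instances are written as strings over a finite alphabet: a formula is written as the list of its literals, clause by clause, each given by its sign and the index of its variable in binary; an instance of unital bilinear feasibility is written as $n$ and $m$ in unary, followed by all the entries of the matrices, each given by its sign and its numerator and denominator (in lowest terms) in binary. -/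

import Mathlib

open Matrix

namespace UnitalFeas

/-! ### Decision problems and polynomial-time many-one reductions -/

/-- A decision problem: a type of instances, each of them written as a string over a finite
alphabet (different instances as different strings), and the set of yes-instances. -/
structure DecisionProblem where
  /-- the instances -/
  Inst : Type
  /-- the alphabet -/
  Sym : Type
  symFintype : Fintype Sym
  /-- the string that represents an instance -/
  encode : Inst → List Sym
  encode_injective : Function.Injective encode
  /-- the instances whose answer is yes -/
  Yes : Inst → Prop

/-- `P` is reducible in polynomial time to `Q`: some map from instances of `P` to instances of `Q`
preserves the answer and is computed by a Turing machine, on the strings that represent the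
instances, in a number of steps polynomial in the length of the input string. -/
def PolyTimeReducible (P Q : DecisionProblem) : Prop :=
  ∃ f : P.Inst → Q.Inst,
    Nonempty (Turing.TM2ComputableInPolyTime P.encode Q.encode f) ∧
    ∀ a : P.Inst, P.Yes a ↔ Q.Yes (f a)

/-! ### Strings

The alphabet is `Option Bool`: the two bits `some false`, `some true` and a separator `none`. -/

/-- A natural number in binary, followed by a separator. -/
def encodeNatSep (k : ℕ) : List (Option Bool) :=
  (Computability.encodeNat k).map some ++ [none]

/-- A natural number in unary, followed by a separator. -/
def encodeUnarySep (k : ℕ) : List (Option Bool) :=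
  List.replicate k (some true) ++ [none]

/-- A rational number: a sign bit, then the numerator and the denominator (in lowest terms),
both in binary. -/
def encodeRat (q : ℚ) : List (Option Bool) :=
  some (decide (q < 0)) :: (encodeNatSep q.num.natAbs ++ encodeNatSep q.den)

/-- `e` is a prefix code: a string can start with at most one code word. -/
def IsPrefixCode {α : Type} (e : α → List (Option Bool)) : Prop :=
  ∀ a b s t, e a ++ s = e b ++ t → a = b ∧ s = t

theorem sep_aux : ∀ (u v : List Bool) (s t : List (Option Bool)),
    u.map some ++ none :: s = v.map some ++ none :: t → u = v ∧ s = t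
  | [], [], s, t, h => by simpa using h
  | [], _ :: _, s, t, h => by simp at h
  | _ :: _, [], s, t, h => by simp at h
  | x :: u, y :: v, s, t, h => by
      simp only [List.map_cons, List.cons_append, List.cons.injEq, Option.some.injEq] at h
      obtain ⟨h1, h2⟩ := sep_aux u v s t h.2
      exact ⟨by rw [h.1, h1], h2⟩

theorem isPrefixCode_encodeNatSep : IsPrefixCode encodeNatSep := by
  intro a b s t h
  simp only [encodeNatSep, List.append_assoc, List.singleton_append] at h
  obtain ⟨h1, h2⟩ := sep_aux _ _ _ _ h
  refine ⟨?_, h2⟩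
  have h3 := congrArg Computability.decodeNat h1
  simpa using h3

theorem isPrefixCode_encodeUnarySep : IsPrefixCode encodeUnarySep := by
  intro a b s t h
  have hr : ∀ k, List.replicate k (some true) = (List.replicate k true).map some := by simp
  simp only [encodeUnarySep, List.append_assoc, List.singleton_append, hr] at h
  obtain ⟨h1, h2⟩ := sep_aux _ _ _ _ h
  refine ⟨?_, h2⟩
  have h3 := congrArg List.length h1
  simpa using h3

theorem isPrefixCode_encodeRat : IsPrefixCode encodeRat := by
  intro a b s t h
  simp only [encodeRat, List.cons_append, List.append_assoc, List.cons.injEq,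
    Option.some.injEq, decide_eq_decide] at h
  obtain ⟨h0, h⟩ := h
  obtain ⟨h1, h⟩ := isPrefixCode_encodeNatSep _ _ _ _ h
  obtain ⟨h2, h⟩ := isPrefixCode_encodeNatSep _ _ _ _ h
  refine ⟨?_, h⟩
  rw [← Rat.num_neg, ← Rat.num_neg] at h0
  exact Rat.ext (by omega) h2

theorem flatMap_aux {ι α : Type} {e : α → List (Option Bool)} (he : IsPrefixCode e)
    (f g : ι → α) : ∀ (l : List ι) (s t : List (Option Bool)),
    (l.flatMap fun i => e (f i)) ++ s = (l.flatMap fun i => e (g i)) ++ t →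
      (∀ i ∈ l, f i = g i) ∧ s = t
  | [], s, t, h => by simpa using h
  | i :: l, s, t, h => by
      simp only [List.flatMap_cons, List.append_assoc] at h
      obtain ⟨h1, h2⟩ := he _ _ _ _ h
      obtain ⟨h3, h4⟩ := flatMap_aux he f g l s t h2
      refine ⟨?_, h4⟩
      intro j hj
      rcases List.mem_cons.1 hj with rfl | hj
      · exact h1
      · exact h3 j hj

theorem isPrefixCode_family {α : Type} {e : α → List (Option Bool)} (he : IsPrefixCode e)
    (k : ℕ) : IsPrefixCode fun f : Fin k → α => (List.finRange k).flatMap fun i => e (f i) := by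
  intro f g s t h
  obtain ⟨h1, h2⟩ := flatMap_aux he f g _ s t h
  exact ⟨funext fun i => h1 i (List.mem_finRange i), h2⟩

theorem flatMap_injective {α : Type} {e : α → List (Option Bool)} (he : IsPrefixCode e)
    (hne : ∀ a, e a ≠ []) : Function.Injective fun l : List α => l.flatMap e
  | [], [], _ => rfl
  | [], b :: l', h => by
      have h' := h.symm
      simp [hne] at h'
  | a :: l, [], h => by simp [hne] at h
  | a :: l, b :: l', h => by
      simp only [List.flatMap_cons] at h
      obtain ⟨h1, h2⟩ := he _ _ _ _ h
      rw [h1, flatMap_injective he hne h2]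

/-! ### 3SAT -/

/-- A literal: the variable with index `var`, negated when `pos = false`. -/
structure Literal where
  var : ℕ
  pos : Bool

/-- A clause is a disjunction of three literals. -/
abbrev Clause : Type := Fin 3 → Literal

/-- An instance of 3SAT: the conjunction of the clauses in a finite list. -/
abbrev Formula3 : Type := List Clause

/-- A literal holds under an assignment of truth values to the variables. -/
def Literal.Holds (σ : ℕ → Bool) (l : Literal) : Prop := σ l.var = l.pos

/-- A formula is satisfiable: some assignment makes a literal of every clause true. -/
def Satisfiable (φ : Formula3) : Prop :=
  ∃ σ : ℕ → Bool, ∀ c ∈ φ, ∃ i : Fin 3, (c i).Holds σ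

/-- A literal: its sign bit, then the index of its variable in binary. -/
def encodeLiteral (l : Literal) : List (Option Bool) :=
  some l.pos :: encodeNatSep l.var

/-- A clause: its three literals in order. -/
def encodeClause (c : Clause) : List (Option Bool) :=
  (List.finRange 3).flatMap fun i => encodeLiteral (c i)

/-- A formula: its clauses in order. -/
def encodeFormula (φ : Formula3) : List (Option Bool) :=
  φ.flatMap encodeClause

theorem isPrefixCode_encodeLiteral : IsPrefixCode encodeLiteral := by
  rintro ⟨v, p⟩ ⟨w, q⟩ s t h
  simp only [encodeLiteral, List.cons_append, List.cons.injEq, Option.some.injEq] at h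
  obtain ⟨h1, h2⟩ := isPrefixCode_encodeNatSep _ _ _ _ h.2
  exact ⟨by rw [h.1, h1], h2⟩

theorem encodeFormula_injective : Function.Injective encodeFormula :=
  flatMap_injective (isPrefixCode_family isPrefixCode_encodeLiteral 3) fun c => by
    simp [encodeClause, encodeLiteral, List.finRange_succ]

/-- The 3SAT problem. -/
def threeSAT : DecisionProblem where
  Inst := Formula3
  Sym := Option Bool
  symFintype := inferInstance
  encode := encodeFormula
  encode_injective := encodeFormula_injective
  Yes := Satisfiable

/-! ### Unital bilinear feasibility -/

/-- A rational matrix, seen as a complex matrix. -/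
noncomputable def toComplex {n : ℕ} (A : Matrix (Fin n) (Fin n) ℚ) :
    Matrix (Fin n) (Fin n) ℂ :=
  A.map fun q : ℚ => (q : ℂ)

/-- An instance: integers `n ≥ 1` and `m`, and complex `n × n` matrices `V 0, …, V (m - 1)`
with rational entries such that `∑ V_i^* V_i = I`. -/
structure UnitalInstance where
  n : ℕ
  n_pos : 0 < n
  m : ℕ
  V : Fin m → Matrix (Fin n) (Fin n) ℚ
  unital : ∑ i, (toComplex (V i))ᴴ * toComplex (V i) = 1

/-- The system `x^T V_i y = 0`, `i = 1, …, m`, has a solution in complex vectors `x ≠ 0`,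
`y ≠ 0`. -/
def UnitalInstance.Feasible (I : UnitalInstance) : Prop :=
  ∃ x y : Fin I.n → ℂ, x ≠ 0 ∧ y ≠ 0 ∧ ∀ i, x ⬝ᵥ (toComplex (I.V i) *ᵥ y) = 0

/-- A family of matrices: all the entries in order, matrix by matrix and row by row. -/
def encodeMatrices (n m : ℕ) (V : Fin m → Matrix (Fin n) (Fin n) ℚ) : List (Option Bool) :=
  (List.finRange m).flatMap fun i => (List.finRange n).flatMap fun r =>
    (List.finRange n).flatMap fun c => encodeRat (V i r c)

/-- An instance: `n` and `m`, then all the entries of the matrices. Since all `m n ^ 2` entries are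
listed, writing `n` and `m` in unary changes the length of the string by at most a constant
factor. -/
def encodeUnitalInstance (I : UnitalInstance) : List (Option Bool) :=
  encodeUnarySep I.n ++ encodeUnarySep I.m ++ encodeMatrices I.n I.m I.V

theorem encodeUnitalInstance_injective : Function.Injective encodeUnitalInstance := by
  rintro ⟨n, hn, m, V, hV⟩ ⟨n', hn', m', V', hV'⟩ h
  simp only [encodeUnitalInstance, List.append_assoc] at h
  obtain ⟨rfl, h⟩ := isPrefixCode_encodeUnarySep _ _ _ _ h
  obtain ⟨rfl, h⟩ := isPrefixCode_encodeUnarySep _ _ _ _ h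
  have hc : IsPrefixCode (encodeMatrices n m) :=
    isPrefixCode_family (isPrefixCode_family (isPrefixCode_family isPrefixCode_encodeRat n) n) m
  have h1 := (hc V V' [] [] (by simpa using h)).1
  subst h1
  rfl

/-- The unital bilinear feasibility problem. -/
def unitalBilinearFeasibility : DecisionProblem where
  Inst := UnitalInstance
  Sym := Option Bool
  symFintype := inferInstance
  encode := encodeUnitalInstance
  encode_injective := encodeUnitalInstance_injective
  Yes := UnitalInstance.Feasible

end UnitalFeas

/-!
A formula with `k` clauses becomes a bilinear system in `n = 3 * k + 2` coordinates: a junk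
coordinate `0`, a homogenizing coordinate `1`, and one coordinate for each of the `3 * k` literal
occurrences. Write `X` and `Y` for the two unknown vectors. The equations (`Sol`) are, up to nonzero
factors:

* `X 0 * Y c = 0` for all `c`, so that `X 0 = 0`;
* `X i * Y j - X j * Y i = 0` for all `i < j`, so that `X` and `Y` are proportional;
* `X i * Y j + X j * Y i = 0` whenever `i` and `j` are complementary literals or two literals of the
  same clause, so that `X i = 0` or `X j = 0`;
* `(X a + X b + X c - X 1) * Y d = 0` for all `d` and every clause with literals `a`, `b`, `c`, so
  that `X a + X b + X c = X 1`.

If `X 1` were `0`, then in each clause at most one coordinate would be nonzero while all three sum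
to `0`, and `X` would vanish. So each clause has exactly one literal with a nonzero coordinate, and
no two of these are complementary: they can be made true together (`Sol.satisfiable`). Conversely,
if each clause has a true literal, the indicator vector of one such choice, with `X 1 = 1`, solves
the system (`exists_sol`).

To make the system unital without irrational entries, each of these conditions (a *slot*) is
realized by a family of matrices indexed by the coordinates whose Gram matrices `Vᵀ V` sum to a
multiple of the identity. The condition on a clause has four coefficients `1` or `-1`; placing them
in column `d`, for each `d`, gives the sum `4`. The matrix of a condition on `i` and `j` has Gram
matrix `E_ii + E_jj`, which is completed by the matrices `E_0c` of the harmless equations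
`X 0 * Y c = 0`, for `c ≠ i, j`. Slot number `s` is scaled by `2 ^ (-s)` (by `2 ^ (-s - 1)` for a
clause) and used three times, so that the first `T` slots contribute
`3 * ∑ 4 ^ (-s) = 1 - 4 ^ (-T)`. One more family, of the matrices `E_0c`, scaled by `2 ^ (-T)`,
makes up the difference (`gram_matrices`).

Polynomial running time is proved for an explicit program in a small structured language (`Prog`)
for machines with several stacks, which is compiled to a machine of Mathlib's model `TM2` with a
count of steps (`computableInPolyTime`). A slot is stored as a word of `n` coefficients together
with a mode. All denominators are powers of `2`, whose binary codes are written by running down a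
unary counter, and every loop empties a stack, so that the steps are bounded by an explicit
polynomial (`exec_reduction`). The output is pushed onto a stack and hence produced backwards, which
is why the words list the coordinates in reverse order (`revGet`).
-/

namespace UnitalFeas

open Turing

/-! ### A structured language for machines with several stacks -/

/-- Structured programs acting on finitely many stacks, indexed by `K`, with entries in `α`, and on
a finite memory `σ`. -/
inductive Prog (K α σ : Type)
  /-- push a symbol that depends on the memory -/
  | push (k : K) (f : σ → α)
  /-- pop a symbol, if there is one, and update the memory accordingly -/
  | pop (k : K) (f : σ → Option α → σ)
  /-- look at the top symbol and update the memory accordingly -/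
  | peek (k : K) (f : σ → Option α → σ)
  /-- update the memory -/
  | load (f : σ → σ)
  /-- sequential composition -/
  | seq (p q : Prog K α σ)
  /-- case distinction -/
  | ite (b : σ → Bool) (p q : Prog K α σ)
  /-- pop a symbol from stack `k` and update the memory by `f`; if `ok` holds then, run the body and
  start again, otherwise stop -/
  | loop (k : K) (f : σ → Option α → σ) (ok : σ → Bool) (p : Prog K α σ)

namespace Prog

variable {K α σ : Type}

/-- The labels of the machine code of a program. -/
def Lab : Prog K α σ → Type
  | push _ _ | pop _ _ | peek _ _ | load _ => Unit
  | seq p q => Lab p ⊕ Lab q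
  | ite _ p q => Option (Lab p ⊕ Lab q)
  | loop _ _ _ p => Option (Lab p)

/-- The label at which the machine code of a program is entered. -/
def entry : (p : Prog K α σ) → Lab p
  | push _ _ | pop _ _ | peek _ _ | load _ => ()
  | seq p _ => Sum.inl (entry p)
  | ite _ _ _ => none
  | loop _ _ _ _ => none

/-- There are finitely many labels. -/
@[reducible]
def fintypeLab : (p : Prog K α σ) → Fintype (Lab p)
  | push _ _ | pop _ _ | peek _ _ | load _ => inferInstanceAs (Fintype Unit)
  | seq p q =>
    have := fintypeLab p
    have := fintypeLab q
    inferInstanceAs (Fintype (Lab p ⊕ Lab q))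
  | ite _ p q =>
    have := fintypeLab p
    have := fintypeLab q
    inferInstanceAs (Fintype (Option (Lab p ⊕ Lab q)))
  | loop _ _ _ p =>
    have := fintypeLab p
    inferInstanceAs (Fintype (Option (Lab p)))

/-- Jump to a label, where `none` stands for halting. -/
def jump {Λ : Type} : Option Λ → TM2.Stmt (fun _ : K => α) Λ σ
  | none => .halt
  | some l => .goto fun _ => l

/-- The machine code of a program inside a larger machine with labels `Λ`: the labels of the
program are placed by `ι`, and control is passed to `ex` at the end. -/
def code {Λ : Type} : (p : Prog K α σ) → (Lab p → Λ) → Option Λ → Lab p →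
    TM2.Stmt (fun _ : K => α) Λ σ
  | push k f, _, ex, _ => .push k f (jump ex)
  | pop k f, _, ex, _ => .pop k f (jump ex)
  | peek k f, _, ex, _ => .peek k f (jump ex)
  | load f, _, ex, _ => .load f (jump ex)
  | seq p q, ι, _, Sum.inl l => code p (fun x => ι (Sum.inl x)) (some (ι (Sum.inr (entry q)))) l
  | seq _ q, ι, ex, Sum.inr l => code q (fun x => ι (Sum.inr x)) ex l
  | ite b p q, ι, _, none =>
    .branch b (jump (some (ι (some (Sum.inl (entry p))))))
      (jump (some (ι (some (Sum.inr (entry q))))))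
  | ite _ p _, ι, ex, some (Sum.inl l) => code p (fun x => ι (some (Sum.inl x))) ex l
  | ite _ _ q, ι, ex, some (Sum.inr l) => code q (fun x => ι (some (Sum.inr x))) ex l
  | loop k f ok p, ι, ex, none =>
    .pop k f (.branch ok (jump (some (ι (some (entry p))))) (jump ex))
  | loop _ _ _ p, ι, _, some l => code p (fun x => ι (some x)) (some (ι none)) l

variable [DecidableEq K]

/-- The machine `M` gets from `c` to `c'` in at most `t` steps. -/
def Reach {Λ : Type} (M : Λ → TM2.Stmt (fun _ : K => α) Λ σ)
    (c c' : TM2.Cfg (fun _ : K => α) Λ σ) (t : ℕ) : Prop :=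
  ∃ t' ≤ t, (flip bind (TM2.step M))^[t'] (some c) = some c'

theorem Reach.trans {Λ : Type} {M : Λ → TM2.Stmt (fun _ : K => α) Λ σ}
    {c₁ c₂ c₃ : TM2.Cfg (fun _ : K => α) Λ σ} {t₁ t₂ : ℕ}
    (h₁ : Reach M c₁ c₂ t₁) (h₂ : Reach M c₂ c₃ t₂) : Reach M c₁ c₃ (t₁ + t₂) := by
  obtain ⟨a, ha, h₁⟩ := h₁
  obtain ⟨b, hb, h₂⟩ := h₂
  refine ⟨b + a, by omega, ?_⟩
  rw [Function.iterate_add_apply, h₁, h₂]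

theorem Reach.single {Λ : Type} {M : Λ → TM2.Stmt (fun _ : K => α) Λ σ}
    {c c' : TM2.Cfg (fun _ : K => α) Λ σ} (h : TM2.step M c = some c') : Reach M c c' 1 :=
  ⟨1, le_rfl, h⟩

/-- Started with memory `v` and stacks `S`, the program `p` stops with memory `v'` and stacks `S'`
after at most `t` machine steps, wherever its code is placed. -/
def Runs (p : Prog K α σ) (v : σ) (S : K → List α) (v' : σ) (S' : K → List α) (t : ℕ) : Prop :=
  ∀ (Λ : Type) (M : Λ → TM2.Stmt (fun _ : K => α) Λ σ) (ι : Lab p → Λ) (ex : Option Λ),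
    (∀ l, M (ι l) = code p ι ex l) → Reach M ⟨some (ι (entry p)), v, S⟩ ⟨ex, v', S'⟩ t

theorem stepAux_jump {Λ : Type} (ex : Option Λ) (v : σ) (S : K → List α) :
    TM2.stepAux (jump ex) v S = ⟨ex, v, S⟩ := by
  cases ex <;> rfl

theorem Runs.mono {p : Prog K α σ} {v v' : σ} {S S' : K → List α} {t t' : ℕ}
    (h : Runs p v S v' S' t) (ht : t ≤ t') : Runs p v S v' S' t' := by
  intro Λ M ι ex hM
  obtain ⟨a, ha, h⟩ := h Λ M ι ex hM
  exact ⟨a, ha.trans ht, h⟩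

theorem Runs.push (k : K) (f : σ → α) (v : σ) (S : K → List α) :
    Runs (.push k f) v S v (Function.update S k (f v :: S k)) 1 := by
  intro Λ M ι ex hM
  apply Reach.single
  rw [TM2.step, hM]
  simp [code, stepAux_jump]

theorem Runs.pop (k : K) (f : σ → Option α → σ) (v : σ) (S : K → List α) :
    Runs (.pop k f) v S (f v (S k).head?) (Function.update S k (S k).tail) 1 := by
  intro Λ M ι ex hM
  apply Reach.single
  rw [TM2.step, hM]
  simp [code, stepAux_jump]

theorem Runs.peek (k : K) (f : σ → Option α → σ) (v : σ) (S : K → List α) :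
    Runs (.peek k f) v S (f v (S k).head?) S 1 := by
  intro Λ M ι ex hM
  apply Reach.single
  rw [TM2.step, hM]
  simp [code, stepAux_jump]

theorem Runs.load (f : σ → σ) (v : σ) (S : K → List α) : Runs (.load f) v S (f v) S 1 := by
  intro Λ M ι ex hM
  apply Reach.single
  rw [TM2.step, hM]
  simp [code, stepAux_jump]

theorem Runs.seq {p q : Prog K α σ} {v₁ v₂ v₃ : σ} {S₁ S₂ S₃ : K → List α} {t₁ t₂ : ℕ}
    (h₁ : Runs p v₁ S₁ v₂ S₂ t₁) (h₂ : Runs q v₂ S₂ v₃ S₃ t₂) :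
    Runs (.seq p q) v₁ S₁ v₃ S₃ (t₁ + t₂) := by
  intro Λ M ι ex hM
  exact (h₁ Λ M (fun x => ι (Sum.inl x)) (some (ι (Sum.inr (entry q))))
    fun l => hM (Sum.inl l)).trans (h₂ Λ M (fun x => ι (Sum.inr x)) ex fun l => hM (Sum.inr l))

theorem Runs.ite_true {b : σ → Bool} {p q : Prog K α σ} {v v' : σ} {S S' : K → List α} {t : ℕ}
    (hb : b v = true) (h : Runs p v S v' S' t) : Runs (.ite b p q) v S v' S' (t + 1) := by
  intro Λ M ι ex hM
  rw [add_comm]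
  refine Reach.trans (Reach.single ?_)
    (h Λ M (fun x => ι (some (Sum.inl x))) ex fun l => hM (some (Sum.inl l)))
  rw [TM2.step, hM]
  simp [code, entry, stepAux_jump, hb]

theorem Runs.ite_false {b : σ → Bool} {p q : Prog K α σ} {v v' : σ} {S S' : K → List α} {t : ℕ}
    (hb : b v = false) (h : Runs q v S v' S' t) : Runs (.ite b p q) v S v' S' (t + 1) := by
  intro Λ M ι ex hM
  rw [add_comm]
  refine Reach.trans (Reach.single ?_)
    (h Λ M (fun x => ι (some (Sum.inr x))) ex fun l => hM (some (Sum.inr l)))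
  rw [TM2.step, hM]
  simp [code, entry, stepAux_jump, hb]

theorem Runs.loop_stop {k : K} {f : σ → Option α → σ} {ok : σ → Bool} {p : Prog K α σ} {v : σ}
    {S : K → List α} (hS : S k = []) (hok : ok (f v none) = false) :
    Runs (.loop k f ok p) v S (f v none) S 1 := by
  intro Λ M ι ex hM
  apply Reach.single
  rw [TM2.step, hM]
  have : Function.update S k [] = S := by rw [← hS, Function.update_eq_self]
  simp [code, entry, stepAux_jump, hS, hok, this]

theorem Runs.loop_cons {k : K} {f : σ → Option α → σ} {ok : σ → Bool} {p : Prog K α σ}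
    {v v₁ v' : σ} {S S₁ S' : K → List α} {a : α} {l : List α} {t₁ t₂ : ℕ} (hS : S k = a :: l)
    (hok : ok (f v (some a)) = true)
    (h₁ : Runs p (f v (some a)) (Function.update S k l) v₁ S₁ t₁)
    (h₂ : Runs (.loop k f ok p) v₁ S₁ v' S' t₂) :
    Runs (.loop k f ok p) v S v' S' (t₁ + 1 + t₂) := by
  intro Λ M ι ex hM
  refine Reach.trans ?_ (h₂ Λ M ι ex hM)
  rw [add_comm]
  refine Reach.trans (Reach.single ?_)
    (h₁ Λ M (fun x => ι (some x)) (some (ι none)) fun l => hM (some l))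
  rw [TM2.step, hM]
  simp [code, entry, stepAux_jump, hS, hok]

/-- The machine that runs a program and halts. -/
def machine [Fintype K] [Fintype α] [Fintype σ] (p : Prog K α σ) (k₀ k₁ : K) (v₀ : σ) : FinTM2 where
  K := K
  k₀ := k₀
  k₁ := k₁
  Γ := fun _ => α
  Λ := Lab p
  main := entry p
  ΛFin := fintypeLab p
  σ := σ
  initialState := v₀
  Γk₀Fin := inferInstanceAs (Fintype α)
  m := code p id none

/-- A function is computable in polynomial time if some program turns the code of the argument on
stack `k₀` into the code of the value on stack `k₁`, and leaves everything else as it was. -/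
theorem computableInPolyTime [Fintype K] [Fintype α] [Fintype σ] {A B : Type}
    {ea : A → List α} {eb : B → List α} (f : A → B) (p : Prog K α σ) (k₀ k₁ : K) (v₀ : σ)
    (time : Polynomial ℕ)
    (h : ∀ a, Runs p v₀ (Function.update (fun _ => []) k₀ (ea a)) v₀
      (Function.update (fun _ => []) k₁ (eb (f a))) (time.eval (ea a).length)) :
    Nonempty (TM2ComputableInPolyTime ea eb f) := by
  have key : ∀ a, ∃ t' ≤ time.eval (ea a).length, ∀ l l', l = ea a → l' = eb (f a) →
      (flip bind (p.machine k₀ k₁ v₀).step)^[t'] (some (initList (p.machine k₀ k₁ v₀) l)) =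
        some (haltList (p.machine k₀ k₁ v₀) l') := by
    intro a
    obtain ⟨t, ht, h⟩ := h a (Lab p) (code p id none) id none fun _ => rfl
    refine ⟨t, ht, ?_⟩
    rintro _ _ rfl rfl
    -- `initList` and `haltList` fill the stacks by a dependent case distinction on their names;
    -- both are updates of the empty stacks.
    have e₁ : initList (p.machine k₀ k₁ v₀) (ea a) =
        ⟨some (entry p), v₀, Function.update (fun _ => []) k₀ (ea a)⟩ := by
      unfold initList
      congr 1
      refine funext fun (k : K) => ?_
      by_cases hk : k = k₀
      · subst hk
        exact (dif_pos rfl).trans (Function.update_self (β := fun _ => List α) k _ _).symm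
      · exact (dif_neg hk).trans
          (Function.update_of_ne (β := fun _ => List α) hk _ (fun _ => [])).symm
    have e₂ : haltList (p.machine k₀ k₁ v₀) (eb (f a)) =
        ⟨none, v₀, Function.update (fun _ => []) k₁ (eb (f a))⟩ := by
      unfold haltList
      congr 1
      refine funext fun (k : K) => ?_
      by_cases hk : k = k₁
      · subst hk
        exact (dif_pos rfl).trans (Function.update_self (β := fun _ => List α) k _ _).symm
      · exact (dif_neg hk).trans
          (Function.update_of_ne (β := fun _ => List α) hk _ (fun _ => [])).symm
    rw [e₁, e₂]
    exact h
  choose t ht hs using key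
  exact ⟨{
    tm := p.machine k₀ k₁ v₀
    inputAlphabet := Equiv.refl α
    outputAlphabet := Equiv.refl α
    time := time
    outputsFun := fun a =>
      { steps := t a
        evals_in_steps := hs a _ _ (List.map_id _) (List.map_id _)
        steps_le_m := ht a } }⟩

end Prog

open Prog

/-! ### The stacks and the memory of the machine -/

/-- The alphabet. In a word of coefficients, `none` stands for `0`, `some false` for `1` and
`some true` for `-1`. -/
abbrev Sym : Type := Option Bool

/-- Names for the stacks. -/
inductive Key
  | inp | out | a | b | x | y | t | c | c' | r | r' | d | d' | u | u' | sc | mc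
  deriving DecidableEq

instance : Fintype Key :=
  ⟨{.inp, .out, .a, .b, .x, .y, .t, .c, .c', .r, .r', .d, .d', .u, .u', .sc, .mc}, fun k => by
    cases k <;> simp⟩

/-- The contents of all stacks. `inp` and `out` hold input and output. The zipper `a`, `b`, `inp`
holds the input during the loops over its literals, `x` and `y` two literals to be compared. `c`,
`r`, `d` hold copies of the coefficient word of the current slot, over which the loops over
families, rows and columns run; `u` marks the current member of the family. `sc` holds the scale and
`mc` the number of matrices so far, in unary. `t` and the primed stacks take what a loop has popped,
so that it can be restored. -/
structure Stk where
  (inp out a b x y t c c' r r' d d' u u' sc mc : List Sym)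

/-- The stacks as a function of their names. -/
def Stk.fn (s : Stk) : Key → List Sym
  | .inp => s.inp | .out => s.out | .a => s.a | .b => s.b | .x => s.x | .y => s.y | .t => s.t
  | .c => s.c | .c' => s.c' | .r => s.r | .r' => s.r' | .d => s.d | .d' => s.d' | .u => s.u
  | .u' => s.u' | .sc => s.sc | .mc => s.mc

/-- Replace the contents of one stack. -/
def Stk.set (s : Stk) : Key → List Sym → Stk
  | .inp, l => { s with inp := l } | .out, l => { s with out := l } | .a, l => { s with a := l }
  | .b, l => { s with b := l } | .x, l => { s with x := l } | .y, l => { s with y := l }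
  | .t, l => { s with t := l } | .c, l => { s with c := l } | .c', l => { s with c' := l }
  | .r, l => { s with r := l } | .r', l => { s with r' := l } | .d, l => { s with d := l }
  | .d', l => { s with d' := l } | .u, l => { s with u := l } | .u', l => { s with u' := l }
  | .sc, l => { s with sc := l } | .mc, l => { s with mc := l }

theorem Stk.update_fn (s : Stk) (k : Key) (l : List Sym) :
    Function.update s.fn k l = (s.set k l).fn := by
  funext k'
  cases k <;> cases k' <;> rfl

theorem Stk.fn_set_self (s : Stk) (k : Key) (l : List Sym) : (s.set k l).fn k = l := by
  cases k <;> rfl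

theorem Stk.fn_set_of_ne (s : Stk) {k k' : Key} (h : k' ≠ k) (l : List Sym) :
    (s.set k l).fn k' = s.fn k' := by
  rw [← Stk.update_fn, Function.update_of_ne h]

theorem Stk.set_set (s : Stk) (k : Key) (l l' : List Sym) : (s.set k l).set k l' = s.set k l' := by
  cases k <;> rfl

theorem Stk.set_comm (s : Stk) {k k' : Key} (h : k ≠ k') (l l' : List Sym) :
    (s.set k l).set k' l' = (s.set k' l').set k l := by
  cases k <;> cases k' <;> first | rfl | exact absurd rfl h

theorem Stk.set_fn_self (s : Stk) (k : Key) : s.set k (s.fn k) = s := by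
  cases k <;> rfl

/-- The memory: registers for popped symbols (`none` if the stack was empty), a flag `j` for the
junk row, the mode of the current slot, a queue `q₁ q₂ q₃` of coefficients waiting to be written,
the position `cnt` in the current clause, and a flag `eq` for comparisons. -/
structure Mem where
  (z wc wr wd u : Option Sym)
  (j : Bool)
  (mode q₁ q₂ q₃ : Sym)
  (cnt : Fin 3)
  (eq : Bool)

noncomputable instance : Fintype Mem :=
  Fintype.ofInjective (fun v => ((v.z, v.wc, v.wr, v.wd, v.u, v.j), v.mode, v.q₁, v.q₂, v.q₃, v.cnt,
    v.eq)) fun v w h => by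
      cases v; cases w; simp_all

/-- `Prog.Runs` for the stacks at hand. -/
def Exec (p : Prog Key Sym Mem) (v : Mem) (s : Stk) (v' : Mem) (s' : Stk) (t : ℕ) : Prop :=
  Runs p v s.fn v' s'.fn t

theorem Exec.of_eq {p : Prog Key Sym Mem} {v v₁ v' : Mem} {s s₁ s' : Stk} {t t' : ℕ}
    (h : Exec p v s v₁ s₁ t) (hv : v₁ = v') (hs : s₁ = s') (ht : t ≤ t') : Exec p v s v' s' t' := by
  subst hv hs
  exact h.mono ht

theorem Exec.push (k : Key) (f : Mem → Sym) (v : Mem) (s : Stk) :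
    Exec (.push k f) v s v (s.set k (f v :: s.fn k)) 1 := by
  rw [Exec, ← Stk.update_fn]
  exact Runs.push k f v s.fn

theorem Exec.pop (k : Key) (f : Mem → Option Sym → Mem) (v : Mem) (s : Stk) :
    Exec (.pop k f) v s (f v (s.fn k).head?) (s.set k (s.fn k).tail) 1 := by
  rw [Exec, ← Stk.update_fn]
  exact Runs.pop k f v s.fn

theorem Exec.peek (k : Key) (f : Mem → Option Sym → Mem) (v : Mem) (s : Stk) :
    Exec (.peek k f) v s (f v (s.fn k).head?) s 1 :=
  Runs.peek k f v s.fn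

theorem Exec.load (f : Mem → Mem) (v : Mem) (s : Stk) : Exec (.load f) v s (f v) s 1 :=
  Runs.load f v s.fn

theorem Exec.seq {p q : Prog Key Sym Mem} {v₁ v₂ v₃ : Mem} {s₁ s₂ s₃ : Stk} {t₁ t₂ : ℕ}
    (h₁ : Exec p v₁ s₁ v₂ s₂ t₁) (h₂ : Exec q v₂ s₂ v₃ s₃ t₂) :
    Exec (.seq p q) v₁ s₁ v₃ s₃ (t₁ + t₂) :=
  Runs.seq h₁ h₂

theorem Exec.ite_true {b : Mem → Bool} {p q : Prog Key Sym Mem} {v v' : Mem} {s s' : Stk} {t : ℕ}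
    (hb : b v = true) (h : Exec p v s v' s' t) : Exec (.ite b p q) v s v' s' (t + 1) :=
  Runs.ite_true hb h

theorem Exec.ite_false {b : Mem → Bool} {p q : Prog Key Sym Mem} {v v' : Mem} {s s' : Stk} {t : ℕ}
    (hb : b v = false) (h : Exec q v s v' s' t) : Exec (.ite b p q) v s v' s' (t + 1) :=
  Runs.ite_false hb h

theorem Exec.loop_stop {k : Key} {f : Mem → Option Sym → Mem} {ok : Mem → Bool}
    {p : Prog Key Sym Mem} {v : Mem} {s : Stk} (hS : s.fn k = []) (hok : ok (f v none) = false) :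
    Exec (.loop k f ok p) v s (f v none) s 1 :=
  Runs.loop_stop hS hok

theorem Exec.loop_cons {k : Key} {f : Mem → Option Sym → Mem} {ok : Mem → Bool}
    {p : Prog Key Sym Mem} {v v₁ v' : Mem} {s s₁ s' : Stk} {e : Sym} {l : List Sym} {t₁ t₂ : ℕ}
    (hS : s.fn k = e :: l) (hok : ok (f v (some e)) = true)
    (h₁ : Exec p (f v (some e)) (s.set k l) v₁ s₁ t₁)
    (h₂ : Exec (.loop k f ok p) v₁ s₁ v' s' t₂) :
    Exec (.loop k f ok p) v s v' s' (t₁ + 1 + t₂) :=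
  Runs.loop_cons hS hok (by rw [Stk.update_fn]; exact h₁) h₂

/-- Sequential composition. -/
scoped infixr:60 " ;; " => Prog.seq

/-! ### Elementary programs -/

/-- For every symbol on stack `k`, popped into register `z`, run `p`. -/
def forZ (k : Key) (p : Prog Key Sym Mem) : Prog Key Sym Mem :=
  .loop k (fun v o => { v with z := o }) (fun v => v.z.isSome) p

/-- Empty stack `k` onto stack `k'`. -/
def move (k k' : Key) : Prog Key Sym Mem := forZ k (.push k' fun v => v.z.getD none)

theorem exec_move {k k' : Key} (h : k ≠ k') (v : Mem) (s : Stk) :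
    Exec (move k k') v s { v with z := none }
      ((s.set k []).set k' ((s.fn k).reverse ++ s.fn k')) (2 * (s.fn k).length + 1) := by
  generalize hl : s.fn k = l
  induction l generalizing v s with
  | nil =>
    refine Exec.of_eq (Exec.loop_stop hl rfl) rfl ?_ (by simp)
    rw [← hl, Stk.set_fn_self, hl, List.reverse_nil, List.nil_append, Stk.set_fn_self]
  | cons e l ih =>
    refine Exec.of_eq (Exec.loop_cons hl rfl (Exec.push _ _ _ _) (ih _ _ ?_)) rfl ?_ ?_
    · rw [Stk.fn_set_of_ne _ h, Stk.fn_set_self]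
    · simp [Stk.fn_set_of_ne _ h.symm, Stk.fn_set_self, Stk.set_comm _ h.symm, Stk.set_set]
    · simp; omega

/-- Empty stack `k`. -/
def clear (k : Key) : Prog Key Sym Mem := forZ k (.load id)

theorem exec_clear (k : Key) (v : Mem) (s : Stk) :
    Exec (clear k) v s { v with z := none } (s.set k []) (2 * (s.fn k).length + 1) := by
  generalize hl : s.fn k = l
  induction l generalizing v s with
  | nil =>
    refine Exec.of_eq (Exec.loop_stop hl rfl) rfl ?_ (by simp)
    rw [← hl, Stk.set_fn_self]
  | cons e l ih =>
    refine Exec.of_eq (Exec.loop_cons hl rfl (Exec.load _ _ _) (ih _ _ ?_)) rfl ?_ ?_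
    · rw [Stk.fn_set_self]
    · rw [Stk.set_set]
    · simp; omega

/-- Push the symbols of a list, the last one first. -/
def pushAll (k : Key) : List Sym → Prog Key Sym Mem
  | [] => .load id
  | e :: l => pushAll k l ;; .push k fun _ => e

theorem exec_pushAll (k : Key) (l : List Sym) (v : Mem) (s : Stk) :
    Exec (pushAll k l) v s v (s.set k (l ++ s.fn k)) (l.length + 1) := by
  induction l with
  | nil => exact Exec.of_eq (Exec.load _ _ _) rfl (Stk.set_fn_self s k).symm le_rfl
  | cons e l ih =>
    exact Exec.of_eq (ih.seq (Exec.push _ _ _ _)) rfl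
      (by rw [Stk.set_set, Stk.fn_set_self, List.cons_append]) le_rfl

/-! ### Writing the matrices of a slot -/

/-- The coefficient of a matrix of a slot: `wr` and `wd` are the coefficients of its row and column
in the word of the slot, `wc` is that of the column that belongs to this member of the family; `u`
tells whether the latter is the column at hand, `j` whether the row is the junk row.

In mode `none`, the word is written into the column of the member. In mode `some e`, the word is
that of a pair: the member of its positive coordinate `i` is `E_ij + E_ji` or `E_ij - E_ji`,
according to the sign `e`, that of its negative coordinate `j` is `0`, and the others have a single
entry, in the junk row and in the column of the member. -/
def coef (mode wc wr wd : Sym) (j u : Bool) : Sym :=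
  match mode with
  | none => if u then wr else none
  | some e =>
    match wc with
    | some false =>
      match wr, wd with
      | some false, some true => some false
      | some true, some false => some e
      | _, _ => none
    | some true => none
    | none => if u && j then some false else none

/-- The code of the rational number `0`, `2 ^ (-s)` or `-2 ^ (-s)`. -/
def entryStr (s : ℕ) : Sym → List Sym
  | none => [some false, none, some true, none]
  | some e => some e :: some true :: none :: (List.replicate s (some false) ++ [some true, none])

/-- The coefficient determined by the memory. -/
def Mem.coef (v : Mem) : Sym :=
  UnitalFeas.coef v.mode (v.wc.getD none) (v.wr.getD none) (v.wd.getD none) v.j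
    (decide (v.u = some (some true)))

/-- Write the current entry. -/
def emitEntry : Prog Key Sym Mem :=
  .ite (fun v => v.coef.isNone) (pushAll .out [some false, none, some true, none])
    (pushAll .out [some true, none] ;;
      forZ .sc ((.push .t fun _ => none) ;; .push .out fun _ => some false) ;;
      move .t .sc ;; pushAll .out [some true, none] ;; .push .out fun v => v.coef)

theorem exec_scale (n : ℕ) (v : Mem) (s : Stk) (hs : s.sc = List.replicate n none) :
    Exec (forZ .sc ((.push .t fun _ => none) ;; .push .out fun _ => some false)) v s
      { v with z := none }
      { s with
        sc := []
        t := List.replicate n none ++ s.t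
        out := List.replicate n (some false) ++ s.out } (3 * n + 1) := by
  induction n generalizing v s with
  | zero =>
    refine Exec.of_eq (Exec.loop_stop hs rfl) rfl ?_ (by simp)
    cases s; simp_all
  | succ n ih =>
    refine Exec.of_eq (Exec.loop_cons (l := List.replicate n none) hs rfl
      ((Exec.push _ _ _ _).seq (Exec.push _ _ _ _)) (ih _ _ rfl)) rfl ?_ (by omega)
    simp [Stk.set, Stk.fn, List.replicate_succ', List.append_assoc]

theorem exec_emitEntry {n : ℕ} {v : Mem} {s : Stk} (hv : v.z = none)
    (hs : s.sc = List.replicate n none) (ht : s.t = []) :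
    Exec emitEntry v s v { s with out := entryStr n v.coef ++ s.out } (5 * n + 15) := by
  cases hc : v.coef with
  | none =>
    refine Exec.of_eq (Exec.ite_true (by simp [hc]) (exec_pushAll .out _ v s)) rfl rfl (by simp)
  | some e =>
    -- In chains like this one, hypotheses on intermediate states are given as `by exact`, to be
    -- elaborated only after the states of consecutive programs have been unified.
    refine Exec.of_eq (Exec.ite_false (by simp [hc]) ((exec_pushAll .out _ v s).seq
      ((exec_scale n _ _ (by exact hs)).seq ((exec_move (k := .t) (k' := .sc) (by decide) _ _).seq
      ((exec_pushAll .out _ _ _).seq (Exec.push _ _ _ _)))))) ?_ ?_ ?_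
    · cases v; simp_all
    · have : (Mem.coef { v with z := none }) = some e := hc
      cases s; simp_all [Stk.set, Stk.fn, entryStr]
    · simp [Stk.set, Stk.fn, ht]; omega

/-- The entries of a row, in order, for words and markers in reverse order. -/
def rowStr (n : ℕ) (mode wc wr : Sym) (j : Bool) : List Sym → List Sym → List Sym
  | wd :: l, u :: m =>
    rowStr n mode wc wr j l m ++ entryStr n (coef mode wc wr wd j (decide (u = some true)))
  | _, _ => []

/-- Write a row. -/
def emitRow : Prog Key Sym Mem :=
  .loop .d (fun v o => { v with wd := o }) (fun v => v.wd.isSome)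
    ((.push .d' fun v => v.wd.getD none) ;; (.pop .u fun v o => { v with u := o }) ;;
      (.push .u' fun v => v.u.getD none) ;; emitEntry ;; .load fun v => { v with u := none }) ;;
  move .d' .d ;; move .u' .u

theorem exec_rowLoop {n : ℕ} (l m rest : List Sym) (hlm : l.length = m.length) {v : Mem} {s : Stk}
    (hz : v.z = none) (hu : v.u = none) (hsc : s.sc = List.replicate n none) (ht : s.t = [])
    (hd : s.d = l) (hsu : s.u = m ++ rest) :
    Exec (.loop .d (fun v o => { v with wd := o }) (fun v => v.wd.isSome)
        ((.push .d' fun v => v.wd.getD none) ;; (.pop .u fun v o => { v with u := o }) ;;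
          (.push .u' fun v => v.u.getD none) ;; emitEntry ;; .load fun v => { v with u := none }))
      v s { v with wd := none }
      { s with
        d := []
        d' := l.reverse ++ s.d'
        u := rest
        u' := m.reverse ++ s.u'
        out := rowStr n v.mode (v.wc.getD none) (v.wr.getD none) v.j l m ++ s.out }
      (l.length * (5 * n + 20) + 1) := by
  induction l generalizing m v s with
  | nil =>
    obtain rfl : m = [] := by simpa using hlm.symm
    refine Exec.of_eq (Exec.loop_stop hd rfl) rfl ?_ (by simp)
    cases s; simp_all [rowStr]
  | cons wd l ih =>
    obtain _ | ⟨u, m⟩ := m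
    · simp at hlm
    refine Exec.of_eq (Exec.loop_cons hd rfl ((Exec.push _ _ _ _).seq ((Exec.pop _ _ _ _).seq
      ((Exec.push _ _ _ _).seq ((exec_emitEntry ?_ (by exact hsc) (by exact ht)).seq
      (Exec.load _ _ _)))))
      (ih m ?_ ?_ ?_ (by exact hsc) (by exact ht) ?_ ?_)) ?_ ?_ ?_
    · exact hz
    · simpa using hlm
    · exact hz
    · rfl
    · rfl
    · simp [Stk.set, Stk.fn, hsu]
    · cases v; simp_all
    · simp [Stk.set, Stk.fn, hsu, rowStr, Mem.coef]
    · simp only [List.length_cons]; ring_nf; omega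

theorem exec_emitRow {n : ℕ} {l m rest : List Sym} (hlm : l.length = m.length) {v : Mem} {s : Stk}
    (hz : v.z = none) (hu : v.u = none) (hsc : s.sc = List.replicate n none) (ht : s.t = [])
    (hd : s.d = l) (hsu : s.u = m ++ rest) (hd' : s.d' = []) (hu' : s.u' = []) :
    Exec emitRow v s { v with wd := none }
      { s with out := rowStr n v.mode (v.wc.getD none) (v.wr.getD none) v.j l m ++ s.out }
      (l.length * (5 * n + 24) + 3) := by
  refine Exec.of_eq ((exec_rowLoop l m rest hlm (by exact hz) (by exact hu) (by exact hsc)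
    (by exact ht) (by exact hd) (by exact hsu)).seq ((exec_move (by decide) _ _).seq
    (exec_move (by decide) _ _))) ?_ ?_ ?_
  · cases v; simp_all
  · cases s; simp_all [Stk.set, Stk.fn]
  · simp [Stk.set, Stk.fn, hd', hu', ← hlm]; ring_nf; omega

/-- The rows of a matrix, in order, for words in reverse order; `j` tells whether the last one is
the junk row. -/
def rowsStr (n : ℕ) (mode wc : Sym) (l m : List Sym) : Bool → List Sym → List Sym
  | _, [] => []
  | j, wr :: k => rowsStr n mode wc l m false k ++ rowStr n mode wc wr j l m

/-- Write a matrix. -/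
def emitMatrix : Prog Key Sym Mem :=
  (.load fun v => { v with j := true }) ;;
  .loop .r (fun v o => { v with wr := o }) (fun v => v.wr.isSome)
    ((.push .r' fun v => v.wr.getD none) ;; emitRow ;; .load fun v => { v with j := false }) ;;
  (.load fun v => { v with j := false }) ;; move .r' .r ;; .push .mc fun _ => none

theorem exec_matrixLoop {n : ℕ} {l m rest : List Sym} (hlm : l.length = m.length) (k : List Sym)
    {v : Mem} {s : Stk}
    (hz : v.z = none) (hu : v.u = none) (hwd : v.wd = none) (hsc : s.sc = List.replicate n none)
    (ht : s.t = [])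
    (hd : s.d = l) (hsu : s.u = m ++ rest) (hd' : s.d' = []) (hu' : s.u' = []) (hr : s.r = k) :
    Exec (.loop .r (fun v o => { v with wr := o }) (fun v => v.wr.isSome)
        ((.push .r' fun v => v.wr.getD none) ;; emitRow ;; .load fun v => { v with j := false }))
      v s { v with wr := none, j := v.j && k.isEmpty }
      { s with
        r := []
        r' := k.reverse ++ s.r'
        out := rowsStr n v.mode (v.wc.getD none) l m v.j k ++ s.out }
      (k.length * (l.length * (5 * n + 24) + 6) + 1) := by
  induction k generalizing v s with
  | nil =>
    refine Exec.of_eq (Exec.loop_stop hr rfl) ?_ ?_ (by simp)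
    · cases v; simp_all
    · cases s; simp_all [rowsStr]
  | cons wr k ih =>
    refine Exec.of_eq (Exec.loop_cons hr rfl ((Exec.push _ _ _ _).seq
      ((exec_emitRow hlm ?_ ?_ (by exact hsc) (by exact ht) (by exact hd) (by exact hsu)
      (by exact hd') (by exact hu')).seq (Exec.load _ _ _)))
      (ih ?_ ?_ ?_ (by exact hsc) (by exact ht) (by exact hd) (by exact hsu) (by exact hd')
      (by exact hu') ?_)) ?_ ?_ ?_
    · exact hz
    · exact hu
    · exact hz
    · exact hu
    · rfl
    · rfl
    · cases v; simp_all
    · simp [Stk.set, Stk.fn, rowsStr]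
    · simp only [List.length_cons]; ring_nf; omega

theorem exec_emitMatrix {n : ℕ} {l m rest k : List Sym} (hlm : l.length = m.length)
    {v : Mem} {s : Stk}
    (hz : v.z = none) (hu : v.u = none) (hwd : v.wd = none) (hwr : v.wr = none)
    (hj : v.j = false) (hsc : s.sc = List.replicate n none) (ht : s.t = [])
    (hd : s.d = l) (hsu : s.u = m ++ rest) (hd' : s.d' = []) (hu' : s.u' = []) (hr : s.r = k)
    (hr' : s.r' = []) :
    Exec emitMatrix v s v
      { s with
        out := rowsStr n v.mode (v.wc.getD none) l m true k ++ s.out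
        mc := none :: s.mc }
      (k.length * (l.length * (5 * n + 24) + 8) + 5) := by
  refine Exec.of_eq ((Exec.load _ _ _).seq ((exec_matrixLoop hlm k ?_ ?_ ?_ (by exact hsc)
    (by exact ht) (by exact hd) (by exact hsu) (by exact hd') (by exact hu') (by exact hr)).seq
    ((Exec.load _ _ _).seq ((exec_move (by decide) _ _).seq (Exec.push _ _ _ _))))) ?_ ?_ ?_
  · exact hz
  · exact hu
  · exact hwd
  · cases v; simp_all
  · cases s; simp_all [Stk.set, Stk.fn]
  · simp [Stk.fn, hr']; ring_nf; omega

/-- The matrices of a family, in order, for words in reverse order. -/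
def blockStr (n : ℕ) (mode : Sym) (w : List Sym) : List Sym → List Sym → List Sym
  | _, [] => []
  | m, wc :: k =>
    blockStr n mode w (none :: m) k ++ rowsStr n mode wc w (m.take w.length) true w

/-- Write a family of matrices. -/
def emitBlock : Prog Key Sym Mem :=
  .loop .c (fun v o => { v with wc := o }) (fun v => v.wc.isSome)
    ((.push .c' fun v => v.wc.getD none) ;; emitMatrix ;; .push .u fun _ => none) ;;
  forZ .c' ((.push .c fun v => v.z.getD none) ;; .pop .u fun v _ => v)

/-- The registers that are used for writing words and matrices are empty. -/
structure Mem.Idle (v : Mem) : Prop where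
  z : v.z = none
  u : v.u = none
  wd : v.wd = none
  wr : v.wr = none
  wc : v.wc = none
  j : v.j = false
  q₁ : v.q₁ = none
  q₂ : v.q₂ = none
  q₃ : v.q₃ = none

theorem exec_blockLoop {n : ℕ} {w : List Sym} (m k : List Sym) (hm : w.length ≤ m.length)
    {v : Mem} {s : Stk}
    (hz : v.z = none) (hu : v.u = none) (hwd : v.wd = none) (hwr : v.wr = none)
    (hj : v.j = false) (hsc : s.sc = List.replicate n none) (ht : s.t = [])
    (hd : s.d = w) (hsu : s.u = m) (hd' : s.d' = []) (hu' : s.u' = []) (hr : s.r = w)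
    (hr' : s.r' = []) (hc : s.c = k) :
    Exec (.loop .c (fun v o => { v with wc := o }) (fun v => v.wc.isSome)
        ((.push .c' fun v => v.wc.getD none) ;; emitMatrix ;; .push .u fun _ => none))
      v s { v with wc := none }
      { s with
        c := []
        c' := k.reverse ++ s.c'
        u := List.replicate k.length none ++ m
        out := blockStr n v.mode w m k ++ s.out
        mc := List.replicate k.length none ++ s.mc }
      (k.length * (w.length * (w.length * (5 * n + 24) + 8) + 8) + 1) := by
  induction k generalizing m v s with
  | nil =>
    refine Exec.of_eq (Exec.loop_stop hc rfl) rfl ?_ (by simp)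
    cases s; simp_all [blockStr]
  | cons wc k ih =>
    refine Exec.of_eq (Exec.loop_cons hc rfl ((Exec.push _ _ _ _).seq
      ((exec_emitMatrix (m := m.take w.length) (rest := m.drop w.length) ?_ (by exact hz)
      (by exact hu) (by exact hwd) (by exact hwr) (by exact hj) (by exact hsc) (by exact ht)
      (by exact hd) ?_ (by exact hd') (by exact hu') (by exact hr) (by exact hr')).seq
      (Exec.push _ _ _ _)))
      (ih (none :: m) ?_ (by exact hz) (by exact hu) (by exact hwd) (by exact hwr) (by exact hj)
      (by exact hsc) (by exact ht) (by exact hd) ?_ (by exact hd') (by exact hu') (by exact hr)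
      (by exact hr') ?_)) rfl ?_ ?_
    · simpa using hm
    · simpa [Stk.set] using hsu
    · simp; omega
    · simp [Stk.set, Stk.fn, hsu]
    · rfl
    · simp [Stk.set, Stk.fn, blockStr, List.replicate_succ']
    · simp only [List.length_cons]; ring_nf; omega

theorem exec_blockRestore (k : List Sym) {m : List Sym} {v : Mem} {s : Stk}
    (hc' : s.c' = k) (hu : s.u = List.replicate k.length none ++ m) :
    Exec (forZ .c' ((.push .c fun v => v.z.getD none) ;; .pop .u fun v _ => v)) v s
      { v with z := none } { s with c' := [], c := k.reverse ++ s.c, u := m }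
      (3 * k.length + 1) := by
  induction k generalizing v s with
  | nil =>
    refine Exec.of_eq (Exec.loop_stop hc' rfl) rfl ?_ (by simp)
    cases s; simp_all
  | cons wc k ih =>
    refine Exec.of_eq (Exec.loop_cons hc' rfl ((Exec.push _ _ _ _).seq (Exec.pop _ _ _ _))
      (ih rfl ?_)) rfl ?_ ?_
    · simp [Stk.set, Stk.fn, hu, List.replicate_succ]
    · simp [Stk.set, Stk.fn]
    · simp; omega

theorem exec_emitBlock {n : ℕ} {w m : List Sym} (hm : w.length ≤ m.length)
    {v : Mem} {s : Stk} (hv : v.Idle) (hsc : s.sc = List.replicate n none) (ht : s.t = [])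
    (hd : s.d = w) (hsu : s.u = m) (hd' : s.d' = []) (hu' : s.u' = []) (hr : s.r = w)
    (hr' : s.r' = []) (hc : s.c = w) (hc' : s.c' = []) :
    Exec emitBlock v s v
      { s with
        out := blockStr n v.mode w m w ++ s.out
        mc := List.replicate w.length none ++ s.mc }
      (w.length * (w.length * (w.length * (5 * n + 24) + 8) + 11) + 2) := by
  obtain ⟨hz, hu, hwd, hwr, hwc, hj, -, -, -⟩ := hv
  refine Exec.of_eq ((exec_blockLoop m w hm (by exact hz) (by exact hu) (by exact hwd)
    (by exact hwr) (by exact hj) (by exact hsc) (by exact ht) (by exact hd) (by exact hsu)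
    (by exact hd') (by exact hu') (by exact hr) (by exact hr') hc).seq
    (exec_blockRestore (m := m) w.reverse ?_ ?_)) ?_ ?_ ?_
  · simp [hc']
  · simp
  · cases v; simp_all
  · cases s; simp_all
  · simp; ring_nf; omega

/-! ### Writing the slots -/

/-- The number of steps for a family of matrices of size `n` and scale `s`. -/
def blockTime {R : Type} [CommSemiring R] (n s : R) : R :=
  n * (n * (n * (5 * s + 24) + 8) + 11) + 2

/-- The number of steps for a slot. -/
def slotTime {R : Type} [CommSemiring R] (n s : R) : R :=
  3 * blockTime n (s + 2) + 8 * n + 16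

/-- The stacks used for writing slots are empty, except for the scale. -/
structure Stk.Clean (s : Stk) : Prop where
  t : s.t = []
  c : s.c = []
  c' : s.c' = []
  r : s.r = []
  r' : s.r' = []
  d : s.d = []
  d' : s.d' = []
  u : s.u = []
  u' : s.u' = []
  sc : s.sc = List.replicate s.sc.length none

/-- The stacks with the word `w` loaded. -/
def Stk.word (s : Stk) (w : List Sym) : Stk :=
  { s with c := w, r := w, d := w, u := List.replicate w.length none }

/-- The exponent of the denominators in a slot of scale `s`. Families of mode `none` are scaled down
once more, since each of their columns has four entries. -/
def expo (mode : Sym) (s : ℕ) : ℕ := if mode.isNone then s + 1 else s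

/-- The code of the family of matrices of a slot. -/
def familyStr (s : ℕ) (mode : Sym) (w : List Sym) : List Sym :=
  blockStr (expo mode s) mode w (some true :: List.replicate w.length none) w

/-- The stacks after writing a slot, given by its mode and its word: its family is written three
times. The scale is the number of the slot, counted from `1`. -/
def Stk.emit₁ (s : Stk) (p : Sym × List Sym) : Stk :=
  { s with
    out := familyStr (s.sc.length + 1) p.1 p.2 ++ (familyStr (s.sc.length + 1) p.1 p.2 ++
      (familyStr (s.sc.length + 1) p.1 p.2 ++ s.out))
    sc := none :: s.sc
    mc := List.replicate (3 * p.2.length) none ++ s.mc }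

/-- The stacks after writing a list of slots. -/
def Stk.emit (s : Stk) (l : List (Sym × List Sym)) : Stk := l.foldl Stk.emit₁ s

theorem Stk.emit_append (s : Stk) (l l' : List (Sym × List Sym)) :
    s.emit (l ++ l') = (s.emit l).emit l' := List.foldl_append

theorem Stk.Clean.emit₁ {s : Stk} (h : s.Clean) (p : Sym × List Sym) : (s.emit₁ p).Clean := by
  obtain ⟨h1, h2, h3, h4, h5, h6, h7, h8, h9, h10⟩ := h
  refine ⟨h1, h2, h3, h4, h5, h6, h7, h8, h9, ?_⟩
  simp only [Stk.emit₁, List.length_cons, List.replicate_succ]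
  rw [← h10]

theorem Stk.Clean.emit {s : Stk} (h : s.Clean) (l : List (Sym × List Sym)) : (s.emit l).Clean := by
  induction l generalizing s with
  | nil => exact h
  | cons p l ih => exact ih (h.emit₁ p)

theorem Stk.emit_eq (s : Stk) (l : List (Sym × List Sym)) :
    s.emit l = { s with
      out := (s.emit l).out, sc := (s.emit l).sc, mc := (s.emit l).mc } := by
  induction l generalizing s with
  | nil => rfl
  | cons p l ih => exact ih (s.emit₁ p)

theorem Stk.emit_sc_length (s : Stk) (l : List (Sym × List Sym)) :
    (s.emit l).sc.length = s.sc.length + l.length := by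
  induction l generalizing s with
  | nil => rfl
  | cons p l ih =>
    refine (ih (s.emit₁ p)).trans ?_
    simp [Stk.emit₁]; omega

/-- Emptying stacks that are not written to commutes with writing slots. -/
theorem Stk.emit_congr (s : Stk) (i a b x y : List Sym) (l : List (Sym × List Sym)) :
    ({ s with inp := i, a := a, b := b, x := x, y := y } : Stk).emit l =
      { s.emit l with inp := i, a := a, b := b, x := x, y := y } := by
  induction l generalizing s with
  | nil => rfl
  | cons p l ih => exact ih (s.emit₁ p)

/-- Prepare the marker of the first matrix of a family, and the scale. -/
def openSlot : Prog Key Sym Mem :=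
  (.push .u fun _ => some true) ;; (.push .sc fun _ => none) ;;
  .ite (fun v => v.mode.isNone) (.push .sc fun _ => none) (.load id)

/-- Remove the loaded word. -/
def closeSlot : Prog Key Sym Mem :=
  .ite (fun v => v.mode.isNone) (.pop .sc fun v _ => v) (.load id) ;;
  clear .c ;; clear .r ;; clear .d ;; clear .u

/-- Write the slot given by the loaded word and the mode in the memory. -/
def emitSlot : Prog Key Sym Mem :=
  openSlot ;; (emitBlock ;; emitBlock ;; emitBlock) ;; closeSlot

theorem exec_threeBlocks {n : ℕ} {w m : List Sym} (hm : w.length ≤ m.length)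
    {v : Mem} {s : Stk} (hv : v.Idle) (hsc : s.sc = List.replicate n none) (ht : s.t = [])
    (hd : s.d = w) (hsu : s.u = m) (hd' : s.d' = []) (hu' : s.u' = []) (hr : s.r = w)
    (hr' : s.r' = []) (hc : s.c = w) (hc' : s.c' = []) :
    Exec (emitBlock ;; emitBlock ;; emitBlock) v s v
      { s with
        out := blockStr n v.mode w m w ++
          (blockStr n v.mode w m w ++ (blockStr n v.mode w m w ++ s.out))
        mc := List.replicate (3 * w.length) none ++ s.mc }
      (3 * blockTime w.length n) := by
  refine Exec.of_eq ((exec_emitBlock hm hv hsc ht hd hsu hd' hu' hr hr' hc hc').seq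
    ((exec_emitBlock (w := w) (m := m) (n := n) hm hv ?_ ?_ ?_ ?_ ?_ ?_ ?_ ?_ ?_ ?_).seq
    (exec_emitBlock (w := w) (m := m) (n := n) hm hv ?_ ?_ ?_ ?_ ?_ ?_ ?_ ?_ ?_ ?_))) rfl ?_ ?_
  any_goals assumption
  · simp only [Stk.mk.injEq, true_and]
    rw [← List.append_assoc, ← List.append_assoc, ← List.replicate_add, ← List.replicate_add]
    congr 2
    ring
  · simp only [blockTime]
    ring_nf
    exact le_rfl

theorem exec_openSlot (v : Mem) (s : Stk) (h : s.sc = List.replicate s.sc.length none) :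
    Exec openSlot v s v
      { s with
        u := some true :: s.u
        sc := List.replicate (expo v.mode (s.sc.length + 1)) none } 4 := by
  generalize hn : s.sc.length = n at h
  cases hm : v.mode with
  | none =>
    refine Exec.of_eq ((Exec.push _ _ _ _).seq ((Exec.push _ _ _ _).seq
      (Exec.ite_true ?_ (Exec.push _ _ _ _)))) rfl ?_ le_rfl
    · simp [hm]
    · simp [Stk.set, Stk.fn, expo, List.replicate_succ, h]
  | some e =>
    refine Exec.of_eq ((Exec.push _ _ _ _).seq ((Exec.push _ _ _ _).seq
      (Exec.ite_false ?_ (Exec.load _ _ _)))) rfl ?_ le_rfl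
    · simp [hm]
    · simp [Stk.set, Stk.fn, expo, List.replicate_succ, h]

theorem exec_closeSlot (n : ℕ) (v : Mem) (s : Stk) (hv : v.z = none)
    (h : s.sc = List.replicate (expo v.mode n) none) :
    Exec closeSlot v s v
      { s with c := [], r := [], d := [], u := [], sc := List.replicate n none }
      (2 * (s.c.length + s.r.length + s.d.length + s.u.length) + 6) := by
  cases hm : v.mode with
  | none =>
    refine Exec.of_eq ((Exec.ite_true ?_ (Exec.pop _ _ _ _)).seq ((exec_clear _ _ _).seq
      ((exec_clear _ _ _).seq ((exec_clear _ _ _).seq (exec_clear _ _ _))))) ?_ ?_ ?_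
    · simp [hm]
    · cases v; simp_all
    · simp [Stk.set, Stk.fn, expo, h, hm]
    · simp [Stk.set, Stk.fn]; omega
  | some e =>
    refine Exec.of_eq ((Exec.ite_false ?_ (Exec.load _ _ _)).seq ((exec_clear _ _ _).seq
      ((exec_clear _ _ _).seq ((exec_clear _ _ _).seq (exec_clear _ _ _))))) ?_ ?_ ?_
    · simp [hm]
    · cases v; simp_all
    · cases s; simp_all [Stk.set, expo]
    · simp [Stk.set, Stk.fn]; omega

theorem exec_emitSlot {w : List Sym} {v : Mem} {s : Stk} (hv : v.Idle) (hs : s.Clean) :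
    Exec emitSlot v (s.word w) v (s.emit₁ (v.mode, w)) (slotTime w.length s.sc.length) := by
  obtain ⟨h1, h2, h3, h4, h5, h6, h7, h8, h9, h10⟩ := hs
  refine Exec.of_eq ((exec_openSlot v (s.word w) (by exact h10)).seq
    ((exec_threeBlocks (n := expo v.mode (s.sc.length + 1)) (w := w)
      (m := some true :: List.replicate w.length none) ?_ hv ?_ ?_ ?_ ?_ ?_ ?_ ?_ ?_ ?_ ?_).seq
    (exec_closeSlot (s.sc.length + 1) _ _ ?_ ?_))) rfl ?_ ?_
  any_goals first | assumption | rfl | simp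
  · exact hv.z
  · simp only [Stk.emit₁, Stk.word, familyStr, List.replicate_succ, h1, h2, h3, h4, h5, h6, h7, h8,
    h9]
    rw [← h10]
  · have : expo v.mode (s.sc.length + 1) ≤ s.sc.length + 2 := by
      unfold expo; split <;> omega
    have h : blockTime w.length (expo v.mode (s.sc.length + 1)) ≤
        blockTime w.length (s.sc.length + 2) := by
      unfold blockTime; gcongr
    simp only [slotTime, Stk.word, List.length_replicate]
    omega

/-! ### Loading words -/

/-- Append a coefficient to the word under construction. -/
def putMark (f : Mem → Sym) : Prog Key Sym Mem :=
  .push .c f ;; .push .r f ;; .push .d f ;; .push .u fun _ => none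

theorem exec_putMark (f : Mem → Sym) (v : Mem) (s : Stk) (w : List Sym) :
    Exec (putMark f) v (s.word w) v (s.word (f v :: w)) 4 :=
  Exec.of_eq ((Exec.push _ _ _ _).seq ((Exec.push _ _ _ _).seq ((Exec.push _ _ _ _).seq
    (Exec.push _ _ _ _)))) rfl rfl le_rfl

/-- Move the queue of coefficients. -/
def Mem.shift (v : Mem) : Mem := { v with q₁ := v.q₂, q₂ := v.q₃, q₃ := none }

/-- The word with `k` coefficients that begins with zeros and ends in the coefficients of a
queue. -/
def queueWord : Sym → Sym → Sym → ℕ → List Sym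
  | _, _, _, 0 => []
  | q₁, q₂, q₃, k + 1 => queueWord q₂ q₃ none k ++ [q₁]

/-- For every separator on stack `k`, append a coefficient to the word under construction; these
coefficients are taken from a queue. -/
def marksLoop (k : Key) : Prog Key Sym Mem :=
  forZ k ((.push .t fun v => v.z.getD none) ;;
    .ite (fun v => decide (v.z = some none)) (putMark Mem.q₁ ;; .load Mem.shift) (.load id))

/-- Append to the word under construction one coefficient for each separator on stack `k`, first
`q₁`, `q₂`, `q₃`, then zeros. -/
def marks (k : Key) (q₁ q₂ q₃ : Sym) : Prog Key Sym Mem :=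
  (.load fun v => { v with q₁ := q₁, q₂ := q₂, q₃ := q₃ }) ;; marksLoop k ;; move .t k ;;
    .load fun v => { v with q₁ := none, q₂ := none, q₃ := none }

theorem exec_marksLoop {k : Key} (hk : k = .inp ∨ k = .a ∨ k = .b) (l w : List Sym) (v : Mem)
    (s : Stk) (hl : s.fn k = l) :
    Exec (marksLoop k) v (s.word w) (Mem.shift^[l.count none] { v with z := none })
      (((s.set k []).set .t (l.reverse ++ s.t)).word
        (queueWord v.q₁ v.q₂ v.q₃ (l.count none) ++ w)) (8 * l.length + 1) := by
  induction l generalizing v s w with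
  | nil =>
    refine Exec.of_eq (Exec.loop_stop ?_ rfl) rfl ?_ (by simp)
    · rcases hk with rfl | rfl | rfl <;> exact hl
    · rw [← hl, Stk.set_fn_self, hl]; rfl
  | cons e l ih =>
    have hl' : (s.word w).fn k = e :: l := by rcases hk with rfl | rfl | rfl <;> exact hl
    have hs (x : List Sym) : (s.word w).set k x = (s.set k x).word w := by
      rcases hk with rfl | rfl | rfl <;> rfl
    have ht : ((s.set k l).set .t (e :: s.t)).fn k = l := by
      rcases hk with rfl | rfl | rfl <;> rfl
    have ht' (x y : List Sym) : (((s.set k l).set .t x).set k []).set .t y =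
        (s.set k []).set .t y := by
      rcases hk with rfl | rfl | rfl <;> rfl
    have htk : (s.set k l).t = s.t := by rcases hk with rfl | rfl | rfl <;> rfl
    cases e with
    | none =>
      have hb : Exec ((.push .t fun v => v.z.getD none) ;;
          .ite (fun v => decide (v.z = some none)) (putMark Mem.q₁ ;; .load Mem.shift) (.load id))
          { v with z := some none } ((s.set k l).word w)
          (Mem.shift { v with z := some none })
          (((s.set k l).set .t (none :: s.t)).word (v.q₁ :: w)) 7 := by
        rw [← htk]
        exact Exec.of_eq ((Exec.push _ _ _ _).seq (Exec.ite_true rfl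
          ((exec_putMark Mem.q₁ { v with z := some none }
            ((s.set k l).set .t (none :: (s.set k l).t)) w).seq (Exec.load _ _ _)))) rfl rfl le_rfl
      rw [← hs] at hb
      refine Exec.of_eq (Exec.loop_cons hl' rfl hb (ih _ _ _ ht)) ?_ ?_ ?_
      · rw [List.count_cons_self, Function.iterate_succ_apply]; rfl
      · rw [ht', List.count_cons_self, queueWord, List.append_assoc, List.reverse_cons,
          List.append_assoc]
        rfl
      · simp only [List.length_cons]; omega
    | some e =>
      have hb : Exec ((.push .t fun v => v.z.getD none) ;;
          .ite (fun v => decide (v.z = some none)) (putMark Mem.q₁ ;; .load Mem.shift) (.load id))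
          { v with z := some (some e) } ((s.set k l).word w) { v with z := some (some e) }
          (((s.set k l).set .t (some e :: s.t)).word w) 3 := by
        rw [← htk]
        exact Exec.of_eq ((Exec.push _ _ _ _).seq (Exec.ite_false rfl (Exec.load _ _ _)))
          rfl rfl le_rfl
      rw [← hs] at hb
      refine Exec.of_eq (Exec.loop_cons hl' rfl hb (ih _ _ _ ht)) ?_ ?_ ?_
      · rw [List.count_cons_of_ne (by simp)]
      · rw [ht', List.count_cons_of_ne (by simp), List.reverse_cons, List.append_assoc]
        rfl
      · simp only [List.length_cons]; omega

theorem shift_iterate_reset (n : ℕ) (v : Mem) :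
    { Mem.shift^[n] v with q₁ := none, q₂ := none, q₃ := none } =
      { v with q₁ := none, q₂ := none, q₃ := none } := by
  induction n generalizing v with
  | zero => rfl
  | succ n ih => exact ih v.shift

theorem exec_marks {k : Key} (hk : k = .inp ∨ k = .a ∨ k = .b) (q₁ q₂ q₃ : Sym) (w : List Sym)
    {v : Mem} {s : Stk} (hv : v.Idle) (ht : s.t = []) :
    Exec (marks k q₁ q₂ q₃) v (s.word w) v
      (s.word (queueWord q₁ q₂ q₃ ((s.fn k).count none) ++ w)) (10 * (s.fn k).length + 4) := by
  have hkt : Key.t ≠ k := by rcases hk with rfl | rfl | rfl <;> decide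
  refine Exec.of_eq ((Exec.load _ _ _).seq ((exec_marksLoop hk (s.fn k) w _ s rfl).seq
    ((exec_move hkt _ _).seq (Exec.load _ _ _)))) ?_ ?_ ?_
  · have h := shift_iterate_reset ((s.fn k).count none)
      { v with z := none, q₁ := q₁, q₂ := q₂, q₃ := q₃ }
    have h' := congrArg (fun v : Mem => { v with z := none }) h
    refine h'.trans ?_
    obtain ⟨h1, -, -, -, -, -, h2, h3, h4⟩ := hv
    cases v
    simp_all
  · rcases hk with rfl | rfl | rfl <;> simp [Stk.set, Stk.fn, Stk.word, ht]
  · rcases hk with rfl | rfl | rfl <;> simp [Stk.set, Stk.fn, Stk.word, ht] <;> omega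

theorem queueWord_none (n : ℕ) : queueWord none none none n = List.replicate n none := by
  induction n with
  | zero => rfl
  | succ n ih => rw [queueWord, ih, List.replicate_succ']

theorem queueWord_one (q : Sym) (n : ℕ) :
    queueWord q none none (n + 1) = List.replicate n none ++ [q] := by
  rw [queueWord, queueWord_none]

theorem queueWord_three (q₁ q₂ q₃ : Sym) (n : ℕ) :
    queueWord q₁ q₂ q₃ (n + 3) = List.replicate n none ++ [q₃, q₂, q₁] := by
  rw [queueWord, queueWord, queueWord, queueWord_none]
  simp

theorem length_queueWord (q₁ q₂ q₃ : Sym) (n : ℕ) : (queueWord q₁ q₂ q₃ n).length = n := by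
  induction n generalizing q₁ q₂ q₃ with
  | zero => rfl
  | succ n ih => simp [queueWord, ih]

/-! ### The slots of the clauses -/

theorem Stk.Clean.word_nil {s : Stk} (h : s.Clean) : s.word [] = s := by
  obtain ⟨h1, h2, h3, h4, h5, h6, h7, h8, h9, -⟩ := h
  cases s; simp_all [Stk.word]

/-- The word with coefficient `h` at the homogenizing coordinate, `x`, `y`, `z` at a clause, and
otherwise `0`; `pre` and `post` are the numbers of literals before and after the clause. -/
def clauseWord (h x y z : Sym) (pre post : ℕ) : List Sym :=
  none :: h :: (List.replicate pre none ++ [x, y, z] ++ List.replicate post none)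

/-- The slots of a clause: its coordinates sum to the homogenizing one, and the product of any two
of them vanishes. -/
def clauseSlots (pre post : ℕ) : List (Sym × List Sym) :=
  [(none, clauseWord (some true) (some false) (some false) (some false) pre post),
   (some false, clauseWord none (some false) (some true) none pre post),
   (some false, clauseWord none (some false) none (some true) pre post),
   (some false, clauseWord none none (some false) (some true) pre post)]

/-- The slots of `k` clauses after `pre` literals. -/
def allClauseSlots : ℕ → ℕ → List (Sym × List Sym)
  | _, 0 => []
  | pre, k + 1 => clauseSlots pre (3 * k) ++ allClauseSlots (pre + 3) k

/-- Write a slot of the clause whose literals have just been moved to stack `a`. -/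
def emitClauseSlot (mode h x y z : Sym) : Prog Key Sym Mem :=
  (.load fun v => { v with mode := mode }) ;; marks .inp none none none ;; marks .a z y x ;;
    putMark (fun _ => h) ;; putMark (fun _ => none) ;; emitSlot

theorem slotTime_mono {n n' s s' : ℕ} (hn : n ≤ n') (hs : s ≤ s') :
    slotTime n s ≤ slotTime n' s' := by
  unfold slotTime blockTime
  gcongr

theorem exec_emitClauseSlot (mode h x y z : Sym) {M pre post : ℕ} {v : Mem} {s : Stk}
    (hv : v.Idle) (hs : s.Clean) (ha : s.a.count none = pre + 3) (hi : s.inp.count none = post)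
    (hM : s.a.length + s.inp.length + 2 ≤ M) (hsc : s.sc.length ≤ M) :
    Exec (emitClauseSlot mode h x y z) v s { v with mode := mode }
      (s.emit₁ (mode, clauseWord h x y z pre post)) (slotTime M M + 10 * M + 20) := by
  have hv' : Mem.Idle { v with mode := mode } := by
    obtain ⟨h1, h2, h3, h4, h5, h6, h7, h8, h9⟩ := hv
    exact ⟨h1, h2, h3, h4, h5, h6, h7, h8, h9⟩
  have hw : none :: h :: (queueWord z y x (s.a.count none) ++
      (queueWord none none none (s.inp.count none) ++ [])) = clauseWord h x y z pre post := by
    rw [ha, hi, queueWord_three, queueWord_none, List.append_nil]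
    rfl
  have key := (Exec.load (fun v => { v with mode := mode }) v (s.word [])).seq
    ((exec_marks (k := .inp) (Or.inl rfl) none none none [] hv' hs.t).seq
    ((exec_marks (k := .a) (Or.inr (Or.inl rfl)) z y x _ hv' hs.t).seq
    ((exec_putMark (fun _ => h) _ s _).seq ((exec_putMark (fun _ => none) _ s _).seq
    (exec_emitSlot hv' hs)))))
  rw [hs.word_nil] at key
  refine Exec.of_eq key rfl (by rw [← hw]; rfl) ?_
  have h1 : s.a.count none ≤ s.a.length := List.count_le_length
  have h2 : s.inp.count none ≤ s.inp.length := List.count_le_length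
  have h3 : (none :: h :: (queueWord z y x (s.a.count none) ++
      (queueWord none none none (s.inp.count none) ++ []))).length ≤ M := by
    simp [length_queueWord]; omega
  have h4 := slotTime_mono h3 hsc
  have e1 : s.fn .a = s.a := rfl
  have e2 : s.fn .inp = s.inp := rfl
  rw [e1, e2]
  omega

/-- Write the slots of the clause whose literals have just been moved to stack `a`. -/
def emitClause : Prog Key Sym Mem :=
  emitClauseSlot none (some true) (some false) (some false) (some false) ;;
  emitClauseSlot (some false) none (some false) (some true) none ;;
  emitClauseSlot (some false) none (some false) none (some true) ;;
  emitClauseSlot (some false) none none (some false) (some true) ;;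
  .load fun v => { v with mode := none }

theorem exec_emitClause {M pre post : ℕ} {v : Mem} {s : Stk}
    (hv : v.Idle) (hmode : v.mode = none) (hs : s.Clean) (ha : s.a.count none = pre + 3)
    (hi : s.inp.count none = post)
    (hM : s.a.length + s.inp.length + 2 ≤ M) (hsc : s.sc.length + 4 ≤ M) :
    Exec emitClause v s v (s.emit (clauseSlots pre post))
      (4 * slotTime M M + 40 * M + 81) := by
  have hidle (m : Sym) : Mem.Idle { v with mode := m } := by
    obtain ⟨h1, h2, h3, h4, h5, h6, h7, h8, h9⟩ := hv
    exact ⟨h1, h2, h3, h4, h5, h6, h7, h8, h9⟩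
  refine Exec.of_eq
    ((exec_emitClauseSlot _ _ _ _ _ (M := M) hv hs ha hi hM (by omega)).seq
    ((exec_emitClauseSlot _ _ _ _ _ (M := M) (hidle _) (hs.emit₁ _) ha hi hM ?_).seq
    ((exec_emitClauseSlot _ _ _ _ _ (M := M) (hidle _) ((hs.emit₁ _).emit₁ _) ha hi hM ?_).seq
    ((exec_emitClauseSlot _ _ _ _ _ (M := M) (hidle _) (((hs.emit₁ _).emit₁ _).emit₁ _) ha hi
      hM ?_).seq (Exec.load _ _ _))))) ?_ rfl ?_
  · simp [Stk.emit₁]; omega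
  · simp [Stk.emit₁]; omega
  · simp [Stk.emit₁]; omega
  · cases v; simp_all
  · omega

/-! ### Loops over the literals -/

/-- The bits of a string, followed by a separator. -/
def sepBlock (u : List Bool) : List Sym := u.map some ++ [none]

theorem count_sepBlock (u : List Bool) : (sepBlock u).count none = 1 := by
  have : (u.map some).count none = 0 := List.count_eq_zero.2 (by simp)
  simp [sepBlock, this]

theorem length_sepBlock (u : List Bool) : (sepBlock u).length = u.length + 1 := by
  simp [sepBlock]

/-- Run `p` for every symbol of the input, and then `q` if this symbol is a separator. -/
def scan (p q : Prog Key Sym Mem) : Prog Key Sym Mem :=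
  forZ .inp (p ;;
    .ite (fun v => decide (v.z = some none)) ((.load fun v => { v with z := none }) ;; q)
    (.load fun v => { v with z := none }))

theorem Mem.set_z {v : Mem} (hz : v.z = none) : { v with z := none } = v := by
  cases v
  simp only at hz
  rw [hz]

theorem exec_scan_nil {p q : Prog Key Sym Mem} {v : Mem} {s : Stk} (hz : v.z = none)
    (hs : s.inp = []) : Exec (scan p q) v s v s 1 :=
  Exec.of_eq (Exec.loop_stop (by exact hs) rfl) (Mem.set_z hz) rfl le_rfl

/-- If `p` acts on the stacks by `g`, scanning a block acts by `g` for each of its symbols, and then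
by `q`. -/
theorem exec_scan_block {p q : Prog Key Sym Mem} {g : Sym → Stk → Stk} (u : List Bool)
    (rest : List Sym) {v v₁ v' : Mem} {s s₁ s' : Stk} {tq t : ℕ} (hz : v.z = none)
    (hp : ∀ e s, Exec p { v with z := some e } s { v with z := some e } (g e s) 5)
    (hg : ∀ e s l, g e (s.set .inp l) = (g e s).set .inp l)
    (hs : s.inp = sepBlock u ++ rest)
    (hq : Exec q v ((sepBlock u).foldl (fun s e => g e s) (s.set .inp rest)) v₁ s₁ tq)
    (h : Exec (scan p q) v₁ s₁ v' s' t) :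
    Exec (scan p q) v s v' s' (8 * (u.length + 1) + tq + t) := by
  have hv := Mem.set_z hz
  induction u generalizing s with
  | nil =>
    refine Exec.of_eq (Exec.loop_cons (by exact hs) rfl ((hp _ _).seq (Exec.ite_true rfl
      ((Exec.load _ _ _).seq ?_))) h) rfl rfl (t := 5 + (1 + tq + 1) + 1 + t)
      (by simp only [List.length_nil]; omega)
    convert hq using 1
    rfl
  | cons b u ih =>
    refine Exec.of_eq (Exec.loop_cons (by exact hs) rfl ((hp _ _).seq (Exec.ite_false rfl
      (Exec.load _ _ _))) (?_ : Exec (scan p q) _ _ _ _ (8 * (u.length + 1) + tq + t))) rfl rfl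
      (by simp only [List.length_cons]; omega)
    rw [show ({ v with z := none } : Mem) = v from hv]
    refine ih ?_ ?_
    · exact congrArg Stk.inp (hg (some b) s (sepBlock u ++ rest))
    · convert hq using 1
      change _ = (sepBlock u).foldl (fun s e => g e s) (g (some b) (s.set .inp rest))
      rw [hg]
      congr 1
      exact (Stk.set_set _ _ _ _).trans (hg _ _ _).symm

/-! ### The loop over the clauses -/

/-- Count the literals modulo three, and run `q` after every third one. -/
def everyThird (q : Prog Key Sym Mem) : Prog Key Sym Mem :=
  .ite (fun v => decide (v.cnt = 2)) ((.load fun v => { v with cnt := 0 }) ;; q)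
    (.load fun v => { v with cnt := v.cnt + 1 })

/-- The loop over the clauses. -/
def clauseLoop : Prog Key Sym Mem :=
  scan (.push .a fun v => v.z.getD none) (everyThird emitClause)

theorem foldl_push_a (l : List Sym) (s : Stk) :
    l.foldl (fun s e => { s with a := e :: s.a }) s = { s with a := l.reverse ++ s.a } := by
  induction l generalizing s with
  | nil => rfl
  | cons e l ih => rw [List.foldl_cons, ih]; simp

theorem encodeLiteral_eq (l : Literal) :
    encodeLiteral l = sepBlock (l.pos :: Computability.encodeNat l.var) := rfl

theorem encodeClause_eq (c : Clause) :
    encodeClause c = encodeLiteral (c 0) ++ (encodeLiteral (c 1) ++ encodeLiteral (c 2)) := by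
  simp [encodeClause, List.finRange_succ]

theorem encodeFormula_cons (c : Clause) (φ : Formula3) :
    encodeFormula (c :: φ) = encodeLiteral (c 0) ++ (encodeLiteral (c 1) ++
      (encodeLiteral (c 2) ++ encodeFormula φ)) := by
  simp [encodeFormula, encodeClause_eq]

theorem count_encodeFormula (φ : Formula3) : (encodeFormula φ).count none = 3 * φ.length := by
  induction φ with
  | nil => rfl
  | cons c φ ih =>
    simp only [encodeFormula_cons, encodeLiteral_eq, List.count_append, count_sepBlock, ih,
      List.length_cons]
    ring

theorem exec_push_a (v : Mem) (e : Sym) (s : Stk) : Exec (.push .a fun v => v.z.getD none)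
    { v with z := some e } s { v with z := some e } { s with a := e :: s.a } 5 :=
  Exec.of_eq (Exec.push _ _ _ _) rfl rfl (by omega)

theorem exec_clauseLoop_step {u : List Bool} {rest : List Sym} {v v' : Mem} {s s' : Stk} {t : ℕ}
    (hz : v.z = none) (hcnt : v.cnt ≠ 2) (hs : s.inp = sepBlock u ++ rest)
    (h : Exec clauseLoop { v with cnt := v.cnt + 1 }
      { s with inp := rest, a := (sepBlock u).reverse ++ s.a } v' s' t) :
    Exec clauseLoop v s v' s' (8 * (u.length + 1) + 2 + t) := by
  refine exec_scan_block u rest hz (exec_push_a v) (fun _ _ _ => rfl) hs ?_ h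
  rw [foldl_push_a]
  exact Exec.ite_false (by simpa using hcnt) (Exec.load _ _ _)

theorem exec_clauseLoop_last {u : List Bool} {rest : List Sym} {v v₁ v' : Mem} {s s₁ s' : Stk}
    {tq t : ℕ} (hz : v.z = none) (hcnt : v.cnt = 2) (hs : s.inp = sepBlock u ++ rest)
    (hq : Exec emitClause { v with cnt := 0 }
      { s with inp := rest, a := (sepBlock u).reverse ++ s.a } v₁ s₁ tq)
    (h : Exec clauseLoop v₁ s₁ v' s' t) :
    Exec clauseLoop v s v' s' (8 * (u.length + 1) + (1 + tq + 1) + t) := by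
  refine exec_scan_block u rest hz (exec_push_a v) (fun _ _ _ => rfl) hs ?_ h
  rw [foldl_push_a]
  exact Exec.ite_true (by simpa using hcnt) ((Exec.load _ _ _).seq hq)

/-- The number of steps for a clause. -/
def clauseTime {R : Type} [CommSemiring R] (M : R) : R := 4 * slotTime M M + 40 * M + 100

theorem exec_clauseLoop (φ : Formula3) {M pre : ℕ} {v : Mem} {s : Stk} (hv : v.Idle)
    (hmode : v.mode = none) (hcnt : v.cnt = 0) (hs : s.Clean) (hi : s.inp = encodeFormula φ)
    (ha : s.a.count none = pre) (hM : s.a.length + s.inp.length + 2 ≤ M)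
    (hsc : s.sc.length + 4 * φ.length ≤ M) :
    Exec clauseLoop v s v
      (({ s with inp := [], a := (encodeFormula φ).reverse ++ s.a } : Stk).emit
        (allClauseSlots pre φ.length))
      ((encodeFormula φ).length * (clauseTime M + 8) + 1) := by
  induction φ generalizing s pre with
  | nil =>
    refine Exec.of_eq (exec_scan_nil hv.z hi) rfl ?_ (by simp)
    cases s
    simp only at hi
    subst hi
    rfl
  | cons c φ ih =>
    rw [encodeFormula_cons] at hi ⊢
    simp only [encodeLiteral_eq] at hi ⊢
    generalize (c 0).pos :: Computability.encodeNat (c 0).var = u₀ at hi ⊢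
    generalize (c 1).pos :: Computability.encodeNat (c 1).var = u₁ at hi ⊢
    generalize (c 2).pos :: Computability.encodeNat (c 2).var = u₂ at hi ⊢
    have hlen := congrArg List.length hi
    simp only [List.length_append, length_sepBlock] at hlen
    simp only [List.length_cons] at hsc
    set a' := (sepBlock u₂).reverse ++ ((sepBlock u₁).reverse ++ ((sepBlock u₀).reverse ++ s.a))
      with ha'
    have ha'_len : a'.length + (encodeFormula φ).length = s.a.length + s.inp.length := by
      simp only [ha', List.length_append, List.length_reverse, length_sepBlock]; omega
    have ha'_count : a'.count none = pre + 3 := by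
      simp only [ha', List.count_append, List.count_reverse, count_sepBlock, ha]; omega
    have hs' : ({ s with inp := encodeFormula φ, a := a' } : Stk).Clean :=
      ⟨hs.1, hs.2, hs.3, hs.4, hs.5, hs.6, hs.7, hs.8, hs.9, hs.10⟩
    have h2 := exec_emitClause (M := M) (v := v) hv hmode hs' ha'_count
      (count_encodeFormula φ) (by simp only; omega) (by simp only; omega)
    have h3 := ih (pre := pre + 3)
      (s := ({ s with inp := encodeFormula φ, a := a' } : Stk).emit
        (clauseSlots pre (3 * φ.length))) (hs'.emit _) (by rw [Stk.emit_eq])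
      (by rw [Stk.emit_eq]; exact ha'_count)
      (by rw [Stk.emit_eq]; simp only; omega)
      (by rw [Stk.emit_sc_length]; simp [clauseSlots]; omega)
    have hv' : ({ v with cnt := 0 } : Mem) = v := by
      rw [← hcnt]
    refine Exec.of_eq (exec_clauseLoop_step hv.z (by rw [hcnt]; decide) hi
      (exec_clauseLoop_step (by exact hv.z) (by simp [hcnt]) rfl
      (exec_clauseLoop_last (by exact hv.z) (by simp [hcnt]) rfl
        (by exact (by rw [hv']; exact h2 : Exec emitClause { v with cnt := 0 }
          { s with inp := encodeFormula φ, a := a' } v _ _)) h3))) rfl ?_ ?_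
    · rw [List.length_cons, allClauseSlots, Stk.emit_append]
      congr 1
      have e₁ := Stk.emit_congr s (encodeFormula φ) a' s.b s.x s.y (clauseSlots pre (3 * φ.length))
      have e₂ := Stk.emit_congr s []
        ((sepBlock u₀ ++ (sepBlock u₁ ++ (sepBlock u₂ ++ encodeFormula φ))).reverse ++ s.a)
        s.b s.x s.y (clauseSlots pre (3 * φ.length))
      refine Eq.trans ?_ e₂.symm
      rw [e₁]
      simp [ha']
    · simp only [List.length_append, length_sepBlock, clauseTime]
      generalize slotTime M M = T
      have h : (u₀.length + u₁.length + u₂.length) * 8 ≤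
          (u₀.length + u₁.length + u₂.length) * (4 * T + 40 * M + 100 + 8) := by gcongr; omega
      have h' : (u₀.length + 1 + (u₁.length + 1 + (u₂.length + 1 + (encodeFormula φ).length))) *
          (4 * T + 40 * M + 100 + 8) = (u₀.length + u₁.length + u₂.length) *
          (4 * T + 40 * M + 100 + 8) + 3 * (4 * T + 40 * M + 100 + 8) +
          (encodeFormula φ).length * (4 * T + 40 * M + 100 + 8) := by ring
      omega

/-! ### Comparing literals -/

/-- Set the flag `eq` if the stacks `x` and `y` agree; afterwards `y` is empty. -/
def compare : Prog Key Sym Mem :=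
  (.load fun v => { v with eq := true }) ;;
  forZ .x ((.push .t fun v => v.z.getD none) ;; (.pop .y fun v o => { v with u := o }) ;;
    .load fun v => { v with eq := v.eq && decide (v.u = v.z), u := none }) ;;
  move .t .x ;; (.pop .y fun v o => { v with u := o }) ;;
  (.load fun v => { v with eq := v.eq && v.u.isNone, u := none }) ;; clear .y

theorem exec_compareLoop (l m : List Sym) {v : Mem} {s : Stk} (hu : v.u = none) (hx : s.x = l)
    (hy : s.y = m) :
    Exec (forZ .x ((.push .t fun v => v.z.getD none) ;; (.pop .y fun v o => { v with u := o }) ;;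
        .load fun v => { v with eq := v.eq && decide (v.u = v.z), u := none })) v s
      { v with z := none, eq := v.eq && decide (l <+: m) }
      { s with x := [], t := l.reverse ++ s.t, y := m.drop l.length } (4 * l.length + 1) := by
  induction l generalizing m v s with
  | nil =>
    refine Exec.of_eq (Exec.loop_stop (by exact hx) rfl) ?_ ?_ (by simp)
    · cases v; simp
    · cases s; simp_all
  | cons e l ih =>
    refine Exec.of_eq (Exec.loop_cons hx rfl ((Exec.push _ _ _ _).seq ((Exec.pop _ _ _ _).seq
      (Exec.load _ _ _))) (ih m.tail ?_ ?_ ?_)) ?_ ?_ ?_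
    · rfl
    · rfl
    · simp [Stk.set, Stk.fn, hy]
    · obtain _ | ⟨e', m⟩ := m
      · simp [Stk.set, Stk.fn, hy, hu]
      · simp only [Stk.set, Stk.fn, hy, hu, List.cons_prefix_cons, Bool.and_assoc, eq_comm,
          List.head?_cons, List.tail_cons, Option.some.injEq, Bool.decide_and]
        congr
    · simp [Stk.set, Stk.fn, hy]
    · simp only [List.length_cons]; omega

theorem exec_compare {v : Mem} {s : Stk} (hz : v.z = none) (hu : v.u = none) (ht : s.t = []) :
    Exec compare v s { v with eq := decide (s.x = s.y) } { s with y := [] }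
      (6 * s.x.length + 2 * s.y.length + 8) := by
  refine Exec.of_eq ((Exec.load _ _ _).seq ((exec_compareLoop s.x s.y ?_ rfl rfl).seq
    ((exec_move (by decide) _ _).seq ((Exec.pop _ _ _ _).seq ((Exec.load _ _ _).seq
    (exec_clear _ _ _)))))) ?_ ?_ ?_
  · exact hu
  · have h : (decide (s.x <+: s.y) && (s.y.drop s.x.length).head?.isNone) =
        decide (s.x = s.y) := by
      rw [Bool.eq_iff_iff]
      simp only [Bool.and_eq_true, decide_eq_true_eq, Option.isNone_iff_eq_none,
        List.head?_eq_none_iff, List.drop_eq_nil_iff]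
      constructor
      · rintro ⟨h1, h2⟩
        exact h1.eq_of_length_le h2
      · intro h
        simp [h]
    simp only [Stk.set, Stk.fn, Bool.true_and]
    rw [h]
    cases v; simp_all
  · cases s; simp_all [Stk.set, Stk.fn]
  · simp [Stk.set, Stk.fn, ht]; omega

/-! ### The slots of the pairs -/

/-- The word with coefficients `1` and `-1` after `pre` zeros and `mid` further zeros. -/
def pairWord (pre mid post : ℕ) : List Sym :=
  List.replicate pre none ++ some false :: (List.replicate mid none ++
    some true :: List.replicate post none)

/-- Change the first bit of a string, which is the sign of a literal. -/
def flipHead : List Bool → List Bool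
  | [] => []
  | b :: l => (!b) :: l

/-- The slots of the pairs that consist of the literal `u` after `pre` others and a literal in the
list, after `mid` others. The first slot of a pair says that the vectors are proportional there, the
second one that the product vanishes if the literals are complementary. Otherwise the first slot is
repeated, so that the number of slots depends only on the number of literals. -/
def pairSlotsWith (pre : ℕ) (u : List Bool) : ℕ → List (List Bool) → List (Sym × List Sym)
  | _, [] => []
  | mid, w :: l =>
    (some true, pairWord pre mid l.length) ::
    (some (!decide (u = flipHead w)), pairWord pre mid l.length) :: pairSlotsWith pre u (mid + 1) l

/-- The slots of the pairs of literals in the list, after `pre` others. -/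
def pairSlots : ℕ → List (List Bool) → List (Sym × List Sym)
  | _, [] => []
  | pre, u :: l => pairSlotsWith pre u 0 l ++ pairSlots (pre + 1) l

/-- Load the word for the literals on top of the stacks `a` and `b`. -/
def loadPair : Prog Key Sym Mem :=
  marks .inp none none none ;; marks .b (some true) none none ;; marks .a (some false) none none

theorem exec_loadPair {pre mid post : ℕ} {v : Mem} {s : Stk} (hv : v.Idle) (hs : s.Clean)
    (ha : s.a.count none = pre + 1) (hb : s.b.count none = mid + 1)
    (hi : s.inp.count none = post) :
    Exec loadPair v s v (s.word (pairWord pre mid post))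
      (10 * (s.inp.length + s.b.length + s.a.length) + 12) := by
  have key := (exec_marks (k := .inp) (Or.inl rfl) none none none [] hv hs.t).seq
    ((exec_marks (k := .b) (Or.inr (Or.inr rfl)) (some true) none none _ hv hs.t).seq
    (exec_marks (k := .a) (Or.inr (Or.inl rfl)) (some false) none none _ hv hs.t))
  rw [hs.word_nil] at key
  refine Exec.of_eq key rfl ?_ ?_
  · have e1 : s.fn .a = s.a := rfl
    have e2 : s.fn .inp = s.inp := rfl
    have e3 : s.fn .b = s.b := rfl
    rw [e1, e2, e3, ha, hb, hi, queueWord_one, queueWord_one, queueWord_none]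
    simp [pairWord]
  · simp only [Stk.fn]; omega

/-- Write the slots for the literals on top of the stacks `a` and `b`, of which `x` and `y` hold
copies, the latter with the first bit changed. -/
def emitPair : Prog Key Sym Mem :=
  compare ;; loadPair ;; (.load fun v => { v with mode := some true }) ;; emitSlot ;;
  loadPair ;; (.load fun v => { v with mode := some (!v.eq) }) ;; emitSlot ;;
  .load fun v => { v with mode := none, eq := false }

theorem length_pairWord (pre mid post : ℕ) :
    (pairWord pre mid post).length = pre + mid + post + 2 := by
  simp [pairWord]; omega

/-- The number of steps for a pair of literals. -/
def pairTime {R : Type} [CommSemiring R] (M : R) : R := 2 * slotTime M M + 40 * M + 50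

theorem exec_emitPair {M pre mid post : ℕ} {v : Mem} {s : Stk} (hv : v.Idle)
    (hmode : v.mode = none) (heq : v.eq = false) (hs : s.Clean)
    (ha : s.a.count none = pre + 1) (hb : s.b.count none = mid + 1)
    (hi : s.inp.count none = post) (hM : s.inp.length + s.b.length + s.a.length ≤ M)
    (hx : s.x.length ≤ M) (hy : s.y.length ≤ M) (hsc : s.sc.length + 2 ≤ M) :
    Exec emitPair v s v
      (({ s with y := [] } : Stk).emit [(some true, pairWord pre mid post),
        (some (!decide (s.x = s.y)), pairWord pre mid post)])
      (pairTime M) := by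
  have hs' : ({ s with y := [] } : Stk).Clean :=
    ⟨hs.1, hs.2, hs.3, hs.4, hs.5, hs.6, hs.7, hs.8, hs.9, hs.10⟩
  have hidle (m : Sym) (e : Bool) : Mem.Idle { v with mode := m, eq := e } := by
    obtain ⟨h1, h2, h3, h4, h5, h6, h7, h8, h9⟩ := hv
    exact ⟨h1, h2, h3, h4, h5, h6, h7, h8, h9⟩
  refine Exec.of_eq ((exec_compare hv.z hv.u hs.t).seq
    ((exec_loadPair (by exact hidle v.mode _) hs' ha hb hi).seq ((Exec.load _ _ _).seq
    ((exec_emitSlot (by exact hidle _ _) hs').seq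
    ((exec_loadPair (by exact hidle (some true) _) (hs'.emit₁ _) ha hb hi).seq
    ((Exec.load _ _ _).seq ((exec_emitSlot (by exact hidle _ _) (hs'.emit₁ _)).seq
    (Exec.load _ _ _)))))))) ?_ rfl ?_
  · cases v; simp_all
  · have h1 : s.a.count none ≤ s.a.length := List.count_le_length
    have h2 : s.inp.count none ≤ s.inp.length := List.count_le_length
    have h3 : s.b.count none ≤ s.b.length := List.count_le_length
    have h4 : (pairWord pre mid post).length ≤ M := by rw [length_pairWord]; omega
    have h5 := slotTime_mono h4 (show s.sc.length ≤ M by omega)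
    have h6 := slotTime_mono h4
      (show (({ s with y := [] } : Stk).emit₁ (some true, pairWord pre mid post)).sc.length ≤ M by
        simp [Stk.emit₁]; omega)
    simp only [pairTime]
    simp only [Stk.emit₁] at h6 ⊢
    omega

/-! ### The loops over the pairs -/

/-- The loop over the second literal of a pair. Each literal moves from `inp` to `b`, and is copied
to `y` with its first bit changed. -/
def innerLoop : Prog Key Sym Mem :=
  scan ((.push .b fun v => v.z.getD none) ;; (.peek .y fun v o => { v with eq := o.isNone }) ;;
    (.push .y fun v => if v.eq then (v.z.getD none).map not else v.z.getD none) ;;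
    .load fun v => { v with eq := false }) emitPair

/-- The action of the body of the inner loop on the stacks. -/
def innerStep (e : Sym) (s : Stk) : Stk :=
  { s with b := e :: s.b, y := (if s.y.isEmpty then e.map not else e) :: s.y }

theorem foldl_innerStep (l : List Sym) (s : Stk) (hy : s.y ≠ []) :
    l.foldl (fun s e => innerStep e s) s =
      { s with b := l.reverse ++ s.b, y := l.reverse ++ s.y } := by
  induction l generalizing s with
  | nil => rfl
  | cons e l ih =>
    have h : s.y.isEmpty = false := by simpa using hy
    rw [List.foldl_cons, ih _ (by simp [innerStep])]
    simp [innerStep, h]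

theorem foldl_innerStep_sepBlock (u : List Bool) (s : Stk) (hy : s.y = []) :
    (sepBlock u).foldl (fun s e => innerStep e s) s =
      { s with b := (sepBlock u).reverse ++ s.b, y := (sepBlock (flipHead u)).reverse } := by
  obtain _ | ⟨b, u⟩ := u
  · simp [sepBlock, innerStep, flipHead, hy]
  · change (sepBlock u).foldl (fun s e => innerStep e s) (innerStep (some b) s) = _
    rw [foldl_innerStep _ _ (by simp [innerStep])]
    simp [innerStep, hy, sepBlock, flipHead]

theorem exec_innerBody {v : Mem} (heq : v.eq = false) (e : Sym) (s : Stk) :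
    Exec ((.push .b fun v => v.z.getD none) ;; (.peek .y fun v o => { v with eq := o.isNone }) ;;
      (.push .y fun v => if v.eq then (v.z.getD none).map not else v.z.getD none) ;;
      .load fun v => { v with eq := false })
      { v with z := some e } s { v with z := some e } (innerStep e s) 5 := by
  refine Exec.of_eq ((Exec.push _ _ _ _).seq ((Exec.peek _ _ _ _).seq ((Exec.push _ _ _ _).seq
    (Exec.load _ _ _)))) ?_ ?_ (by omega)
  · cases v; simp_all
  · cases hy : s.y <;> simp [innerStep, Stk.set, Stk.fn, hy]

/-- The blocks of a list of strings. -/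
def sepBlocks (l : List (List Bool)) : List Sym := l.flatMap sepBlock

theorem count_sepBlocks (l : List (List Bool)) : (sepBlocks l).count none = l.length := by
  induction l with
  | nil => rfl
  | cons u l ih =>
    simp only [sepBlocks, List.flatMap_cons, List.count_append, count_sepBlock, List.length_cons]
      at ih ⊢
    omega

theorem length_pairSlotsWith (pre mid : ℕ) (u : List Bool) (l : List (List Bool)) :
    (pairSlotsWith pre u mid l).length = 2 * l.length := by
  induction l generalizing mid with
  | nil => rfl
  | cons w l ih => simp [pairSlotsWith, ih]; omega

theorem length_flipHead (u : List Bool) : (flipHead u).length = u.length := by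
  cases u <;> rfl

theorem sepBlock_injective : Function.Injective sepBlock := by
  intro u w h
  have h' := List.append_cancel_right h
  exact List.map_injective_iff.2 (Option.some_injective _) h'

theorem exec_innerLoop (l : List (List Bool)) {M pre mid : ℕ} {u : List Bool} {v : Mem} {s : Stk}
    (hv : v.Idle) (hmode : v.mode = none) (heq : v.eq = false) (hs : s.Clean)
    (ha : s.a.count none = pre + 1) (hb : s.b.count none = mid)
    (hi : s.inp = sepBlocks l) (hx : s.x = (sepBlock u).reverse) (hy : s.y = [])
    (hM : s.inp.length + s.b.length + s.a.length ≤ M)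
    (hxM : s.x.length ≤ M) (hsc : s.sc.length + 2 * l.length ≤ M) :
    Exec innerLoop v s v
      (({ s with inp := [], b := (sepBlocks l).reverse ++ s.b } : Stk).emit
        (pairSlotsWith pre u mid l))
      ((sepBlocks l).length * (pairTime M + 8) + 1) := by
  induction l generalizing s mid with
  | nil =>
    refine Exec.of_eq (exec_scan_nil hv.z hi) rfl ?_ (by simp)
    cases s
    simp only [sepBlocks, List.flatMap_nil] at hi
    subst hi
    rfl
  | cons w l ih =>
    have hcons : sepBlocks (w :: l) = sepBlock w ++ sepBlocks l := rfl
    rw [hcons] at hi ⊢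
    have hlen := congrArg List.length hi
    simp only [List.length_append, length_sepBlock] at hlen
    simp only [List.length_cons] at hsc
    set b' := (sepBlock w).reverse ++ s.b with hb'
    have hb'_len : b'.length = w.length + 1 + s.b.length := by
      simp only [hb', List.length_append, List.length_reverse, length_sepBlock]
    have hb'_count : b'.count none = mid + 1 := by
      simp only [hb', List.count_append, List.count_reverse, count_sepBlock, hb]; omega
    have hs' : ({ s with inp := sepBlocks l, b := b', y := (sepBlock (flipHead w)).reverse } :
        Stk).Clean :=
      ⟨hs.1, hs.2, hs.3, hs.4, hs.5, hs.6, hs.7, hs.8, hs.9, hs.10⟩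
    have h2 := exec_emitPair (M := M) hv hmode heq hs' ha hb'_count (count_sepBlocks l)
      (by simp only; omega) hxM
      (by simp only [List.length_reverse, length_sepBlock, length_flipHead]; omega)
      (by simp only; omega)
    have hx' : decide (s.x = (sepBlock (flipHead w)).reverse) = decide (u = flipHead w) := by
      rw [decide_eq_decide, hx, List.reverse_inj, sepBlock_injective.eq_iff]
    simp only [hx'] at h2
    set p := [(some true, pairWord pre mid l.length),
      (some (!decide (u = flipHead w)), pairWord pre mid l.length)] with hp
    have e₁ := Stk.emit_congr s (sepBlocks l) s.a b' s.x [] p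
    have e₂ := Stk.emit_congr s [] s.a ((sepBlock w ++ sepBlocks l).reverse ++ s.b) s.x s.y p
    have hs'' : ({ s with inp := sepBlocks l, b := b', y := [] } : Stk).Clean :=
      ⟨hs.1, hs.2, hs.3, hs.4, hs.5, hs.6, hs.7, hs.8, hs.9, hs.10⟩
    have h3 := ih (mid := mid + 1)
      (s := ({ s with inp := sepBlocks l, b := b', y := [] } : Stk).emit p)
      (hs''.emit _)
      (by rw [e₁]; exact ha) (by rw [e₁]; exact hb'_count) (by rw [e₁]) (by rw [e₁]; exact hx)
      (by rw [e₁]) (by rw [e₁]; simp only; omega) (by rw [e₁]; exact hxM)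
      (by rw [Stk.emit_sc_length]; simp [hp]; omega)
    refine Exec.of_eq (exec_scan_block w (sepBlocks l) hv.z (exec_innerBody heq)
      (fun _ _ _ => rfl) hi (tq := pairTime M) ?_ h3) rfl ?_ ?_
    · rw [foldl_innerStep_sepBlock _ _ (by exact hy)]
      exact h2
    · have h4 : pairSlotsWith pre u mid (w :: l) = p ++ pairSlotsWith pre u (mid + 1) l := rfl
      rw [h4, Stk.emit_append]
      congr 1
      refine Eq.trans ?_ e₂.symm
      rw [e₁]
      simp [hb', hy]
    · simp only [List.length_append, length_sepBlock]
      generalize pairTime M = T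
      have h : w.length * 8 ≤ w.length * (T + 8) := by gcongr; omega
      have h' : (w.length + 1 + (sepBlocks l).length) * (T + 8) = w.length * (T + 8) + T + 8 +
        (sepBlocks l).length * (T + 8) := by ring
      omega

/-- The loop over the first literal of a pair. Each literal moves from `inp` to `a`, and is copied
to `x`. -/
def outerLoop : Prog Key Sym Mem :=
  scan ((.push .a fun v => v.z.getD none) ;; .push .x fun v => v.z.getD none)
    (innerLoop ;; move .b .inp ;; clear .x)

theorem foldl_push_ax (l : List Sym) (s : Stk) :
    l.foldl (fun s e => { s with a := e :: s.a, x := e :: s.x }) s =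
      { s with a := l.reverse ++ s.a, x := l.reverse ++ s.x } := by
  induction l generalizing s with
  | nil => rfl
  | cons e l ih => rw [List.foldl_cons, ih]; simp

/-- The number of steps for the pairs with a given first literal. -/
def outerTime {R : Type} [CommSemiring R] (M : R) : R := M * (pairTime M + 8) + 4 * M + 10

theorem exec_outerLoop (l : List (List Bool)) {M pre : ℕ} {v : Mem} {s : Stk}
    (hv : v.Idle) (hmode : v.mode = none) (heq : v.eq = false) (hs : s.Clean)
    (ha : s.a.count none = pre) (hb : s.b = [])
    (hi : s.inp = sepBlocks l) (hx : s.x = []) (hy : s.y = [])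
    (hM : s.inp.length + s.a.length ≤ M)
    (hsc : s.sc.length + (pairSlots pre l).length ≤ M) :
    Exec outerLoop v s v
      (({ s with inp := [], a := (sepBlocks l).reverse ++ s.a } : Stk).emit (pairSlots pre l))
      ((sepBlocks l).length * (outerTime M + 8) + 1) := by
  induction l generalizing s pre with
  | nil =>
    refine Exec.of_eq (exec_scan_nil hv.z hi) rfl ?_ (by simp)
    cases s
    simp only [sepBlocks, List.flatMap_nil] at hi
    subst hi
    rfl
  | cons u l ih =>
    have hcons : sepBlocks (u :: l) = sepBlock u ++ sepBlocks l := rfl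
    rw [hcons] at hi ⊢
    have hlen := congrArg List.length hi
    simp only [List.length_append, length_sepBlock] at hlen
    simp only [pairSlots, List.length_append, length_pairSlotsWith] at hsc
    set a' := (sepBlock u).reverse ++ s.a with ha'
    have ha'_len : a'.length = u.length + 1 + s.a.length := by
      simp only [ha', List.length_append, List.length_reverse, length_sepBlock]
    have ha'_count : a'.count none = pre + 1 := by
      simp only [ha', List.count_append, List.count_reverse, count_sepBlock, ha]; omega
    have hs' : ({ s with inp := sepBlocks l, a := a', x := (sepBlock u).reverse } : Stk).Clean :=
      ⟨hs.1, hs.2, hs.3, hs.4, hs.5, hs.6, hs.7, hs.8, hs.9, hs.10⟩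
    have h2 := exec_innerLoop l (M := M) (mid := 0) (u := u) hv hmode heq hs' ha'_count
      (by simp [hb]) rfl rfl hy (by simp only [hb, List.length_nil]; omega)
      (by simp only [List.length_reverse, length_sepBlock]; omega) (by simp only; omega)
    set p := pairSlotsWith pre u 0 l with hp
    have e₀ := Stk.emit_congr s [] a' ((sepBlocks l).reverse ++ s.b) (sepBlock u).reverse s.y p
    have e₁ := Stk.emit_congr s (sepBlocks l) a' [] [] s.y p
    have e₂ := Stk.emit_congr s [] ((sepBlock u ++ sepBlocks l).reverse ++ s.a) s.b s.x s.y p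
    have hs'' : ({ s with inp := sepBlocks l, a := a', b := [], x := [] } : Stk).Clean :=
      ⟨hs.1, hs.2, hs.3, hs.4, hs.5, hs.6, hs.7, hs.8, hs.9, hs.10⟩
    have h3 := ih (pre := pre + 1)
      (s := ({ s with inp := sepBlocks l, a := a', b := [], x := [] } : Stk).emit p)
      (hs''.emit _)
      (by rw [e₁]; exact ha'_count) (by rw [e₁]) (by rw [e₁]) (by rw [e₁])
      (by rw [e₁]; exact hy) (by rw [e₁]; simp only; omega)
      (by rw [Stk.emit_sc_length, hp, length_pairSlotsWith]; simp only; omega)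
    have hbody (e : Sym) (s : Stk) : Exec ((.push .a fun v => v.z.getD none) ;;
        .push .x fun v => v.z.getD none) { v with z := some e } s { v with z := some e }
        { s with a := e :: s.a, x := e :: s.x } 5 :=
      Exec.of_eq ((Exec.push _ _ _ _).seq (Exec.push _ _ _ _)) rfl rfl (by omega)
    refine Exec.of_eq (exec_scan_block u (sepBlocks l) hv.z hbody
      (fun _ _ _ => rfl) hi (tq := outerTime M) ?_ h3) rfl ?_ ?_
    · rw [foldl_push_ax]
      have h4 := h2.seq ((exec_move (k := .b) (k' := .inp) (by decide) _ _).seq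
        (exec_clear .x _ _))
      have hst : ({ s.set .inp (sepBlocks l) with
          a := (sepBlock u).reverse ++ (s.set .inp (sepBlocks l)).a
          x := (sepBlock u).reverse ++ (s.set .inp (sepBlocks l)).x } : Stk) =
          { s with inp := sepBlocks l, a := a', x := (sepBlock u).reverse } := by
        simp [Stk.set, hx, ha']
      rw [hst]
      refine Exec.of_eq h4 (Mem.set_z hv.z) ?_ ?_
      · rw [e₁]
        erw [e₀]
        simp [Stk.set, Stk.fn, hb]
      · have h5 := congrArg (fun s : Stk => s.b.length) e₀
        have h6 := congrArg (fun s : Stk => s.x.length) e₀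
        simp only [hb, List.append_nil, List.length_reverse, length_sepBlock] at h5 h6
        simp only [Stk.set, Stk.fn, hb, List.append_nil]
        rw [h5, h6, outerTime]
        have h7 : (sepBlocks l).length * (pairTime M + 8) ≤ M * (pairTime M + 8) := by
          gcongr; omega
        omega
    · rw [pairSlots, Stk.emit_append]
      congr 1
      refine Eq.trans ?_ e₂.symm
      rw [e₁]
      simp [ha', hb, hx]
    · simp only [List.length_append, length_sepBlock]
      generalize outerTime M = T
      have h : u.length * 8 ≤ u.length * (T + 8) := by gcongr; omega
      have h' : (u.length + 1 + (sepBlocks l).length) * (T + 8) = u.length * (T + 8) + T + 8 +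
        (sepBlocks l).length * (T + 8) := by ring
      omega

/-! ### The program of the reduction -/

/-- For every symbol on stack `k`, write a unary digit. -/
def tally (k : Key) : Prog Key Sym Mem := forZ k (.push .out fun _ => some true)

theorem exec_tally {k : Key} (h : k ≠ .out) (v : Mem) (s : Stk) :
    Exec (tally k) v s { v with z := none }
      ((s.set k []).set .out (List.replicate (s.fn k).length (some true) ++ s.out))
      (2 * (s.fn k).length + 1) := by
  have hout (s : Stk) (l : List Sym) : (s.set k l).out = s.out := Stk.fn_set_of_ne s h.symm l
  generalize hl : s.fn k = l
  induction l generalizing v s with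
  | nil =>
    refine Exec.of_eq (Exec.loop_stop hl rfl) rfl ?_ (by simp)
    rw [← hl, Stk.set_fn_self, hl]
    rfl
  | cons e l ih =>
    refine Exec.of_eq (Exec.loop_cons hl rfl (Exec.push _ _ _ _) (ih _ _ ?_)) rfl ?_ ?_
    · rw [Stk.fn_set_of_ne _ h, Stk.fn_set_self]
    · have e₁ : (s.set k l).fn .out = s.out := hout s l
      have e₂ (s : Stk) (x : List Sym) : (s.set .out x).out = x := rfl
      rw [e₁, e₂, Stk.set_comm _ h.symm, Stk.set_set, Stk.set_set, List.length_cons,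
        List.replicate_succ', List.append_assoc]
      rfl
    · simp only [List.length_cons]; omega

/-- The code of the last family. -/
def lastStr (n s : ℕ) : List Sym :=
  blockStr s (some true) (List.replicate n none) (some true :: List.replicate n none)
    (List.replicate n none)

/-- Write the last family, the number of matrices and their size. -/
def finish : Prog Key Sym Mem :=
  marks .a none none none ;; (.push .u fun _ => some true) ;;
  (.load fun v => { v with mode := some true }) ;; emitBlock ;; clear .c ;; clear .r ;; clear .u ;;
  clear .sc ;; (.push .out fun _ => none) ;; tally .mc ;; (.push .out fun _ => none) ;; tally .d ;;
  clear .a ;; .load fun v => { v with mode := none }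

theorem exec_finish {n : ℕ} {v : Mem} {s : Stk} (hv : v.Idle) (hmode : v.mode = none)
    (hs : s.Clean) (ha : s.a.count none = n) :
    Exec finish v s v
      { s with
        a := [], sc := [], mc := []
        out := encodeUnarySep n ++ encodeUnarySep (n + s.mc.length) ++
          (lastStr n s.sc.length ++ s.out) }
      (blockTime n s.sc.length + 12 * s.a.length + 10 * n + 2 * s.sc.length + 2 * s.mc.length +
        30) := by
  have hv' : Mem.Idle { v with mode := some true } := by
    obtain ⟨h1, h2, h3, h4, h5, h6, h7, h8, h9⟩ := hv
    exact ⟨h1, h2, h3, h4, h5, h6, h7, h8, h9⟩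
  have h1 := exec_marks (k := .a) (Or.inr (Or.inl rfl)) none none none [] hv hs.t
  have e1 : s.fn .a = s.a := rfl
  rw [e1, ha, queueWord_none, List.append_nil, hs.word_nil] at h1
  obtain ⟨c1, c2, c3, c4, c5, c6, c7, c8, c9, c10⟩ := hs
  refine Exec.of_eq (h1.seq ((Exec.push _ _ _ _).seq ((Exec.load _ _ _).seq
    ((exec_emitBlock (n := s.sc.length) (w := List.replicate n none)
      (m := some true :: List.replicate n none) ?_ hv' (by exact c10) (by exact c1) rfl
      (by simp [Stk.set, Stk.fn, Stk.word]) (by exact c7) (by exact c9) rfl (by exact c5) rfl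
      (by exact c3)).seq
    ((exec_clear _ _ _).seq ((exec_clear _ _ _).seq ((exec_clear _ _ _).seq ((exec_clear _ _ _).seq
    ((Exec.push _ _ _ _).seq ((exec_tally (by decide) _ _).seq ((Exec.push _ _ _ _).seq
    ((exec_tally (by decide) _ _).seq ((exec_clear _ _ _).seq
    (Exec.load _ _ _)))))))))))))) ?_ ?_ ?_
  · simp
  · obtain ⟨d1, -⟩ := hv
    cases v; simp_all
  · simp [Stk.set, Stk.fn, Stk.word, c2, c4, c6, c8, encodeUnarySep, lastStr]
  · simp only [Stk.set, Stk.fn, Stk.word, List.length_replicate, List.length_append, blockTime,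
      List.length_cons]
    omega

/-- The code of a literal without its separator. -/
def Literal.bits (l : Literal) : List Bool := l.pos :: Computability.encodeNat l.var

/-- The literals of a formula, in order. -/
def literals (φ : Formula3) : List Literal := φ.flatMap fun c => [c 0, c 1, c 2]

/-- The strings attached to the coordinates: the empty string for the junk coordinate and the
homogenizing coordinate, the code of the literal for the others. The first two count as
complementary, which does no harm since the junk coordinate is `0` anyway. -/
def labels (φ : Formula3) : List (List Bool) := [] :: [] :: (literals φ).map Literal.bits

/-- All slots of a formula. -/
def slots (φ : Formula3) : List (Sym × List Sym) :=
  allClauseSlots 0 φ.length ++ pairSlots 0 (labels φ)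

theorem encodeFormula_eq (φ : Formula3) :
    encodeFormula φ = sepBlocks ((literals φ).map Literal.bits) := by
  induction φ with
  | nil => rfl
  | cons c φ ih =>
    rw [encodeFormula_cons, ih]
    rfl

theorem sepBlocks_labels (φ : Formula3) :
    sepBlocks (labels φ) = none :: none :: encodeFormula φ := by
  rw [encodeFormula_eq]; rfl

theorem length_literals (φ : Formula3) : (literals φ).length = 3 * φ.length := by
  induction φ with
  | nil => rfl
  | cons c φ ih =>
    simp only [literals, List.flatMap_cons, List.length_append, List.length_cons,
      List.length_nil] at ih ⊢
    omega

/-- The stacks between the phases of the reduction. -/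
def Stk.of (inp a out sc mc : List Sym) : Stk :=
  ⟨inp, out, a, [], [], [], [], [], [], [], [], [], [], [], [], sc, mc⟩

theorem Stk.emit_of (i a o sc mc : List Sym) (l : List (Sym × List Sym)) :
    (Stk.of i a o sc mc).emit l = Stk.of i a ((Stk.of [] [] o sc mc).emit l).out
      ((Stk.of [] [] o sc mc).emit l).sc ((Stk.of [] [] o sc mc).emit l).mc := by
  induction l generalizing o sc mc with
  | nil => rfl
  | cons p l ih => exact ih _ _ _

theorem Stk.clean_of (i a o mc : List Sym) : (Stk.of i a o [] mc).Clean :=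
  ⟨rfl, rfl, rfl, rfl, rfl, rfl, rfl, rfl, rfl, rfl⟩

/-- The initial memory. -/
def Mem.init : Mem := ⟨none, none, none, none, none, false, none, none, none, none, 0, false⟩

/-- The program of the reduction. -/
def reduction : Prog Key Sym Mem :=
  clauseLoop ;; (move .a .inp ;; (.push .inp fun _ => none) ;; (.push .inp fun _ => none)) ;;
    outerLoop ;; finish

/-- The output of the reduction. -/
def outStr (φ : Formula3) : List Sym :=
  encodeUnarySep (3 * φ.length + 2) ++
    encodeUnarySep (3 * φ.length + 2 + 3 * (3 * φ.length + 2) * (slots φ).length) ++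
    (lastStr (3 * φ.length + 2) (slots φ).length ++ ((Stk.of [] [] [] [] []).emit (slots φ)).out)

theorem length_allClauseSlots (pre k : ℕ) : (allClauseSlots pre k).length = 4 * k := by
  induction k generalizing pre with
  | zero => rfl
  | succ k ih => simp [allClauseSlots, clauseSlots, ih]; omega

theorem length_pairSlots (pre : ℕ) (l : List (List Bool)) :
    (pairSlots pre l).length = l.length * (l.length - 1) := by
  induction l generalizing pre with
  | nil => rfl
  | cons u l ih =>
    simp only [pairSlots, List.length_append, length_pairSlotsWith, ih, List.length_cons]
    cases l.length <;> simp; ring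

theorem length_word_of_mem_clauseSlots {pre k : ℕ} {p : Sym × List Sym}
    (hp : p ∈ allClauseSlots pre k) : p.2.length = pre + 3 * k + 2 := by
  induction k generalizing pre with
  | zero => simp [allClauseSlots] at hp
  | succ k ih =>
    rw [allClauseSlots, List.mem_append] at hp
    rcases hp with hp | hp
    · simp only [clauseSlots, List.mem_cons, List.not_mem_nil, or_false] at hp
      rcases hp with rfl | rfl | rfl | rfl <;> simp [clauseWord] <;> ring
    · rw [ih hp]; ring

theorem length_word_of_mem_pairSlots {pre : ℕ} {l : List (List Bool)} {p : Sym × List Sym}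
    (hp : p ∈ pairSlots pre l) : p.2.length = pre + l.length := by
  have aux : ∀ (l : List (List Bool)) {pre mid : ℕ} {u : List Bool} {p : Sym × List Sym},
      p ∈ pairSlotsWith pre u mid l → p.2.length = pre + mid + l.length + 1 := by
    intro l
    induction l with
    | nil => intro _ _ _ p hp; simp [pairSlotsWith] at hp
    | cons w l ih =>
      intro pre mid u p hp
      simp only [pairSlotsWith, List.mem_cons] at hp
      rcases hp with rfl | rfl | hp
      · simp [length_pairWord]; ring
      · simp [length_pairWord]; ring
      · rw [ih hp, List.length_cons]; ring
  induction l generalizing pre with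
  | nil => simp [pairSlots] at hp
  | cons u l ih =>
    rw [pairSlots, List.mem_append] at hp
    rcases hp with hp | hp
    · rw [aux l hp, List.length_cons]; ring
    · rw [ih hp, List.length_cons]; ring

theorem length_word_of_mem_slots {φ : Formula3} {p : Sym × List Sym} (hp : p ∈ slots φ) :
    p.2.length = 3 * φ.length + 2 := by
  rcases List.mem_append.1 hp with hp | hp
  · rw [length_word_of_mem_clauseSlots hp]; ring
  · rw [length_word_of_mem_pairSlots hp]
    simp [labels, length_literals]

theorem Stk.length_emit_mc {n : ℕ} {l : List (Sym × List Sym)} (hl : ∀ p ∈ l, p.2.length = n)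
    (s : Stk) : (s.emit l).mc.length = 3 * n * l.length + s.mc.length := by
  induction l generalizing s with
  | nil => simp [Stk.emit]
  | cons p l ih =>
    refine (ih (fun q hq => hl q (by simp [hq])) (s.emit₁ p)).trans ?_
    simp only [Stk.emit₁, List.length_append, List.length_replicate, List.length_cons,
      hl p (by simp)]
    ring

/-- A bound for the length of the input and the number of slots, given the length of the input. -/
def sizeBound {R : Type} [CommSemiring R] (n : R) : R := 6 * (n + 2) * (n + 2)

/-- The number of steps of the reduction, given the length of the input. -/
def reductionTime {R : Type} [CommSemiring R] (n : R) : R :=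
  n * (clauseTime (sizeBound n) + 8) + (n + 2) * (outerTime (sizeBound n) + 8) +
    blockTime (sizeBound n) (sizeBound n) + 30 * sizeBound n + 6 * sizeBound n * sizeBound n + 50

theorem exec_reduction (φ : Formula3) :
    Exec reduction Mem.init (Stk.of (encodeFormula φ) [] [] [] []) Mem.init
      (Stk.of [] [] (outStr φ) [] []) (reductionTime (encodeFormula φ).length) := by
  set ℓ := (encodeFormula φ).length with hℓ
  have hn : 3 * φ.length ≤ ℓ := by
    rw [← count_encodeFormula]; exact List.count_le_length
  have hlab : (labels φ).length = 3 * φ.length + 2 := by simp [labels, length_literals]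
  have hslots : (slots φ).length ≤ sizeBound ℓ := by
    have : (3 * φ.length + 2) * (3 * φ.length + 2 - 1) ≤ (ℓ + 2) * (ℓ + 2) := by gcongr; omega
    simp only [slots, List.length_append, length_allClauseSlots, length_pairSlots, hlab, sizeBound]
    nlinarith
  have hM : 2 * ℓ + 4 ≤ sizeBound ℓ := by simp only [sizeBound]; nlinarith
  have hidle : Mem.init.Idle := ⟨rfl, rfl, rfl, rfl, rfl, rfl, rfl, rfl, rfl⟩
  have hsl : (slots φ).length = 4 * φ.length + (pairSlots 0 (labels φ)).length := by
    simp [slots, length_allClauseSlots]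
  have htime : reductionTime ℓ = ℓ * (clauseTime (sizeBound ℓ) + 8) +
    (ℓ + 2) * (outerTime (sizeBound ℓ) + 8) + blockTime (sizeBound ℓ) (sizeBound ℓ) +
    30 * sizeBound ℓ + 6 * sizeBound ℓ * sizeBound ℓ + 50 := rfl
  rw [htime]
  generalize sizeBound ℓ = M at hslots hM
  set E := (Stk.of [] [] [] [] []).emit (allClauseSlots 0 φ.length) with hE
  set F := (Stk.of [] [] [] [] []).emit (slots φ) with hF
  have h1 : Exec clauseLoop Mem.init (Stk.of (encodeFormula φ) [] [] [] []) Mem.init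
      (Stk.of [] (encodeFormula φ).reverse E.out E.sc E.mc) (ℓ * (clauseTime M + 8) + 1) := by
    refine Exec.of_eq (exec_clauseLoop φ (M := M) (pre := 0) hidle rfl rfl (Stk.clean_of _ _ _ _)
      rfl rfl ?_ ?_) rfl ?_ le_rfl
    · simp only [Stk.of, List.length_nil]; omega
    · simp only [Stk.of, List.length_nil]; omega
    · refine (Stk.emit_of [] ((encodeFormula φ).reverse ++ []) [] [] [] _).trans ?_
      rw [List.append_nil]
  have h2 : Exec (move .a .inp ;; (.push .inp fun _ => none) ;; (.push .inp fun _ => none))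
      Mem.init (Stk.of [] (encodeFormula φ).reverse E.out E.sc E.mc) Mem.init
      (Stk.of (sepBlocks (labels φ)) [] E.out E.sc E.mc) (2 * ℓ + 3) := by
    refine Exec.of_eq ((exec_move (by decide) _ _).seq ((Exec.push _ _ _ _).seq
      (Exec.push _ _ _ _))) rfl ?_ ?_
    · simp [Stk.set, Stk.fn, Stk.of, sepBlocks_labels]
    · simp [Stk.fn, Stk.of, hℓ]
  have hEsc : E.sc.length = 4 * φ.length := by
    rw [hE, Stk.emit_sc_length, length_allClauseSlots]; simp [Stk.of]
  have h3 : Exec outerLoop Mem.init (Stk.of (sepBlocks (labels φ)) [] E.out E.sc E.mc) Mem.init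
      (Stk.of [] (sepBlocks (labels φ)).reverse F.out F.sc F.mc)
      ((ℓ + 2) * (outerTime M + 8) + 1) := by
    have hclean : (Stk.of (sepBlocks (labels φ)) [] E.out E.sc E.mc).Clean := by
      rw [hE, ← Stk.emit_of]; exact (Stk.clean_of _ _ _ _).emit _
    refine Exec.of_eq (exec_outerLoop (labels φ) (M := M) (pre := 0) hidle rfl rfl hclean
      rfl rfl rfl rfl rfl ?_ ?_) rfl ?_ ?_
    · simp only [Stk.of, sepBlocks_labels, List.length_cons, List.length_nil]; omega
    · simp only [Stk.of]; omega
    · have h : E = Stk.of [] [] E.out E.sc E.mc := Stk.emit_of _ _ _ _ _ _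
      refine (Stk.emit_of [] ((sepBlocks (labels φ)).reverse ++ []) E.out E.sc E.mc _).trans ?_
      rw [List.append_nil, ← h, hE, ← Stk.emit_append]
      rfl
    · rw [sepBlocks_labels]; exact le_rfl
  have hFsc : F.sc.length = (slots φ).length := by
    rw [hF, Stk.emit_sc_length]; simp [Stk.of]
  have hFmc : F.mc.length = 3 * (3 * φ.length + 2) * (slots φ).length := by
    rw [hF, Stk.length_emit_mc fun p hp => length_word_of_mem_slots hp]; simp [Stk.of]
  have h4 : Exec finish Mem.init (Stk.of [] (sepBlocks (labels φ)).reverse F.out F.sc F.mc) Mem.init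
      (Stk.of [] [] (outStr φ) [] []) (blockTime (3 * φ.length + 2) (slots φ).length +
        12 * (ℓ + 2) + 10 * (3 * φ.length + 2) + 2 * (slots φ).length +
        2 * (3 * (3 * φ.length + 2) * (slots φ).length) + 30) := by
    have hclean : (Stk.of [] (sepBlocks (labels φ)).reverse F.out F.sc F.mc).Clean := by
      rw [hF, ← Stk.emit_of]; exact (Stk.clean_of _ _ _ _).emit _
    refine Exec.of_eq (exec_finish (n := 3 * φ.length + 2) hidle rfl hclean ?_) rfl ?_ ?_
    · simp only [Stk.of, List.count_reverse, count_sepBlocks, hlab]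
    · simp only [Stk.of, hFsc, hFmc]
      rfl
    · simp only [Stk.of, hFsc, hFmc, sepBlocks_labels, List.length_reverse, List.length_cons]
      omega
  refine Exec.of_eq (h1.seq (h2.seq (h3.seq h4))) rfl rfl ?_
  have hb : blockTime (3 * φ.length + 2) (slots φ).length ≤ blockTime M M := by
    unfold blockTime; gcongr <;> omega
  have hm : (3 * φ.length + 2) * (slots φ).length ≤ M * M := by gcongr; omega
  have hm' : 2 * (3 * (3 * φ.length + 2) * (slots φ).length) =
    6 * ((3 * φ.length + 2) * (slots φ).length) := by ring
  have hm'' : 6 * M * M = 6 * (M * M) := by ring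
  rw [hm', hm'']
  omega

/-- The time bound of the reduction is a polynomial. -/
theorem eval_reductionTime (n : ℕ) :
    (reductionTime (Polynomial.X : Polynomial ℕ)).eval n = reductionTime n := by
  simp [reductionTime, clauseTime, outerTime, pairTime, slotTime, blockTime, sizeBound]

/-- A map to strings is computable in polynomial time if it is realized by the program of the
reduction. -/
theorem reduction_computable {f : Formula3 → UnitalInstance}
    (h : ∀ φ, encodeUnitalInstance (f φ) = outStr φ) :
    Nonempty (Turing.TM2ComputableInPolyTime encodeFormula encodeUnitalInstance f) := by
  refine computableInPolyTime f reduction .inp .out Mem.init (reductionTime Polynomial.X)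
    fun φ => ?_
  rw [eval_reductionTime, h]
  have e₁ : Function.update (fun _ => []) Key.inp (encodeFormula φ) =
      (Stk.of (encodeFormula φ) [] [] [] []).fn := by
    funext k; cases k <;> rfl
  have e₂ : Function.update (fun _ => []) Key.out (outStr φ) =
      (Stk.of [] [] (outStr φ) [] []).fn := by
    funext k; cases k <;> rfl
  rw [e₁, e₂]
  exact exec_reduction φ

open Computability

/-! ### The matrices behind the strings -/

/-- The rational number denoted by a coefficient. -/
def sgn : Sym → ℚ
  | none => 0
  | some false => 1
  | some true => -1

theorem encodeNat_two_pow (s : ℕ) : encodeNat (2 ^ s) = List.replicate s false ++ [true] := by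
  have h1 : ∀ s : ℕ, ((PosNum.bit0^[s] PosNum.one : PosNum) : ℕ) = 2 ^ s := by
    intro s
    induction s with
    | zero => rfl
    | succ s ih => rw [Function.iterate_succ_apply', PosNum.cast_bit0, ih]; ring
  have h2 : ∀ s : ℕ, encodePosNum (PosNum.bit0^[s] PosNum.one) =
      List.replicate s false ++ [true] := by
    intro s
    induction s with
    | zero => rfl
    | succ s ih => rw [Function.iterate_succ_apply', encodePosNum, ih]; rfl
  have h3 : ((2 ^ s : ℕ) : Num) = Num.pos (PosNum.bit0^[s] PosNum.one) := by
    rw [← h1, ← Num.of_to_nat (Num.pos _)]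
    rfl
  rw [encodeNat, h3, encodeNum, h2]

theorem encodeNatSep_two_pow (s : ℕ) :
    encodeNatSep (2 ^ s) = List.replicate s (some false) ++ [some true, none] := by
  simp [encodeNatSep, encodeNat_two_pow]

theorem encodeRat_sgn (s : ℕ) (e : Sym) : encodeRat (sgn e / 2 ^ s) = entryStr s e := by
  have h0 : encodeNatSep 0 = [none] := rfl
  have h1 : encodeNatSep 1 = [some true, none] := rfl
  have hpos : (0 : ℚ) < 2 ^ s := by positivity
  have hcast : (2 : ℚ) ^ s = ((2 ^ s : ℕ) : ℚ) := by push_cast; rfl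
  rcases e with _ | _ | _
  · simp [sgn, encodeRat, entryStr, h0, h1]
  · have hn : ¬ ((1 : ℚ) / 2 ^ s < 0) := not_lt.2 (by positivity)
    have hq : (1 : ℚ) / 2 ^ s = Rat.divInt 1 ((2 ^ s : ℕ) : ℤ) := by
      rw [Rat.divInt_eq_div]; push_cast; rfl
    have hnum : ((1 : ℚ) / 2 ^ s).num = 1 := by
      rw [hcast, one_div, Rat.inv_natCast_num_of_pos (by positivity)]
    have hden : ((1 : ℚ) / 2 ^ s).den = 2 ^ s := by
      rw [hcast, one_div, Rat.inv_natCast_den_of_pos (by positivity)]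
    simp [sgn, encodeRat, entryStr, -one_div, hn, hnum, hden, h1, encodeNatSep_two_pow]
  · have hn : (-1 : ℚ) / 2 ^ s < 0 := div_neg_of_neg_of_pos (by norm_num) hpos
    have hnum : ((-1 : ℚ) / 2 ^ s).num = -1 := by
      rw [neg_div, Rat.neg_num, hcast, one_div, Rat.inv_natCast_num_of_pos (by positivity)]
    have hden : ((-1 : ℚ) / 2 ^ s).den = 2 ^ s := by
      rw [neg_div, Rat.neg_den, hcast, one_div, Rat.inv_natCast_den_of_pos (by positivity)]
    simp [sgn, encodeRat, entryStr, hn, hnum, hden, h1, encodeNatSep_two_pow]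

/-- The `c`-th matrix of the family given by a mode and a coefficient for each coordinate, with
denominators `2 ^ s`; `z` is the junk coordinate. -/
def slotMatrix {ι : Type} [DecidableEq ι] (z : ι) (s : ℕ) (mode : Sym) (w : ι → Sym) (c : ι) :
    Matrix ι ι ℚ :=
  Matrix.of fun r d => sgn (coef mode (w c) (w r) (w d) (decide (r = z)) (decide (d = c))) / 2 ^ s

/-- The coefficient at a coordinate: words begin at the last coordinate, since what is written first
comes last in the output. -/
def revGet {n : ℕ} (w : List Sym) (i : Fin n) : Sym := w.getD i.rev none

/-- The code of a matrix. -/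
def encodeMatrix {n : ℕ} (A : Matrix (Fin n) (Fin n) ℚ) : List Sym :=
  (List.finRange n).flatMap fun r => (List.finRange n).flatMap fun c => encodeRat (A r c)

theorem flatMap_finRange_succ {α : Type} (n : ℕ) (f : Fin (n + 1) → List α) :
    (List.finRange (n + 1)).flatMap f =
      ((List.finRange n).flatMap fun i => f i.castSucc) ++ f (Fin.last n) := by
  rw [List.finRange_succ_last, List.flatMap_append, List.flatMap_map]
  simp

theorem revGet_castSucc {n : ℕ} (e : Sym) (w : List Sym) (i : Fin n) :
    revGet (e :: w) i.castSucc = revGet w i := by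
  simp [revGet, Fin.rev_castSucc]

theorem revGet_last {n : ℕ} (e : Sym) (w : List Sym) : revGet (e :: w) (Fin.last n) = e := by
  simp [revGet]

theorem rowStr_eq (s : ℕ) (mode wc wr : Sym) (j : Bool) {n : ℕ} {l m : List Sym}
    (hl : l.length = n) (hm : m.length = n) :
    rowStr s mode wc wr j l m = (List.finRange n).flatMap fun d =>
      entryStr s (coef mode wc wr (revGet l d) j (decide (revGet m d = some true))) := by
  induction n generalizing l m with
  | zero =>
    rw [List.length_eq_zero_iff] at hl
    subst hl
    simp [rowStr]
  | succ n ih =>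
    obtain ⟨e, l, rfl⟩ := List.exists_cons_of_length_eq_add_one hl
    obtain ⟨e', m, rfl⟩ := List.exists_cons_of_length_eq_add_one hm
    rw [flatMap_finRange_succ, rowStr, ih (by simpa using hl) (by simpa using hm)]
    simp only [revGet_castSucc, revGet_last]

theorem rowsStr_eq (s : ℕ) (mode wc : Sym) (l m : List Sym) (j : Bool) {n : ℕ} {k : List Sym}
    (hk : k.length = n) :
    rowsStr s mode wc l m j k = (List.finRange n).flatMap fun r =>
      rowStr s mode wc (revGet k r) (j && decide (r.rev.val = 0)) l m := by
  induction n generalizing k j with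
  | zero =>
    rw [List.length_eq_zero_iff] at hk
    subst hk
    simp [rowsStr]
  | succ n ih =>
    obtain ⟨e, k, rfl⟩ := List.exists_cons_of_length_eq_add_one hk
    rw [flatMap_finRange_succ, rowsStr, ih _ (by simpa using hk)]
    simp only [revGet_castSucc, revGet_last]
    simp [Fin.rev_castSucc]

theorem blockStr_eq (s : ℕ) (mode : Sym) (w : List Sym) {n : ℕ} (m k : List Sym)
    (hk : k.length = n) :
    blockStr s mode w m k = (List.finRange n).flatMap fun c =>
      rowsStr s mode (revGet k c) w ((List.replicate c.rev.val none ++ m).take w.length) true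
        w := by
  induction n generalizing m k with
  | zero =>
    rw [List.length_eq_zero_iff] at hk
    subst hk
    simp [blockStr]
  | succ n ih =>
    obtain ⟨e, k, rfl⟩ := List.exists_cons_of_length_eq_add_one hk
    rw [flatMap_finRange_succ, blockStr, ih _ _ (by simpa using hk)]
    simp only [revGet_castSucc, revGet_last]
    simp [Fin.rev_castSucc, List.replicate_succ']

/-- The family of a slot. -/
def family {n : ℕ} [NeZero n] (s : ℕ) (mode : Sym) (w : List Sym) :
    List (Matrix (Fin n) (Fin n) ℚ) :=
  (List.finRange n).map (slotMatrix (Fin.rev 0) s mode (revGet w))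

theorem blockStr_eq_family {n : ℕ} [NeZero n] (s : ℕ) (mode : Sym) {w : List Sym}
    (hw : w.length = n) :
    blockStr s mode w (some true :: List.replicate w.length none) w =
      (family (n := n) s mode w).flatMap encodeMatrix := by
  have hmark (c d : Fin n) : (revGet ((List.replicate c.rev.val none ++
      some true :: List.replicate n none).take n) d = some true) ↔ d = c := by
    have hd : d.rev.val < n := d.rev.isLt
    rw [revGet, List.getD_eq_getElem?_getD, List.getElem?_take_of_lt hd]
    rcases lt_trichotomy d.rev.val c.rev.val with h | h | h
    · rw [List.getElem?_append_left (by simpa using h), List.getElem?_replicate_of_lt h]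
      simp only [Option.getD_some, reduceCtorEq, false_iff]
      rintro rfl
      exact absurd h (lt_irrefl _)
    · rw [List.getElem?_append_right (by simp only [List.length_replicate]; omega)]
      have : d = c := Fin.rev_injective (Fin.ext h)
      simp [this]
    · rw [List.getElem?_append_right (by simpa using h.le), List.length_replicate]
      obtain ⟨t, ht⟩ := Nat.exists_eq_add_of_lt h
      have : d ≠ c := by rintro rfl; exact absurd h (lt_irrefl _)
      rw [ht, show c.rev.val + t + 1 - c.rev.val = t + 1 by omega, List.getElem?_cons_succ,
        List.getElem?_replicate_of_lt (by omega)]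
      simp [this]
  rw [blockStr_eq s mode w _ _ hw, family, List.flatMap_map]
  refine List.flatMap_congr fun c _ => ?_
  rw [rowsStr_eq s mode _ _ _ _ hw, encodeMatrix]
  refine List.flatMap_congr fun r _ => ?_
  have hz : decide (r.rev.val = 0) = decide (r = Fin.rev 0) := by
    rw [decide_eq_decide, Fin.val_eq_zero_iff, Fin.rev_eq_iff]
  rw [rowStr_eq s mode _ _ _ hw (by simp; omega)]
  refine List.flatMap_congr fun d _ => ?_
  rw [slotMatrix, Matrix.of_apply, encodeRat_sgn, hw, Bool.true_and, hz,
    decide_eq_decide.2 (hmark c d)]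

/-- The matrices of a list of slots, the first of which has scale `s`, in the order of the output:
the first slot comes last. -/
def slotsMatrices {n : ℕ} [NeZero n] : ℕ → List (Sym × List Sym) →
    List (Matrix (Fin n) (Fin n) ℚ)
  | _, [] => []
  | s, p :: l => slotsMatrices (s + 1) l ++ (family (expo p.1 s) p.1 p.2 ++
      (family (expo p.1 s) p.1 p.2 ++ family (expo p.1 s) p.1 p.2))

theorem emit_out_eq {n : ℕ} [NeZero n] {l : List (Sym × List Sym)}
    (hl : ∀ p ∈ l, p.2.length = n) (s : Stk) :
    (s.emit l).out =
      (slotsMatrices (n := n) (s.sc.length + 1) l).flatMap encodeMatrix ++ s.out := by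
  induction l generalizing s with
  | nil => rfl
  | cons p l ih =>
    refine (ih (fun q hq => hl q (by simp [hq])) (s.emit₁ p)).trans ?_
    simp only [slotsMatrices, List.flatMap_append, Stk.emit₁, List.length_cons, List.append_assoc,
      familyStr, blockStr_eq_family _ _ (hl p (by simp))]

/-- The size of the matrices: two coordinates and one for each literal. -/
abbrev size (φ : Formula3) : ℕ := 3 * φ.length + 2

/-- All matrices of the instance attached to a formula. -/
def matrices (φ : Formula3) : List (Matrix (Fin (size φ)) (Fin (size φ)) ℚ) :=
  family (slots φ).length (some true) (List.replicate (size φ) none) ++ slotsMatrices 1 (slots φ)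

theorem length_slotsMatrices {n : ℕ} [NeZero n] (s : ℕ) (l : List (Sym × List Sym)) :
    (slotsMatrices (n := n) s l).length = 3 * n * l.length := by
  induction l generalizing s with
  | nil => rfl
  | cons p l ih =>
    simp only [slotsMatrices, List.length_append, ih, family, List.length_map,
      List.length_finRange, List.length_cons]
    ring

theorem outStr_eq (φ : Formula3) : outStr φ = encodeUnarySep (size φ) ++
    encodeUnarySep (matrices φ).length ++ (matrices φ).flatMap encodeMatrix := by
  have h1 : (matrices φ).length = 3 * φ.length + 2 + 3 * (3 * φ.length + 2) * (slots φ).length := by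
    rw [matrices, List.length_append, length_slotsMatrices]
    simp [family]
  have h2 := blockStr_eq_family (n := size φ) (slots φ).length (some true)
    (w := List.replicate (size φ) none) (by simp)
  rw [List.length_replicate] at h2
  rw [outStr, h1, matrices, List.flatMap_append, ← h2,
    emit_out_eq (n := size φ) fun p hp => length_word_of_mem_slots hp]
  simp [lastStr, Stk.of]

theorem encodeMatrices_get {n : ℕ} (l : List (Matrix (Fin n) (Fin n) ℚ)) :
    encodeMatrices n l.length l.get = l.flatMap encodeMatrix := by
  conv_rhs => rw [← List.ofFn_get l, List.ofFn_eq_map, List.flatMap_map]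
  rfl

/-! ### Which slots occur -/

theorem mem_allClauseSlots {pre k : ℕ} {p : Sym × List Sym} :
    p ∈ allClauseSlots pre k ↔ ∃ q < k, p ∈ clauseSlots (pre + 3 * q) (3 * (k - 1 - q)) := by
  induction k generalizing pre with
  | zero => simp [allClauseSlots]
  | succ k ih =>
    rw [allClauseSlots, List.mem_append, ih]
    constructor
    · rintro (h | ⟨q, hq, h⟩)
      · exact ⟨0, by omega, h⟩
      · refine ⟨q + 1, by omega, ?_⟩
        rwa [show pre + 3 * (q + 1) = pre + 3 + 3 * q by ring,
          show k + 1 - 1 - (q + 1) = k - 1 - q by omega]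
    · rintro ⟨_ | q, hq, h⟩
      · exact Or.inl h
      · refine Or.inr ⟨q, by omega, ?_⟩
        rwa [show pre + 3 * (q + 1) = pre + 3 + 3 * q by ring,
          show k + 1 - 1 - (q + 1) = k - 1 - q by omega] at h

theorem mem_pairSlotsWith {pre mid : ℕ} {u : List Bool} {l : List (List Bool)}
    {p : Sym × List Sym} :
    p ∈ pairSlotsWith pre u mid l ↔ ∃ (t : ℕ) (ht : t < l.length),
      p = (some true, pairWord pre (mid + t) (l.length - 1 - t)) ∨
      p = (some (!decide (u = flipHead l[t])), pairWord pre (mid + t) (l.length - 1 - t)) := by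
  induction l generalizing mid with
  | nil => simp [pairSlotsWith]
  | cons w l ih =>
    have h (t : ℕ) : mid + (t + 1) = mid + 1 + t := by ring
    have h' (t : ℕ) : l.length + 1 - 1 - (t + 1) = l.length - 1 - t := by omega
    simp only [pairSlotsWith, List.mem_cons, ih, List.length_cons]
    constructor
    · rintro (rfl | rfl | ⟨t, ht, hp⟩)
      · exact ⟨0, by omega, Or.inl rfl⟩
      · exact ⟨0, by omega, Or.inr rfl⟩
      · refine ⟨t + 1, by omega, ?_⟩
        rw [h, h']
        exact hp
    · rintro ⟨_ | t, ht, hp⟩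
      · exact hp.imp_right Or.inl
      · rw [h, h'] at hp
        exact Or.inr (Or.inr ⟨t, by omega, hp⟩)

theorem mem_pairSlots {pre : ℕ} {l : List (List Bool)} {p : Sym × List Sym} :
    p ∈ pairSlots pre l ↔ ∃ (i j : ℕ) (hij : i < j) (hj : j < l.length),
      p = (some true, pairWord (pre + i) (j - i - 1) (l.length - 1 - j)) ∨
      p = (some (!decide (l[i] = flipHead l[j])),
        pairWord (pre + i) (j - i - 1) (l.length - 1 - j)) := by
  induction l generalizing pre with
  | nil => simp [pairSlots]
  | cons u l ih =>
    simp only [pairSlots, List.mem_append, ih, mem_pairSlotsWith, List.length_cons]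
    constructor
    · rintro (⟨t, ht, h⟩ | ⟨i, j, hij, hj, h⟩)
      · refine ⟨0, t + 1, by omega, by omega, ?_⟩
        rw [show t + 1 - 0 - 1 = 0 + t by omega,
          show l.length + 1 - 1 - (t + 1) = l.length - 1 - t by omega]
        exact h
      · refine ⟨i + 1, j + 1, by omega, by omega, ?_⟩
        rw [show pre + (i + 1) = pre + 1 + i by ring, show j + 1 - (i + 1) - 1 = j - i - 1 by omega,
          show l.length + 1 - 1 - (j + 1) = l.length - 1 - j by omega]
        exact h
    · rintro ⟨_ | i, _ | j, hij, hj, h⟩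
      · omega
      · refine Or.inl ⟨j, by omega, ?_⟩
        rw [show j + 1 - 0 - 1 = 0 + j by omega,
          show l.length + 1 - 1 - (j + 1) = l.length - 1 - j by omega] at h
        exact h
      · omega
      · refine Or.inr ⟨i, j, by omega, by omega, ?_⟩
        rw [show pre + (i + 1) = pre + 1 + i by ring, show j + 1 - (i + 1) - 1 = j - i - 1 by omega,
          show l.length + 1 - 1 - (j + 1) = l.length - 1 - j by omega] at h
        exact h

theorem clauseWord_eq_pairWord₁ (pre post : ℕ) :
    clauseWord none (some false) (some true) none pre post = pairWord (pre + 2) 0 (post + 1) := by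
  simp [clauseWord, pairWord, List.replicate_succ]

theorem clauseWord_eq_pairWord₂ (pre post : ℕ) :
    clauseWord none (some false) none (some true) pre post = pairWord (pre + 2) 1 post := by
  simp [clauseWord, pairWord, List.replicate_succ]

theorem clauseWord_eq_pairWord₃ (pre post : ℕ) :
    clauseWord none none (some false) (some true) pre post = pairWord (pre + 3) 0 post := by
  rw [clauseWord, pairWord, show pre + 3 = pre + 1 + 2 by ring, List.replicate_succ,
    List.replicate_succ, List.replicate_succ']
  simp

/-- A slot either has four nonzero coefficients and linear mode, or belongs to a pair. -/
theorem slot_cases {φ : Formula3} {p : Sym × List Sym} (hp : p ∈ slots φ) :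
    (p.1 = none ∧ (p.2.map fun e => sgn e ^ 2).sum = 4) ∨
      ∃ e pre mid post, p = (some e, pairWord pre mid post) := by
  rcases List.mem_append.1 hp with hp | hp
  · obtain ⟨q, -, hp⟩ := mem_allClauseSlots.1 hp
    simp only [clauseSlots, clauseWord_eq_pairWord₁, clauseWord_eq_pairWord₂,
      clauseWord_eq_pairWord₃, List.mem_cons, List.not_mem_nil, or_false] at hp
    rcases hp with rfl | rfl | rfl | rfl
    · left
      simp [clauseWord, sgn]
      norm_num
    all_goals exact Or.inr ⟨_, _, _, _, rfl⟩
  · obtain ⟨i, j, -, -, rfl | rfl⟩ := mem_pairSlots.1 hp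
    all_goals exact Or.inr ⟨_, _, _, _, rfl⟩

/-! ### The matrices of a slot -/

section slotMatrix

variable {ι : Type} [DecidableEq ι] (z : ι) (s : ℕ)

theorem slotMatrix_none (w : ι → Sym) (c : ι) :
    slotMatrix z s none w c = of fun r d => if d = c then sgn (w r) / 2 ^ s else 0 := by
  ext r d
  by_cases h : d = c <;> simp [slotMatrix, coef, h, sgn]

/-- The word of the pair `i`, `j` as a function of the coordinate. -/
def pairFn (i j : ι) (p : ι) : Sym :=
  if p = i then some false else if p = j then some true else none

theorem slotMatrix_pair_left (e : Bool) {i j : ι} (hij : i ≠ j) :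
    slotMatrix z s (some e) (pairFn i j) i =
      single i j (1 / 2 ^ s) + single j i (sgn (some e) / 2 ^ s) := by
  ext r d
  have hji := hij.symm
  rw [slotMatrix, of_apply, Matrix.add_apply, single_apply, single_apply]
  by_cases h1 : r = i
  · subst h1
    by_cases h3 : d = j
    · subst h3
      simp [pairFn, coef, hji, sgn]
    · by_cases h4 : d = r <;> simp [pairFn, coef, hji, sgn, h3, h4, Ne.symm h3]
  · by_cases h2 : r = j
    · subst h2
      by_cases h4 : d = i
      · subst h4
        simp [pairFn, coef, hji, hij, sgn]
      · by_cases h3 : d = r <;> simp [pairFn, coef, hji, hij, sgn, h3, h4, Ne.symm h4]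
    · simp [pairFn, coef, h1, h2, Ne.symm h1, Ne.symm h2, sgn]

theorem slotMatrix_pair_right (e : Bool) {i j : ι} (hij : i ≠ j) :
    slotMatrix z s (some e) (pairFn i j) j = 0 := by
  ext r d
  simp [slotMatrix, pairFn, coef, hij.symm, sgn]

theorem slotMatrix_junk (e : Bool) {w : ι → Sym} {c : ι} (hc : w c = none) :
    slotMatrix z s (some e) w c = single z c (1 / 2 ^ s) := by
  ext r d
  rw [slotMatrix, of_apply, single_apply]
  by_cases h1 : r = z <;> by_cases h2 : d = c <;>
    simp [coef, hc, h1, h2, sgn, eq_comm (a := z), eq_comm (a := c)]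

theorem pairFn_of_ne {i j c : ι} (hi : c ≠ i) (hj : c ≠ j) : pairFn i j c = none := by
  simp [pairFn, hi, hj]

variable [Fintype ι]

theorem gram_none (w : ι → Sym) :
    ∑ c, (slotMatrix z s none w c)ᵀ * slotMatrix z s none w c =
      ((∑ r, sgn (w r) ^ 2) / 4 ^ s) • (1 : Matrix ι ι ℚ) := by
  ext d d'
  have h4 : (4 : ℚ) ^ s = 2 ^ s * 2 ^ s := by rw [← mul_pow]; norm_num
  simp only [slotMatrix_none, Matrix.sum_apply, mul_apply, transpose_apply, of_apply,
    Matrix.smul_apply,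
    one_apply, smul_eq_mul, ite_mul, mul_ite, zero_mul, mul_zero]
  by_cases h : d = d'
  · subst h
    simp only [if_true, mul_one]
    rw [Finset.sum_eq_single d (by intro c _ hc; simp [Ne.symm hc]) (by simp)]
    simp only [if_true]
    rw [Finset.sum_div]
    refine Finset.sum_congr rfl fun r _ => ?_
    rw [h4]
    ring
  · simp only [h, if_false]
    refine Finset.sum_eq_zero fun c _ => Finset.sum_eq_zero fun r _ => ?_
    by_cases h1 : d' = c
    · subst h1
      simp [h]
    · simp [h1]

theorem gram_junk (e : Bool) {w : ι → Sym} {c : ι} (hc : w c = none) :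
    (slotMatrix z s (some e) w c)ᵀ * slotMatrix z s (some e) w c = single c c (1 / 4 ^ s) := by
  have h4 : (4 : ℚ) ^ s = 2 ^ s * 2 ^ s := by rw [← mul_pow]; norm_num
  rw [slotMatrix_junk z s e hc, transpose_single, single_mul_single_same, h4]
  congr 1
  ring

theorem sum_single_self (a : ℚ) : ∑ c : ι, single c c a = a • (1 : Matrix ι ι ℚ) := by
  ext d d'
  by_cases h : d = d'
  · subst h
    simp [Matrix.sum_apply, single_apply]
  · simp only [Matrix.sum_apply, single_apply, Matrix.smul_apply, one_apply, h, if_false, smul_zero]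
    refine Finset.sum_eq_zero fun c _ => if_neg ?_
    rintro ⟨rfl, rfl⟩
    exact h rfl

theorem gram_last (e : Bool) {w : ι → Sym} (hw : ∀ c, w c = none) :
    ∑ c, (slotMatrix z s (some e) w c)ᵀ * slotMatrix z s (some e) w c =
      (1 / 4 ^ s : ℚ) • (1 : Matrix ι ι ℚ) := by
  rw [← sum_single_self]
  exact Finset.sum_congr rfl fun c _ => gram_junk z s e (hw c)

theorem gram_pair (e : Bool) {i j : ι} (hij : i ≠ j) :
    ∑ c, (slotMatrix z s (some e) (pairFn i j) c)ᵀ * slotMatrix z s (some e) (pairFn i j) c =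
      (1 / 4 ^ s : ℚ) • (1 : Matrix ι ι ℚ) := by
  have h4 : (4 : ℚ) ^ s = 2 ^ s * 2 ^ s := by rw [← mul_pow]; norm_num
  have he : sgn (some e) / 2 ^ s * (sgn (some e) / 2 ^ s) = 1 / 4 ^ s := by
    rw [h4]
    cases e
    · simp [sgn]
    · simp only [sgn]; ring
  have h1 : (1 : ℚ) / 2 ^ s * (1 / 2 ^ s) = 1 / 4 ^ s := by rw [h4]; ring
  have hj : j ∈ Finset.univ.erase i := by simp [hij.symm]
  rw [← sum_single_self, ← Finset.add_sum_erase _ _ (Finset.mem_univ i),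
    ← Finset.add_sum_erase _ _ hj, ← Finset.add_sum_erase _ _ (Finset.mem_univ i),
    ← Finset.add_sum_erase _ (fun c => single c c _) hj, ← add_assoc, ← add_assoc]
  congr 1
  · rw [slotMatrix_pair_left z s e hij, slotMatrix_pair_right z s e hij, transpose_add,
      transpose_single, transpose_single, Matrix.add_mul, Matrix.mul_add, Matrix.mul_add,
      single_mul_single_same, single_mul_single_same, single_mul_single_of_ne _ _ _ _ hij,
      single_mul_single_of_ne _ _ _ _ hij.symm, he, h1]
    simp [add_comm]
  · refine Finset.sum_congr rfl fun c hc => gram_junk z s e (pairFn_of_ne ?_ ?_)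
    · simp only [Finset.mem_erase] at hc; exact hc.2.1
    · simp only [Finset.mem_erase] at hc; exact hc.1

end slotMatrix

/-! ### Unitality -/

/-- The coordinate at a given place of a word. -/
def coord {n p : ℕ} (hp : p < n) : Fin n := Fin.rev ⟨p, hp⟩

theorem eq_coord_iff {n p : ℕ} (hp : p < n) (i : Fin n) : i = coord hp ↔ i.rev.val = p := by
  rw [coord, ← Fin.rev_eq_iff, Fin.ext_iff]

theorem revGet_pairWord {n pre mid post : ℕ} (h₁ : pre < n) (h₂ : pre + mid + 1 < n)
    (hn : pre + mid + post + 2 = n) :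
    revGet (pairWord pre mid post) = pairFn (coord h₁) (coord h₂) := by
  funext i
  simp only [pairFn, eq_coord_iff, revGet]
  have hi := i.rev.isLt
  generalize i.rev.val = t at hi
  rw [pairWord, List.getD_eq_getElem?_getD]
  rcases lt_trichotomy t pre with h | rfl | h
  · rw [List.getElem?_append_left (by simpa using h), List.getElem?_replicate_of_lt h,
      if_neg (by omega), if_neg (by omega)]
    rfl
  · rw [List.getElem?_append_right (by simp)]
    simp
  · obtain ⟨t, rfl⟩ := Nat.exists_eq_add_of_lt h
    rw [List.getElem?_append_right (by simp; omega), List.length_replicate,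
      show pre + t + 1 - pre = t + 1 by omega, List.getElem?_cons_succ, if_neg (by omega)]
    rcases lt_trichotomy t mid with h | rfl | h
    · rw [List.getElem?_append_left (by simpa using h), List.getElem?_replicate_of_lt h,
        if_neg (by omega)]
      rfl
    · rw [List.getElem?_append_right (by simp), if_pos rfl]
      simp
    · obtain ⟨t, rfl⟩ := Nat.exists_eq_add_of_lt h
      rw [List.getElem?_append_right (by simp; omega), List.length_replicate,
        show mid + t + 1 - mid = t + 1 by omega, List.getElem?_cons_succ,
        List.getElem?_replicate_of_lt (by omega), if_neg (by omega)]
      rfl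

theorem sum_revGet {n : ℕ} {w : List Sym} (hw : w.length = n) (f : Sym → ℚ) :
    ∑ i : Fin n, f (revGet w i) = (w.map f).sum := by
  subst hw
  rw [← Equiv.sum_comp Fin.revPerm, ← List.sum_ofFn]
  congr 1
  refine List.ext_getElem (by simp) fun i h₁ h₂ => ?_
  simp only [List.length_ofFn] at h₁
  simp [revGet]

/-- The sum of the Gram matrices of the matrices in a list. -/
def gram {n : ℕ} (l : List (Matrix (Fin n) (Fin n) ℚ)) : Matrix (Fin n) (Fin n) ℚ :=
  (l.map fun A => Aᵀ * A).sum

theorem gram_append {n : ℕ} (l l' : List (Matrix (Fin n) (Fin n) ℚ)) :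
    gram (l ++ l') = gram l + gram l' := by
  simp [gram]

theorem gram_family {n : ℕ} [NeZero n] (s : ℕ) (mode : Sym) (w : List Sym) :
    gram (family (n := n) s mode w) =
      ∑ c, (slotMatrix (Fin.rev 0) s mode (revGet w) c)ᵀ *
        slotMatrix (Fin.rev 0) s mode (revGet w) c := by
  rw [gram, family, List.map_map, Fin.sum_univ_def]
  rfl

theorem gram_slot {φ : Formula3} {p : Sym × List Sym} (hp : p ∈ slots φ) (s : ℕ) :
    gram (family (n := size φ) (expo p.1 s) p.1 p.2) = (1 / 4 ^ s : ℚ) • 1 := by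
  have hlen := length_word_of_mem_slots hp
  rw [gram_family]
  rcases slot_cases hp with ⟨h, h4⟩ | ⟨e, pre, mid, post, rfl⟩
  · rw [h, gram_none, sum_revGet hlen fun e => sgn e ^ 2, h4]
    congr 1
    simp only [expo, Option.isNone_none, if_true, pow_succ]
    field_simp
  · rw [length_pairWord] at hlen
    rw [revGet_pairWord (by omega) (by omega) hlen, gram_pair]
    · rfl
    · rw [Ne, eq_coord_iff, coord, Fin.rev_rev]
      simp only
      omega

theorem gram_slotsMatrices {φ : Formula3} {l : List (Sym × List Sym)} (hl : ∀ p ∈ l, p ∈ slots φ)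
    (s : ℕ) : gram (slotsMatrices (n := size φ) (s + 1) l) =
      (1 / 4 ^ s - 1 / 4 ^ (s + l.length) : ℚ) • 1 := by
  induction l generalizing s with
  | nil => simp [slotsMatrices, gram]
  | cons p l ih =>
    rw [slotsMatrices, gram_append, gram_append, gram_append, gram_slot (hl p (by simp)),
      ih (fun q hq => hl q (by simp [hq])), ← add_smul, ← add_smul, ← add_smul]
    congr 1
    rw [List.length_cons, show s + (l.length + 1) = s + 1 + l.length by ring, pow_succ]
    field_simp
    ring

/-- The scales are chosen such that the Gram matrices of the first `s` slots sum to
`1 - 4 ^ (-s)`; the last family makes up the difference. -/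
theorem gram_matrices (φ : Formula3) : gram (matrices φ) = 1 := by
  have h : ∀ c : Fin (size φ), revGet (List.replicate (size φ) none) c = none := by
    intro c
    simp [revGet]
  rw [matrices, gram_append, gram_family, gram_last _ _ _ h,
    gram_slotsMatrices (fun p hp => hp) 0, ← add_smul]
  simp

theorem toComplex_eq {n : ℕ} (A : Matrix (Fin n) (Fin n) ℚ) :
    toComplex A = (Rat.castHom ℂ).mapMatrix A := rfl

theorem unital_matrices (φ : Formula3) :
    ∑ i, (toComplex ((matrices φ).get i))ᴴ * toComplex ((matrices φ).get i) = 1 := by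
  have h1 (A : Matrix (Fin (size φ)) (Fin (size φ)) ℚ) :
      (toComplex A)ᴴ * toComplex A = (Rat.castHom ℂ).mapMatrix (Aᵀ * A) := by
    rw [map_mul, ← toComplex_eq]
    congr 1
    ext i j
    simp [toComplex]
  have h2 := gram_matrices φ
  rw [gram, ← List.ofFn_get (matrices φ), List.map_ofFn, List.sum_ofFn] at h2
  simp only [h1, ← map_sum]
  simp only [Function.comp_def] at h2
  rw [h2, map_one]

/-- The instance attached to a formula. -/
def instanceOf (φ : Formula3) : UnitalInstance where
  n := size φ
  n_pos := by simp
  m := (matrices φ).length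
  V := (matrices φ).get
  unital := unital_matrices φ

theorem encode_instanceOf (φ : Formula3) : encodeUnitalInstance (instanceOf φ) = outStr φ := by
  rw [outStr_eq, ← encodeMatrices_get]
  rfl

/-! ### The equations of the slots -/

/-- The bilinear form of a rational matrix on complex vectors. -/
noncomputable def bil {n : ℕ} (A : Matrix (Fin n) (Fin n) ℚ) (x y : Fin n → ℂ) : ℂ :=
  x ⬝ᵥ (toComplex A *ᵥ y)

/-- The value at a place of a word, which is `0` beyond the end of the word. -/
noncomputable def val {n : ℕ} (x : Fin n → ℂ) (p : ℕ) : ℂ :=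
  if hp : p < n then x (coord hp) else 0

section bil

variable {n : ℕ} (x y : Fin n → ℂ)

theorem val_of_lt {p : ℕ} (hp : p < n) : val x p = x (coord hp) := dif_pos hp

theorem val_rev (i : Fin n) : val x i.rev = x i := by
  rw [val_of_lt x i.rev.isLt, coord, Fin.eta, Fin.rev_rev]

theorem bil_add (A B : Matrix (Fin n) (Fin n) ℚ) : bil (A + B) x y = bil A x y + bil B x y := by
  simp only [bil, toComplex_eq, map_add, add_mulVec, dotProduct_add]

theorem bil_smul (a : ℚ) (A : Matrix (Fin n) (Fin n) ℚ) : bil (a • A) x y = a * bil A x y := by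
  have h : toComplex (a • A) = (a : ℂ) • toComplex A := by
    ext i j
    simp [toComplex]
  rw [bil, bil, h, smul_mulVec, dotProduct_smul, smul_eq_mul]

theorem bil_zero : bil 0 x y = 0 := by
  simp [bil, toComplex_eq]

theorem bil_single (i j : Fin n) (a : ℚ) : bil (single i j a) x y = a * (x i * y j) := by
  have h : toComplex (single i j a) = single i j (a : ℂ) := by
    ext r d
    rw [toComplex, map_apply, single_apply, single_apply]
    split_ifs <;> simp
  simp only [bil, h, dotProduct, mulVec, single_apply, ite_and, ite_mul, zero_mul]
  rw [Finset.sum_eq_single i (by intro r _ hr; simp [Ne.symm hr]) (by simp)]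
  simp
  ring

theorem bil_none (w : Fin n → Sym) (z c : Fin n) :
    bil (slotMatrix z 0 none w c) x y = (∑ r, x r * (sgn (w r) : ℂ)) * y c := by
  have h (r : Fin n) : (toComplex (slotMatrix z 0 none w c) *ᵥ y) r = (sgn (w r) : ℂ) * y c := by
    simp [slotMatrix_none, toComplex, mulVec, dotProduct, apply_ite]
  simp only [bil, dotProduct, h, Finset.sum_mul, mul_assoc]

theorem slotMatrix_eq_smul (z : Fin n) (s : ℕ) (mode : Sym) (w : Fin n → Sym) (c : Fin n) :
    slotMatrix z s mode w c = (1 / 2 ^ s : ℚ) • slotMatrix z 0 mode w c := by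
  ext r d
  simp only [slotMatrix, of_apply, Matrix.smul_apply, smul_eq_mul, pow_zero, div_one]
  ring

theorem bil_slotMatrix_eq_zero_iff (z : Fin n) (s : ℕ) (mode : Sym) (w : Fin n → Sym)
    (c : Fin n) :
    bil (slotMatrix z s mode w c) x y = 0 ↔ bil (slotMatrix z 0 mode w c) x y = 0 := by
  rw [slotMatrix_eq_smul, bil_smul]
  simp

/-- The equations of a slot. -/
def SlotHolds [NeZero n] (p : Sym × List Sym) : Prop :=
  ∀ c, bil (slotMatrix (Fin.rev 0) 0 p.1 (revGet p.2) c) x y = 0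

theorem forall_mem_family [NeZero n] (s : ℕ) (mode : Sym) (w : List Sym) :
    (∀ A ∈ family (n := n) s mode w, bil A x y = 0) ↔ SlotHolds x y (mode, w) := by
  simp only [family, List.mem_map, List.mem_finRange, true_and, forall_exists_index,
    forall_apply_eq_imp_iff, SlotHolds, bil_slotMatrix_eq_zero_iff x y _ s]

theorem forall_mem_slotsMatrices [NeZero n] (s : ℕ) (l : List (Sym × List Sym)) :
    (∀ A ∈ slotsMatrices (n := n) s l, bil A x y = 0) ↔ ∀ p ∈ l, SlotHolds x y p := by
  induction l generalizing s with
  | nil => simp [slotsMatrices]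
  | cons p l ih =>
    simp only [slotsMatrices, List.mem_append, or_self, or_imp, forall_and, ih,
      forall_mem_family, List.forall_mem_cons]
    exact and_comm

theorem coord_zero [NeZero n] : (Fin.rev 0 : Fin n) = coord (NeZero.pos n) := rfl

theorem slotHolds_last [NeZero n] :
    SlotHolds x y (some true, List.replicate n none) ↔ ∀ c < n, val x 0 * val y c = 0 := by
  have h (c : Fin n) : revGet (List.replicate n none) c = none := by simp [revGet]
  have h' (c : Fin n) : bil (slotMatrix (Fin.rev 0) 0 (some true)
      (revGet (List.replicate n none)) c) x y = val x 0 * val y c.rev := by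
    rw [slotMatrix_junk _ _ _ (h c), bil_single, val_rev, coord_zero, ← val_of_lt x]
    simp
  simp only [SlotHolds, h']
  constructor
  · intro h c hc
    simpa using h (Fin.rev ⟨c, hc⟩)
  · intro h c
    exact h _ c.rev.isLt

theorem slotHolds_pair [NeZero n] (e : Bool) {i j : ℕ} (hij : i < j) (hj : j < n) :
    SlotHolds x y (some e, pairWord i (j - i - 1) (n - 1 - j)) ↔
      val x i * val y j + sgn (some e) * (val x j * val y i) = 0 ∧
        ∀ c < n, c ≠ i → c ≠ j → val x 0 * val y c = 0 := by
  have hi : i < n := hij.trans hj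
  have hij' : coord hi ≠ coord hj := by
    rw [Ne, eq_coord_iff, coord, Fin.rev_rev]
    simp only
    omega
  have hw : revGet (pairWord i (j - i - 1) (n - 1 - j)) = pairFn (coord hi) (coord hj) := by
    rw [revGet_pairWord hi (by omega) (by omega)]
    congr 2
    omega
  have h₁ : bil (slotMatrix (Fin.rev 0) 0 (some e) (pairFn (coord hi) (coord hj)) (coord hi)) x y =
      val x i * val y j + sgn (some e) * (val x j * val y i) := by
    rw [slotMatrix_pair_left _ _ _ hij', bil_add, bil_single, bil_single, val_of_lt x hi,
      val_of_lt x hj, val_of_lt y hi, val_of_lt y hj]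
    simp
  have h₂ : bil (slotMatrix (Fin.rev 0) 0 (some e) (pairFn (coord hi) (coord hj)) (coord hj)) x y =
      0 := by
    rw [slotMatrix_pair_right _ _ _ hij', bil_zero]
  have h₃ (c : Fin n) (hci : c ≠ coord hi) (hcj : c ≠ coord hj) :
      bil (slotMatrix (Fin.rev 0) 0 (some e) (pairFn (coord hi) (coord hj)) c) x y =
        val x 0 * val y c.rev := by
    rw [slotMatrix_junk _ _ _ (pairFn_of_ne hci hcj), bil_single, val_rev, coord_zero,
      ← val_of_lt x]
    simp
  simp only [SlotHolds, hw]
  constructor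
  · intro h
    refine ⟨h₁ ▸ h _, fun c hc hci hcj => ?_⟩
    have h' := h₃ (coord hc) (by rw [Ne, eq_coord_iff, coord, Fin.rev_rev]; exact hci)
      (by rw [Ne, eq_coord_iff, coord, Fin.rev_rev]; exact hcj)
    rw [h, coord, Fin.rev_rev] at h'
    exact h'.symm
  · rintro ⟨h, h'⟩ c
    by_cases hci : c = coord hi
    · rw [hci, h₁, h]
    by_cases hcj : c = coord hj
    · rw [hcj, h₂]
    rw [h₃ c hci hcj]
    rw [eq_coord_iff] at hci hcj
    exact h' _ c.rev.isLt hci hcj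

theorem getD_clauseWord (h e : Sym) (pre post t : ℕ) :
    (clauseWord h e e e pre post).getD t none =
      if t = 1 then h else if t = pre + 2 ∨ t = pre + 3 ∨ t = pre + 4 then e else none := by
  rw [List.getD_eq_getElem?_getD, clauseWord]
  obtain _ | _ | t := t
  · simp
  · simp
  rw [List.getElem?_cons_succ, List.getElem?_cons_succ, List.append_assoc, if_neg (by omega)]
  by_cases h : t < pre
  · rw [List.getElem?_append_left (by simpa using h), List.getElem?_replicate_of_lt h,
      if_neg (by omega)]
    rfl
  obtain ⟨t, rfl⟩ := Nat.exists_eq_add_of_le (not_lt.1 h)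
  rw [List.getElem?_append_right (by simp), List.length_replicate, Nat.add_sub_cancel_left]
  obtain _ | _ | _ | t := t
  · simp
  · simp
  · simp
  rw [if_neg (by omega)]
  by_cases h : t < post
  · simp [List.getElem?_replicate_of_lt h]
  · simp [h]

theorem slotHolds_clause [NeZero n] {pre post : ℕ} (hn : pre + post + 5 = n) :
    SlotHolds x y (none, clauseWord (some true) (some false) (some false) (some false) pre post) ↔
      ∀ c < n, (val x (pre + 2) + val x (pre + 3) + val x (pre + 4) - val x 1) * val y c = 0 := by
  have hsum : ∑ r : Fin n, x r * (sgn (revGet (clauseWord (some true) (some false) (some false)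
      (some false) pre post) r) : ℂ) =
      val x (pre + 2) + val x (pre + 3) + val x (pre + 4) - val x 1 := by
    have h (r : Fin n) : x r * (sgn (revGet (clauseWord (some true) (some false) (some false)
        (some false) pre post) r) : ℂ) =
        (if r = coord (show pre + 2 < n by omega) then x r else 0) +
        (if r = coord (show pre + 3 < n by omega) then x r else 0) +
        (if r = coord (show pre + 4 < n by omega) then x r else 0) -
        (if r = coord (show 1 < n by omega) then x r else 0) := by
      simp only [revGet, getD_clauseWord, eq_coord_iff]
      generalize r.rev.val = t
      by_cases h1 : t = 1
      · subst h1
        rw [if_pos rfl, if_pos rfl, if_neg (by omega), if_neg (by omega), if_neg (by omega)]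
        simp [sgn]
      by_cases h2 : t = pre + 2
      · subst h2
        simp [sgn]
      by_cases h3 : t = pre + 3
      · subst h3
        simp [sgn]
      by_cases h4 : t = pre + 4
      · subst h4
        simp [sgn]
      simp [h1, h2, h3, h4, sgn]
    simp only [h, Finset.sum_add_distrib, Finset.sum_sub_distrib, Finset.sum_ite_eq',
      Finset.mem_univ, if_true, ← val_of_lt]
  simp only [SlotHolds, bil_none, hsum]
  constructor
  · intro h c hc
    rw [val_of_lt y hc]
    exact h _
  · intro h c
    rw [← val_rev y]
    exact h _ c.rev.isLt

end bil

theorem length_labels (φ : Formula3) : (labels φ).length = size φ := by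
  simp [labels, length_literals]

/-- The equations that the instance of a formula imposes on `x` and `y`, whose entries are taken in
the order of the words. -/
structure Sol (φ : Formula3) (X Y : ℕ → ℂ) : Prop where
  junk : ∀ c < size φ, X 0 * Y c = 0
  swap : ∀ i j, i < j → j < size φ → X i * Y j = X j * Y i
  conflict : ∀ i j (hij : i < j) (hj : j < (labels φ).length),
    (labels φ)[i] = flipHead (labels φ)[j] → X i * Y j + X j * Y i = 0
  clause : ∀ q < φ.length, ∀ c < size φ,
    (X (3 * q + 2) + X (3 * q + 3) + X (3 * q + 4) - X 1) * Y c = 0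
  excl : ∀ q < φ.length, ∀ a b, a < b → b < 3 →
    X (3 * q + 2 + a) * Y (3 * q + 2 + b) + X (3 * q + 2 + b) * Y (3 * q + 2 + a) = 0

theorem slotHolds_excl {φ : Formula3} (x y : Fin (size φ) → ℂ) {q a b : ℕ} (hq : q < φ.length)
    (hab : a < b) (hb : b < 3)
    (hjunk : ∀ c < size φ, val x 0 * val y c = 0) {w : List Sym}
    (hw : w = pairWord (3 * q + 2 + a) (b - a - 1) (3 * (φ.length - 1 - q) + (2 - b))) :
    SlotHolds x y (some false, w) ↔
      val x (3 * q + 2 + a) * val y (3 * q + 2 + b) +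
        val x (3 * q + 2 + b) * val y (3 * q + 2 + a) = 0 := by
  have hj : 3 * q + 2 + b < size φ := by simp only [size]; omega
  have h := slotHolds_pair x y false (show 3 * q + 2 + a < 3 * q + 2 + b by omega) hj
  rw [show 3 * q + 2 + b - (3 * q + 2 + a) - 1 = b - a - 1 by omega,
    show size φ - 1 - (3 * q + 2 + b) = 3 * (φ.length - 1 - q) + (2 - b) by
      simp only [size]; omega, ← hw] at h
  rw [h]
  simp only [sgn, Rat.cast_one, one_mul]
  exact and_iff_left fun c hc _ _ => hjunk c hc

theorem forall_bil_iff {φ : Formula3} (x y : Fin (size φ) → ℂ) :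
    (∀ A ∈ matrices φ, bil A x y = 0) ↔ Sol φ (val x) (val y) := by
  have key : (∀ A ∈ matrices φ, bil A x y = 0) ↔ (∀ c < size φ, val x 0 * val y c = 0) ∧
      ∀ p ∈ slots φ, SlotHolds x y p := by
    simp only [matrices, List.mem_append, or_imp, forall_and, forall_mem_family,
      forall_mem_slotsMatrices, slotHolds_last]
  have hclause {q : ℕ} (hq : q < φ.length) := slotHolds_clause x y
    (show 3 * q + 3 * (φ.length - 1 - q) + 5 = size φ by simp only [size]; omega)
  have hw₁ (q : ℕ) : clauseWord none (some false) (some true) none (0 + 3 * q)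
      (3 * (φ.length - 1 - q)) =
      pairWord (3 * q + 2 + 0) (1 - 0 - 1) (3 * (φ.length - 1 - q) + (2 - 1)) := by
    rw [clauseWord_eq_pairWord₁, zero_add]
  have hw₂ (q : ℕ) : clauseWord none (some false) none (some true) (0 + 3 * q)
      (3 * (φ.length - 1 - q)) =
      pairWord (3 * q + 2 + 0) (2 - 0 - 1) (3 * (φ.length - 1 - q) + (2 - 2)) := by
    rw [clauseWord_eq_pairWord₂, zero_add]; rfl
  have hw₃ (q : ℕ) : clauseWord none none (some false) (some true) (0 + 3 * q)
      (3 * (φ.length - 1 - q)) =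
      pairWord (3 * q + 2 + 1) (2 - 1 - 1) (3 * (φ.length - 1 - q) + (2 - 2)) := by
    rw [clauseWord_eq_pairWord₃, zero_add]; rfl
  have hmem {q : ℕ} (hq : q < φ.length) {p : Sym × List Sym}
      (hp : p ∈ clauseSlots (0 + 3 * q) (3 * (φ.length - 1 - q))) : p ∈ slots φ :=
    List.mem_append_left _ (mem_allClauseSlots.2 ⟨q, hq, hp⟩)
  have hpost {j : ℕ} : size φ - 1 - j = (labels φ).length - 1 - j := by rw [length_labels]
  rw [key]
  constructor
  · rintro ⟨hjunk, h⟩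
    have hpair {i j : ℕ} (hij : i < j) (hj : j < (labels φ).length) (e : Bool)
        (he : e = true ∨ e = !decide ((labels φ)[i] = flipHead (labels φ)[j])) :
        val x i * val y j + sgn (some e) * (val x j * val y i) = 0 := by
      rw [length_labels] at hj
      refine ((slotHolds_pair x y e hij hj).1 (h _ (List.mem_append_right _
        (mem_pairSlots.2 ⟨i, j, hij, by rwa [length_labels], ?_⟩)))).1
      rw [zero_add, hpost]
      exact he.imp (fun he => by rw [he]) fun he => by rw [he]
    refine ⟨hjunk, fun i j hij hj => ?_, fun i j hij hj hc => ?_, fun q hq => ?_,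
      fun q hq a b hab hb => ?_⟩
    · have := hpair hij (by rwa [length_labels]) true (Or.inl rfl)
      simp only [sgn, Rat.cast_neg, Rat.cast_one] at this
      linear_combination this
    · have := hpair hij hj false (Or.inr (by simp [hc]))
      simp only [sgn, Rat.cast_one] at this
      linear_combination this
    · refine (hclause hq).1 (h _ (hmem hq ?_))
      simp [clauseSlots]
    · obtain ⟨rfl, rfl⟩ | ⟨rfl, rfl⟩ | ⟨rfl, rfl⟩ :
          (a = 0 ∧ b = 1) ∨ (a = 0 ∧ b = 2) ∨ (a = 1 ∧ b = 2) := by omega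
      · exact (slotHolds_excl x y hq hab hb hjunk (hw₁ q)).1 (h _ (hmem hq (by simp [clauseSlots])))
      · exact (slotHolds_excl x y hq hab hb hjunk (hw₂ q)).1 (h _ (hmem hq (by simp [clauseSlots])))
      · exact (slotHolds_excl x y hq hab hb hjunk (hw₃ q)).1 (h _ (hmem hq (by simp [clauseSlots])))
  · rintro ⟨hjunk, hswap, hconflict, hcl, hexcl⟩
    refine ⟨hjunk, fun p hp => ?_⟩
    rcases List.mem_append.1 hp with hp | hp
    · obtain ⟨q, hq, hp⟩ := mem_allClauseSlots.1 hp
      simp only [clauseSlots, List.mem_cons, List.not_mem_nil, or_false] at hp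
      rcases hp with rfl | rfl | rfl | rfl
      · rw [zero_add]
        exact (hclause hq).2 (hcl q hq)
      · exact (slotHolds_excl x y hq zero_lt_one (by omega) hjunk (hw₁ q)).2
          (hexcl q hq 0 1 (by omega) (by omega))
      · exact (slotHolds_excl x y hq zero_lt_two (by omega) hjunk (hw₂ q)).2
          (hexcl q hq 0 2 (by omega) (by omega))
      · exact (slotHolds_excl x y hq one_lt_two (by omega) hjunk (hw₃ q)).2
          (hexcl q hq 1 2 (by omega) (by omega))
    · obtain ⟨i, j, hij, hj, hp⟩ := mem_pairSlots.1 hp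
      have hj' : j < size φ := by rwa [length_labels] at hj
      have hs := hswap i j hij hj'
      rw [zero_add, ← hpost] at hp
      rcases hp with rfl | rfl
      · refine (slotHolds_pair x y _ hij hj').2 ⟨?_, fun c hc _ _ => hjunk c hc⟩
        simp only [sgn, Rat.cast_neg, Rat.cast_one]
        linear_combination hs
      · refine (slotHolds_pair x y _ hij hj').2 ⟨?_, fun c hc _ _ => hjunk c hc⟩
        by_cases hc : (labels φ)[i] = flipHead (labels φ)[j]
        · simp only [hc, decide_true, Bool.not_true, sgn, Rat.cast_one]
          linear_combination hconflict i j hij hj hc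
        · simp only [hc, decide_false, Bool.not_false, sgn, Rat.cast_neg, Rat.cast_one]
          linear_combination hs

/-! ### Solutions and satisfying assignments -/

theorem literals_getElem (φ : Formula3) {q : ℕ} (hq : q < φ.length) (t : Fin 3)
    (h : 3 * q + t < (literals φ).length) : (literals φ)[3 * q + (t : ℕ)] = φ[q] t := by
  induction φ generalizing q with
  | nil => simp at hq
  | cons c φ ih =>
    have hc : literals (c :: φ) = c 0 :: c 1 :: c 2 :: literals φ := rfl
    simp only [hc]
    obtain _ | q := q
    · fin_cases t <;> rfl
    · have h' : 3 * q + (t : ℕ) < (literals φ).length := by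
        rw [length_literals] at h ⊢
        simp only [List.length_cons] at h
        omega
      have := ih (by simpa using hq) h'
      simp only [show 3 * (q + 1) + (t : ℕ) = 3 * q + t + 1 + 1 + 1 by ring, List.getElem_cons_succ]
      exact this

theorem labels_getElem (φ : Formula3) {p : ℕ} (hp : p < (literals φ).length)
    (h : p + 2 < (labels φ).length) : (labels φ)[p + 2] = (literals φ)[p].bits := by
  simp [labels]

theorem bits_eq_flipHead_iff (l l' : Literal) :
    l.bits = flipHead l'.bits ↔ l.var = l'.var ∧ l.pos = !l'.pos := by
  have h : Function.Injective Computability.encodeNat := fun a b h => by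
    have := congrArg Computability.decodeNat h
    simpa using this
  simp only [Literal.bits, flipHead, List.cons.injEq, h.eq_iff]
  exact and_comm

/-- The first half of the reduction: the literals with a nonzero coordinate can be made true
simultaneously, and every clause has one. -/
theorem Sol.satisfiable {φ : Formula3} {X Y : ℕ → ℂ} (h : Sol φ X Y) {p₀ p₁ : ℕ}
    (hp₀ : p₀ < size φ) (hX : X p₀ ≠ 0) (hp₁ : p₁ < size φ) (hY : Y p₁ ≠ 0) : Satisfiable φ := by
  -- The vectors are proportional, so that a symmetric equation makes one of two coordinates vanish.
  have hswap (i j : ℕ) (hi : i < size φ) (hj : j < size φ) : X i * Y j = X j * Y i := by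
    rcases lt_trichotomy i j with hij | rfl | hij
    · exact h.swap i j hij hj
    · rfl
    · exact (h.swap j i hij hi).symm
  have hXY (i : ℕ) (hi : i < size φ) (hYi : Y i = 0) : X i = 0 := by
    have := hswap i p₁ hi hp₁
    rw [hYi, mul_zero] at this
    exact (mul_eq_zero.1 this).resolve_right hY
  have hprod (i j : ℕ) (hi : i < size φ) (hj : j < size φ) (hij : X i * Y j + X j * Y i = 0) :
      X i = 0 ∨ X j = 0 := by
    have h' : X i * Y j = 0 := by
      have := hswap i j hi hj
      linear_combination (hij + this) / 2
    exact (mul_eq_zero.1 h').imp_right (hXY j hj)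
  have h0 : X 0 = 0 := (mul_eq_zero.1 (h.junk p₁ hp₁)).resolve_right hY
  have hclause (q : ℕ) (hq : q < φ.length) :
      X (3 * q + 2) + X (3 * q + 3) + X (3 * q + 4) = X 1 :=
    sub_eq_zero.1 ((mul_eq_zero.1 (h.clause q hq p₁ hp₁)).resolve_right hY)
  have hexcl (q : ℕ) (hq : q < φ.length) (a b : ℕ) (hab : a < b) (hb : b < 3) :
      X (3 * q + 2 + a) = 0 ∨ X (3 * q + 2 + b) = 0 :=
    hprod _ _ (by simp only [size]; omega) (by simp only [size]; omega) (h.excl q hq a b hab hb)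
  -- If the homogenizing coordinate vanished, so would the coordinates of every clause.
  have h1 : X 1 ≠ 0 := by
    intro h1
    have hzero (q : ℕ) (hq : q < φ.length) (t : ℕ) (ht : t < 3) : X (3 * q + 2 + t) = 0 := by
      have e := hclause q hq
      have e₁ := hexcl q hq 0 1 (by omega) (by omega)
      have e₂ := hexcl q hq 0 2 (by omega) (by omega)
      have e₃ := hexcl q hq 1 2 (by omega) (by omega)
      rw [h1] at e
      have e' : X (3 * q + 2) = 0 ∧ X (3 * q + 3) = 0 ∧ X (3 * q + 4) = 0 := by
        simp only [add_zero, add_assoc, Nat.reduceAdd] at e₁ e₂ e₃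
        rcases e₁ with e₁ | e₁ <;> rcases e₂ with e₂ | e₂ <;> rcases e₃ with e₃ | e₃ <;>
          simp_all
      obtain ⟨f₀, f₁, f₂⟩ := e'
      interval_cases t
      · exact f₀
      · exact f₁
      · exact f₂
    refine hX ?_
    obtain _ | _ | p := p₀
    · exact h0
    · exact h1
    · simp only [size] at hp₀
      have := hzero (p / 3) (by omega) (p % 3) (by omega)
      rwa [show 3 * (p / 3) + 2 + p % 3 = p + 2 by omega] at this
  -- A variable is true if a positive occurrence of it has a nonzero coordinate.
  classical
  refine ⟨fun v => decide (∃ (p : ℕ) (hp : p < (literals φ).length),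
    (literals φ)[p] = ⟨v, true⟩ ∧ X (p + 2) ≠ 0), fun c hc => ?_⟩
  obtain ⟨q, hq, rfl⟩ := List.getElem_of_mem hc
  obtain ⟨t, ht⟩ : ∃ t : Fin 3, X (3 * q + t + 2) ≠ 0 := by
    by_contra! hall
    refine h1 ?_
    rw [← hclause q hq]
    have e₀ := hall 0
    have e₁ := hall 1
    have e₂ := hall 2
    simp only [Fin.val_zero, Fin.val_one, Fin.val_two, add_zero, add_assoc, Nat.reduceAdd]
      at e₀ e₁ e₂
    rw [e₀, e₁, e₂]
    simp
  have hp : 3 * q + (t : ℕ) < (literals φ).length := by rw [length_literals]; omega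
  have hlit := literals_getElem φ hq t hp
  refine ⟨t, ?_⟩
  rw [Literal.Holds]
  cases hpos : (φ[q] t).pos with
  | true =>
    refine decide_eq_true ⟨_, hp, ?_, ht⟩
    rw [hlit, ← hpos]
  | false =>
    refine decide_eq_false ?_
    rintro ⟨p, hp', hlit', ht'⟩
    have hlab := length_labels φ
    have hlen := length_literals φ
    have hne {i j : ℕ} (hi : i < (literals φ).length) (hj : j < (literals φ).length)
        (hv : (literals φ)[i].var = (literals φ)[j].var)
        (hpos : (literals φ)[i].pos = !(literals φ)[j].pos) (hij : i < j)
        (hXi : X (i + 2) ≠ 0) : X (j + 2) = 0 := by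
      refine (hprod (i + 2) (j + 2) (by simp only [size]; omega) (by simp only [size]; omega)
        (h.conflict (i + 2) (j + 2) (by omega) (by simp only [size] at hlab; omega) ?_)
        ).resolve_left
        hXi
      rw [labels_getElem φ hi, labels_getElem φ hj, bits_eq_flipHead_iff]
      exact ⟨hv, hpos⟩
    rcases lt_trichotomy p (3 * q + t) with hlt | rfl | hlt
    · exact ht (hne hp' hp (by rw [hlit', hlit]) (by rw [hlit', hlit, hpos]; rfl) hlt ht')
    · rw [hlit] at hlit'
      rw [hlit'] at hpos
      exact absurd hpos (by simp)
    · exact ht' (hne hp hp' (by rw [hlit', hlit]) (by rw [hlit', hlit, hpos]; rfl) hlt ht)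

/-- The second half of the reduction: the indicator vector of a true literal in each clause, with
homogenizing coordinate `1`, is a solution. -/
theorem exists_sol {φ : Formula3} (h : Satisfiable φ) : ∃ X : ℕ → ℂ, X 1 = 1 ∧ Sol φ X X := by
  obtain ⟨σ, hσ⟩ := h
  -- The choice of a literal that holds, for each clause.
  have hex (q : ℕ) : ∃ t : Fin 3, ∀ hq : q < φ.length, (φ[q] t).Holds σ := by
    by_cases hq : q < φ.length
    · obtain ⟨t, ht⟩ := hσ φ[q] (List.getElem_mem hq)
      exact ⟨t, fun _ => ht⟩
    · exact ⟨0, fun hq' => absurd hq' hq⟩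
  choose t ht using hex
  let X : ℕ → ℂ := fun p => match p with
    | 0 => 0
    | 1 => 1
    | p + 2 => if p % 3 = t (p / 3) then 1 else 0
  have hX (q a : ℕ) (ha : a < 3) : X (3 * q + 2 + a) = if a = t q then 1 else 0 := by
    have e : 3 * q + 2 + a = (3 * q + a) + 2 := by ring
    rw [e]
    change (if (3 * q + a) % 3 = t ((3 * q + a) / 3) then (1 : ℂ) else 0) = _
    rw [show (3 * q + a) % 3 = a by omega, show (3 * q + a) / 3 = q by omega]
  have hholds (p : ℕ) (hp : p < (literals φ).length) (hXp : X (p + 2) ≠ 0) :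
      (literals φ)[p].Holds σ := by
    have hp' := hp
    rw [length_literals] at hp'
    have e : p = 3 * (p / 3) + p % 3 := by omega
    have h1 : p % 3 = t (p / 3) := by
      by_contra hne
      exact hXp (if_neg hne)
    have h2 := literals_getElem φ (show p / 3 < φ.length by omega) (t (p / 3)) (by omega)
    have h3 := ht (p / 3) (by omega)
    rw [← h2] at h3
    convert h3 using 2
    omega
  refine ⟨X, rfl, ⟨fun c _ => zero_mul _, fun i j _ _ => mul_comm _ _, ?_, ?_, ?_⟩⟩
  · intro i j hij hj hlab
    suffices X i * X j = 0 by linear_combination 2 * this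
    -- The first two coordinates have empty labels, so that `j` is a literal unless `i = 0`.
    have hlen := length_labels φ
    have hlen' := length_literals φ
    simp only [size] at hlen
    obtain _ | _ | j := j
    · omega
    · obtain rfl : i = 0 := by omega
      exact zero_mul _
    obtain _ | _ | i := i
    · exact zero_mul _
    · rw [labels_getElem φ (p := j) (by omega)] at hlab
      exact absurd hlab (by simp [labels, Literal.bits, flipHead])
    rw [labels_getElem φ (p := i) (by omega), labels_getElem φ (p := j) (by omega),
      bits_eq_flipHead_iff] at hlab
    by_contra hne
    obtain ⟨hi, hj⟩ := mul_ne_zero_iff.1 hne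
    have h1 := hholds i (by omega) hi
    have h2 := hholds j (by omega) hj
    rw [Literal.Holds] at h1 h2
    rw [hlab.1, h2, hlab.2] at h1
    simp at h1
  · intro q hq c hc
    have e₀ := hX q 0 (by omega)
    have e₁ := hX q 1 (by omega)
    have e₂ := hX q 2 (by omega)
    simp only [add_zero, add_assoc, Nat.reduceAdd] at e₀ e₁ e₂
    rw [e₀, e₁, e₂]
    suffices ((if 0 = (t q : ℕ) then 1 else 0) + (if 1 = (t q : ℕ) then 1 else 0) +
        (if 2 = (t q : ℕ) then 1 else 0) : ℂ) - X 1 = 0 by rw [this, zero_mul]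
    change _ - (1 : ℂ) = 0
    generalize t q = s
    fin_cases s <;> simp
  · intro q hq a b hab hb
    rw [hX q a (by omega), hX q b hb]
    by_cases ha : a = t q
    · simp [show b ≠ t q by omega]
    · simp [ha]

theorem feasible_instanceOf_iff (φ : Formula3) : (instanceOf φ).Feasible ↔ Satisfiable φ := by
  have key (x y : Fin (size φ) → ℂ) :
      (∀ i, bil ((matrices φ).get i) x y = 0) ↔ Sol φ (val x) (val y) := by
    rw [← forall_bil_iff, List.forall_mem_iff_get]
  have hne {x : Fin (size φ) → ℂ} (hx : x ≠ 0) : ∃ p < size φ, val x p ≠ 0 := by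
    obtain ⟨i, hi⟩ := Function.ne_iff.1 hx
    exact ⟨i.rev, i.rev.isLt, by rwa [val_rev]⟩
  constructor
  · rintro ⟨x, y, hx, hy, h⟩
    obtain ⟨p₀, hp₀, hX⟩ := hne hx
    obtain ⟨p₁, hp₁, hY⟩ := hne hy
    exact ((key x y).1 h).satisfiable hp₀ hX hp₁ hY
  · intro h
    obtain ⟨X, hX1, hX⟩ := exists_sol h
    let x : Fin (size φ) → ℂ := fun i => X i.rev
    have hval (p : ℕ) (hp : p < size φ) : val x p = X p := by
      rw [val_of_lt x hp]
      simp only [x, coord, Fin.rev_rev]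
    have hx : x ≠ 0 := by
      intro hx
      have := hval 1 (by simp)
      rw [hx, hX1] at this
      simp [val] at this
    refine ⟨x, x, hx, hx, (key x x).2 ?_⟩
    have hlab := length_labels φ
    refine ⟨fun c hc => ?_, fun i j hij hj => ?_, fun i j hij hj he => ?_, fun q hq c hc => ?_,
      fun q hq a b hab hb => ?_⟩
    · rw [hval 0 (by simp), hval c hc]; exact hX.junk c hc
    · rw [hval i (by omega), hval j hj]; exact hX.swap i j hij hj
    · rw [hval i (by omega), hval j (by omega)]; exact hX.conflict i j hij hj he
    · rw [hval _ (by simp only [size]; omega), hval _ (by simp only [size]; omega),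
        hval _ (by simp only [size]; omega), hval 1 (by simp), hval c hc]
      exact hX.clause q hq c hc
    · rw [hval _ (by simp only [size]; omega), hval _ (by simp only [size]; omega)]
      exact hX.excl q hq a b hab hb

end UnitalFeas

theorem mainTheorem2 :
    UnitalFeas.PolyTimeReducible UnitalFeas.threeSAT UnitalFeas.unitalBilinearFeasibility :=
  ⟨UnitalFeas.instanceOf, UnitalFeas.reduction_computable UnitalFeas.encode_instanceOf,
    fun φ => (UnitalFeas.feasible_instanceOf_iff φ).symm⟩
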